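/- **Setting.** Let $T>0$, let $\Gamma\in\mathcal C^{1,1}([0,T],\mathbb R^2)$ be a curve parametrized by arclength, and let $s^\pm\in\mathcal C^{0,1}([0,T])$ be positive. Put $N_\Gamma=(\Gamma')^\perp$ (counterclockwise rotation by $\pi/2$), $\kappa=\Gamma''\cdot N_\Gamma$, $M=\{(s,t): t\in(0,T),\ -s^-(t)<s<s^+(t)\}$, $\Phi(s,t)=\Gamma(t)+sN_\Gamma(t)$ and $\Omega=\Phi(M)$. Assume that the open segments $\{\Gamma(t)+sN_\Gamma(t): -s^-(t)<s<s^+(t)\}$, $t\in[0,T]$, are pairwise disjoint and that $\Omega$ is a bounded Lipschitz domain. Let $\kappa_n\in L^2(0,T)$, and let $r=(\gamma',v,n)^T\in W^{1,2}((0,T),SO(3))$ solve $$r'=\begin{pmatrix}0&\kappa&\kappa_n\\-\kappa&0&0\\-\kappa_n&0&0\end{pmatrix}r\quad\text{a.e. in }(0,T),\qquad r(0)=\mathrm{Id}.$$ Put $\gamma(t)=\int_0^t\gamma'$, define $u:\Omega\to\mathbb R^3$ by $u(\Phi(s,t))=\gamma(t)+s\,v(t)$ for $(s,t)\in M$, and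 let $S=u(\Omega)$. The surface $S$ is called *developable of class $\mathcal C^{k,1}$* (with chart $u$) if $u\in\mathcal C^{k,1}(\overline\Omega,\mathbb R^3)$. Here $\mathcal C^{k,1}(\overline\Omega)$ is the space of functions that are $k$ times continuously differentiable in $\Omega$, with bounded derivatives up to order $k$ and with Lipschitz $k$-th derivative. Put $a_{ij}=(\partial_1u\times\partial_2u)\cdot\partial_i\partial_ju$. The surface $S$ may be merely immersed ($u$ need not be injective). A map $f$ on $S$ is understood as its pull-back $f\circ u$ on $\Omega$, and its regularity is that of the pull-back. Accordingly $\mathrm{id}$ is represented by $u$, the tangential derivative of $f$ in the direction $\partial_iu$ is $\partial_i(f\circ u)$, the tensors $\mathrm{sym}\nabla V$ and $(\nabla\phi)^T\nabla\phi-\mathrm{Id}$ have, in the tangent frame $(\partial_1u,\partial_2u)$, the components $$\tfrac12\big(\partial_i(V\circ u)\cdot\partial_ju+\partial_j(V\circ u)\cdot\partial_iu\big),\qquad \partial_i(\phi\circ u)\cdot\partial_j(\phi\circ u)-\partial_iu\cdot\partial_ju .$$ A family $\{u_\varepsilon\}_{\varepsilon>0}\subset\mathcal C^{0,1}(\overline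 S,\mathbb R^3)$ is a *(generalized) $N$-th order infinitesimal isometry* if $\|(\nabla u_\varepsilon)^T\nabla u_\varepsilon-\mathrm{Id}\|_{L^\infty(S)}=\mathcal O(\varepsilon^{N+1})$ as $\varepsilon\to0$. **Theorem (matching property).** Let $N\ge1$ be an integer and let $S$ be a developable surface of class $\mathcal C^{2N,1}$ whose mean curvature is bounded away from zero, that is, $|a_{11}+a_{22}|\ge c$ in $\Omega$ for some $c>0$. Let $V\in\mathcal C^{2N-1,1}(\overline S,\mathbb R^3)$ be a first order infinitesimal isometry, that is, $\mathrm{sym}\nabla V=0$ on $S$. Then there is a family $\{w_\varepsilon\}_{\varepsilon>0}\subset\mathcal C^{1,1}(S,\mathbb R^3)$, equibounded in $\mathcal C^{1,1}(S)$, such that the maps $$u_\varepsilon=\mathrm{id}+\varepsilon V+\varepsilon^2w_\varepsilon$$ are of class $\mathcal C^{1,1}$ and form a (generalized) $N$-th order infinitesimal isometry. -/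

import Mathlib

open Set Filter Topology MeasureTheory

noncomputable section

namespace DevSurf

/-- The Euclidean plane. -/
abbrev E2 := EuclideanSpace ℝ (Fin 2)

/-- Euclidean three-space. -/
abbrev E3 := EuclideanSpace ℝ (Fin 3)

/-- The partial derivative `∂ᵢ f (x)`. -/
def pd (f : E2 → E3) (i : Fin 2) (x : E2) : E3 :=
  fderiv ℝ f x (EuclideanSpace.single i 1)

/-- The cross product of `ℝ³`. -/
def cross (a b : E3) : E3 :=
  WithLp.toLp 2 (crossProduct (WithLp.ofLp a) (WithLp.ofLp b))

/-- Counterclockwise rotation of the plane by a right angle, `x ↦ x^⊥`. -/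
def perp (x : E2) : E2 := !₂[-(x 1), x 0]

/-- `f` is of class `C^{k,1}` up to the boundary of the open set `Ω`, with bound `K`: `f` is `k` times
continuously differentiable in `Ω`, its derivatives of order at most `k` are bounded by `K`
and the `k`-th derivative is Lipschitz on `Ω` with constant `K`. -/
structure IsCkLipWith (k : ℕ) (K : ℝ) (f : E2 → E3) (Ω : Set E2) : Prop where
  contDiffOn : ContDiffOn ℝ k f Ω
  bound : ∀ j ≤ k, ∀ x ∈ Ω, ‖iteratedFDerivWithin ℝ j f Ω x‖ ≤ K
  lipschitz : ∀ x ∈ Ω, ∀ y ∈ Ω,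
    ‖iteratedFDerivWithin ℝ k f Ω x - iteratedFDerivWithin ℝ k f Ω y‖ ≤ K * ‖x - y‖

/-- `f ∈ C^{k,1}(Ω̄)`. -/
def IsCkLip (k : ℕ) (f : E2 → E3) (Ω : Set E2) : Prop := ∃ K : ℝ, IsCkLipWith k K f Ω

/-- Bounded Lipschitz domains of the plane: bounded, connected, open, and, near each boundary point
and in suitable Cartesian coordinates, the region strictly above the graph of a
Lipschitz function. -/
structure IsLipschitzDomain (Ω : Set E2) : Prop where
  isOpen : IsOpen Ω
  isConnected : IsConnected Ω
  isBounded : Bornology.IsBounded Ω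
  boundary : ∀ p ∈ frontier Ω, ∃ (R : E2 ≃ₗᵢ[ℝ] E2) (ρ h : ℝ) (g : ℝ → ℝ) (L : NNReal),
    0 < ρ ∧ 0 < h ∧ LipschitzWith L g ∧
    ∀ q : E2, |R (q - p) 0| < ρ → |R (q - p) 1| < h → (q ∈ Ω ↔ g (R (q - p) 0) < R (q - p) 1)

/-- The planar data of a line of curvature chart: an arclength parametrized curve
`Γ ∈ C^{1,1}([0,T], ℝ²)` and positive Lipschitz functions `s⁻, s⁺` on `[0,T]`. -/
structure PlanarData where
  /-- length of the parameter interval -/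
  T : ℝ
  T_pos : 0 < T
  /-- the curve `Γ` -/
  Γ : ℝ → E2
  Γ_diff : DifferentiableOn ℝ Γ (Icc 0 T)
  Γ_lip : ∃ L : NNReal, LipschitzOnWith L (derivWithin Γ (Icc 0 T)) (Icc 0 T)
  Γ_arclength : ∀ t ∈ Icc 0 T, ‖derivWithin Γ (Icc 0 T) t‖ = 1
  /-- the function `s⁻` -/
  sm : ℝ → ℝ
  /-- the function `s⁺` -/
  sp : ℝ → ℝ
  sm_lip : ∃ L : NNReal, LipschitzOnWith L sm (Icc 0 T)
  sp_lip : ∃ L : NNReal, LipschitzOnWith L sp (Icc 0 T)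
  sm_pos : ∀ t ∈ Icc 0 T, 0 < sm t
  sp_pos : ∀ t ∈ Icc 0 T, 0 < sp t

namespace PlanarData

variable (P : PlanarData)

/-- The unit tangent `Γ'`. -/
def tangent (t : ℝ) : E2 := derivWithin P.Γ (Icc 0 P.T) t

/-- The unit normal `N = (Γ')^⊥`. -/
def normal (t : ℝ) : E2 := perp (P.tangent t)

/-- The curvature `κ = Γ'' · N`, defined for almost every `t ∈ (0,T)`. -/
def curvature (t : ℝ) : ℝ := inner ℝ (deriv P.tangent t) (P.normal t)

/-- The map `Φ(s,t) = Γ(t) + s N(t)`. -/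
def Φ (z : ℝ × ℝ) : E2 := P.Γ z.2 + z.1 • P.normal z.2

/-- The parameter domain `M = {(s,t) : t ∈ (0,T), s ∈ (-s⁻(t), s⁺(t))}`. -/
def M : Set (ℝ × ℝ) := {z | z.2 ∈ Ioo 0 P.T ∧ z.1 ∈ Ioo (-P.sm z.2) (P.sp z.2)}

/-- The open segment `[Γ(t)]`. -/
def segm (t : ℝ) : Set E2 := (fun s : ℝ => P.Γ t + s • P.normal t) '' Ioo (-P.sm t) (P.sp t)

/-- The planar domain `Ω = Φ(M)`. -/
def Ω : Set E2 := P.Φ '' P.M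

end PlanarData

/-- A line of curvature chart `u : Ω → ℝ³` of the developable surface `S`. -/
structure DevelopableChart (S : Set E3) extends PlanarData where
  /-- distinct segments do not meet -/
  admissible : ∀ t₁ ∈ Icc 0 T, ∀ t₂ ∈ Icc 0 T, t₁ ≠ t₂ →
    Disjoint (toPlanarData.segm t₁) (toPlanarData.segm t₂)
  lipschitzDomain : IsLipschitzDomain toPlanarData.Ω
  /-- the normal curvature `κₙ ∈ L²(0,T)` -/
  κn : ℝ → ℝ
  κn_memLp : MemLp κn 2 (volume.restrict (Ioo 0 T))
  /-- the moving frame, whose rows are `γ'`, `v`, `n` -/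
  r : ℝ → Matrix (Fin 3) (Fin 3) ℝ
  r_mem : ∀ t ∈ Icc 0 T, r t ∈ Matrix.specialOrthogonalGroup (Fin 3) ℝ
  /-- together with the equation below (whose right hand side is in `L²`), this says
  `r ∈ W^{1,2}(0,T)` -/
  r_ac : ∀ i j, AbsolutelyContinuousOnInterval (fun t => r t i j) 0 T
  r_ode : ∀ᵐ t ∂(volume.restrict (Ioo 0 T)), ∀ i j,
    HasDerivAt (fun τ => r τ i j)
      ((!![0, toPlanarData.curvature t, κn t;
           -toPlanarData.curvature t, 0, 0;
           -κn t, 0, 0] * r t) i j) t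
  r_zero : r 0 = 1
  /-- the chart -/
  u : E2 → E3
  /-- `u(Φ(s,t)) = γ(t) + s v(t)` with `γ(t) = ∫₀ᵗ γ'` -/
  u_eq : ∀ z ∈ toPlanarData.M,
    u (toPlanarData.Φ z) =
      (∫ τ in (0 : ℝ)..z.2, (WithLp.toLp 2 (r τ 0) : E3)) + z.1 • (WithLp.toLp 2 (r z.2 1) : E3)
  /-- `S = u(Ω)` -/
  surface_eq : S = u '' toPlanarData.Ω

namespace DevelopableChart

variable {S : Set E3} (D : DevelopableChart S)

/-- The coefficients `a_{ij} = (∂₁u × ∂₂u) · ∂ᵢ∂ⱼu` of the second fundamental form (up to sign). -/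
def a (i j : Fin 2) (x : E2) : ℝ :=
  inner ℝ (cross (pd D.u 0 x) (pd D.u 1 x)) (pd (pd D.u j) i x)

/-- The mean curvature (the trace of `[a_{ij}]`) is bounded away from zero. -/
def MeanCurvatureBoundedBelow : Prop :=
  ∃ c > 0, ∀ x ∈ D.Ω, c ≤ |D.a 0 0 x + D.a 1 1 x|

/-- The surface is of class `C^{k,1}`: `u ∈ C^{k,1}(Ω̄, ℝ³)`. -/
def IsOfClass (k : ℕ) : Prop := IsCkLip k D.u D.Ω

/-! A map `f` on the (possibly only immersed) surface `S` is represented by its pull-back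
`f ∘ u : Ω → ℝ³`; tangential derivatives of `f` in the direction `∂ᵢu` are then the derivatives
`∂ᵢ(f ∘ u)`, and regularity of `f` is regularity of `f ∘ u`. -/

/-- `sym ∇V`, evaluated on the tangent vectors `∂ᵢu`, `∂ⱼu`, where `V` stands for the pull-back
of the displacement. -/
def symGrad (V : E2 → E3) (i j : Fin 2) (x : E2) : ℝ :=
  (inner ℝ (pd V i x) (pd D.u j x) + inner ℝ (pd V j x) (pd D.u i x)) / 2

/-- First order infinitesimal isometries: `sym ∇V = 0` on `S`. -/
def IsFirstOrderIsometry (V : E2 → E3) : Prop :=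
  ∀ x ∈ D.Ω, ∀ i j, D.symGrad V i j x = 0

/-- The change of metric `(∇φ)ᵀ(∇φ) - Id`, evaluated on the tangent vectors `∂ᵢu`, `∂ⱼu` (which
are orthonormal), where `φ` stands for the pull-back of the deformation. -/
def metricChange (φ : E2 → E3) (i j : Fin 2) (x : E2) : ℝ :=
  inner ℝ (pd φ i x) (pd φ j x) - inner ℝ (pd D.u i x) (pd D.u j x)

/-- A family `(φ_ε)_{ε>0} ⊂ C^{0,1}` is a (generalized) `N`-th order infinitesimal isometry if
`‖(∇φ_ε)ᵀ(∇φ_ε) - Id‖_{L^∞(S)} = O(ε^{N+1})` as `ε → 0`. -/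
def IsInfinitesimalIsometry (N : ℕ) (φ : ℝ → E2 → E3) : Prop :=
  (∀ ε > 0, IsCkLip 0 (φ ε) D.Ω) ∧
  ∃ C : ℝ, ∀ᶠ ε in 𝓝[>] (0 : ℝ), ∀ᵐ x ∂(volume.restrict D.Ω), ∀ i j,
    |D.metricChange (φ ε) i j x| ≤ C * ε ^ (N + 1)

end DevelopableChart

end DevSurf

end

/-!
The family is a truncated expansion `∑ εᵃ W a` with `W 0 = u` and `W 1 = V`. The coefficient of
`εʲ` in its induced metric is `∑_{a+b=j} ∂ᵢ(W a) · ∂ₗ(W b)`, so that making it vanish amounts to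
solving, for `W j`, the linearized isometry equation `2 sym ∇w = -∑ ∇(W a)ᵀ∇(W b)` on the surface
(`IsRuledIsometry.exists_expansion`). What remains of the metric change is of order `ε^{N+1}`
(`exists_metric_bound`).

All the work is in solving that equation while losing only two derivatives
(`IsRuledIsometry.exists_solution`); then `V ∈ C^{2N-1,1}` leaves `W N ∈ C^{1,1}`. Let `T` be the
unit field across the rulings and `T^⊥` the one along them. Writing `w = ∇u q + c n` with a planar
field `q` and using that the second fundamental form is `η T ⊗ T`, the components of the equation
other than `T ⊗ T` involve `q` alone and are integrated along the rulings
(`IsRuling.exists_planar_field`), and the `T ⊗ T` component is solved algebraically for `c`, as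
`η` is the trace of the second fundamental form and does not vanish. In the last step a derivative
`∂_T q` is needed, which formally costs a further derivative of the data: it contains a primitive,
along the rulings, of third derivatives. These combine, as in the Gauss equation, to a derivative
along the rulings plus terms of lower order (`IsRuling.isReg_ddT_prim`), so nothing is lost. That
primitives along the rulings preserve regularity up to that of `T` (`IsRuling.isReg_avg`) is seen
by differentiating under the integral along and across the rulings.

The curve `Γ` is only of class `C^{1,1}`, so the regularity of the rulings has to come from the
surface. By the Frenet equations, which hold almost everywhere, and by continuity, `∇u` maps `T`
and `T^⊥` to the first two rows of the moving frame (`DevelopableChart.pder_u`). So `u` is an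
isometry whose gradient is constant along the rulings, and its second fundamental form is `A = η T
⊗ T` with `η = tr A`. Hence `T ⊗ T = A / tr A` is regular, and with it `T`, once `T` is known to
be continuous (`isReg_of_tensorSquare`, `PlanarData.Admissible.continuousAt_param`).

Finally, `C^{k,1}` here asks for a Lipschitz `k`-th derivative on `Ω` itself. That products and
compositions stay in these classes rests on the fact that bounded Lipschitz domains are
quasiconvex (`IsLipschitzDomain.isQuasiconvex`), which turns bounded gradients into Lipschitz
bounds.
-/

noncomputable section

namespace DevSurf

/-! ### Polygonal paths and quasiconvex sets -/

/-- `PolyPath Ω x y ℓ`: the points `x` and `y` are joined inside `Ω` by a polygonal path of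
length `ℓ`. -/
inductive PolyPath {E : Type} [NormedAddCommGroup E] [NormedSpace ℝ E] (Ω : Set E) :
    E → E → ℝ → Prop
  | refl (x : E) : x ∈ Ω → PolyPath Ω x x 0
  | step (x y z : E) (l : ℝ) : PolyPath Ω x y l → segment ℝ y z ⊆ Ω → PolyPath Ω x z (l + ‖z - y‖)

/-- Any two points of `Ω` are joined inside `Ω` by a polygonal path whose length is controlled by
their distance. -/
def IsQuasiconvex {E : Type} [NormedAddCommGroup E] [NormedSpace ℝ E] (Ω : Set E) : Prop :=
  ∃ C : ℝ, ∀ x ∈ Ω, ∀ y ∈ Ω, ∃ l ≤ C * ‖x - y‖, PolyPath Ω x y l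

section PolyPath

variable {E : Type} [NormedAddCommGroup E] [NormedSpace ℝ E] {Ω : Set E}

theorem PolyPath.trans {x y z : E} {l l' : ℝ} (h : PolyPath Ω x y l) (h' : PolyPath Ω y z l') :
    PolyPath Ω x z (l + l') := by
  induction h' with
  | refl hx => simpa using h
  | step b c l₁ _ hs ih =>
    rw [← add_assoc]
    exact PolyPath.step _ _ _ _ ih hs

theorem PolyPath.of_segment {x y : E} (h : segment ℝ x y ⊆ Ω) : PolyPath Ω x y ‖y - x‖ := by
  have := PolyPath.step x x y 0 (PolyPath.refl x (h (left_mem_segment ℝ x y))) h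
  simpa using this

theorem PolyPath.symm {x y : E} {l : ℝ} (h : PolyPath Ω x y l) : PolyPath Ω y x l := by
  induction h with
  | refl hx => exact PolyPath.refl x hx
  | step b c l₁ _ hs ih =>
    have h1 : PolyPath Ω c b ‖b - c‖ := PolyPath.of_segment (by rwa [segment_symm])
    rw [add_comm, norm_sub_rev]
    exact h1.trans ih

/-- The mean value inequality along a polygonal path. -/
theorem PolyPath.norm_sub_le {F : Type} [NormedAddCommGroup F] [NormedSpace ℝ F]
    (hΩ : IsOpen Ω) {f : E → F} {K : ℝ}
    (hf : DifferentiableOn ℝ f Ω) (hK : ∀ x ∈ Ω, ‖fderiv ℝ f x‖ ≤ K) {x y : E} {l : ℝ}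
    (h : PolyPath Ω x y l) : ‖f y - f x‖ ≤ K * l := by
  induction h with
  | refl hx => simp
  | step b c l₁ _ hs ih =>
    have h1 : ‖f c - f b‖ ≤ K * ‖c - b‖ :=
      (convex_segment b c).norm_image_sub_le_of_norm_fderiv_le
        (fun x hx => (hf x (hs hx)).differentiableAt (hΩ.mem_nhds (hs hx)))
        (fun x hx => hK x (hs hx)) (left_mem_segment ℝ b c) (right_mem_segment ℝ b c)
    calc ‖f c - f x‖ = ‖(f c - f b) + (f b - f x)‖ := by congr 1; abel
      _ ≤ ‖f c - f b‖ + ‖f b - f x‖ := norm_add_le _ _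
      _ ≤ K * (l₁ + ‖c - b‖) := by linarith

end PolyPath

/-! ### Functions with bounded derivatives and Lipschitz top derivative -/

section Reg

variable {F G H : Type} [NormedAddCommGroup F] [NormedSpace ℝ F] [NormedAddCommGroup G]
  [NormedSpace ℝ G] [NormedAddCommGroup H] [NormedSpace ℝ H]

/-- The partial derivative `∂ᵢ f`, for an arbitrary target space. -/
def pder (f : E2 → F) (i : Fin 2) (x : E2) : F := fderiv ℝ f x (EuclideanSpace.single i 1)

/-- Recursive form of `C^{k,1}(Ω̄)`: all partial derivatives of order at most `k` exist and are
bounded, and those of order `k` are Lipschitz on `Ω`. -/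
def IsReg (Ω : Set E2) : ℕ → (E2 → F) → Prop
  | 0, f => (∃ K, ∀ x ∈ Ω, ‖f x‖ ≤ K) ∧ ∃ K, ∀ x ∈ Ω, ∀ y ∈ Ω, ‖f x - f y‖ ≤ K * ‖x - y‖
  | k + 1, f => (∃ K, ∀ x ∈ Ω, ‖f x‖ ≤ K) ∧ DifferentiableOn ℝ f Ω ∧ ∀ i, IsReg Ω k (pder f i)

theorem fderiv_apply_eq_pder (f : E2 → F) (x y : E2) :
    fderiv ℝ f x y = y 0 • pder f 0 x + y 1 • pder f 1 x := by
  have hy : y = y 0 • EuclideanSpace.single 0 (1 : ℝ) + y 1 • EuclideanSpace.single 1 (1 : ℝ) := by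
    ext i; fin_cases i <;> simp
  conv_lhs => rw [hy]
  simp [pder]

theorem norm_fderiv_le_pder (f : E2 → F) (x : E2) :
    ‖fderiv ℝ f x‖ ≤ ‖pder f 0 x‖ + ‖pder f 1 x‖ := by
  refine ContinuousLinearMap.opNorm_le_bound _ (by positivity) fun y => ?_
  rw [fderiv_apply_eq_pder]
  have h0 : ‖y 0‖ ≤ ‖y‖ := PiLp.norm_apply_le y 0
  have h1 : ‖y 1‖ ≤ ‖y‖ := PiLp.norm_apply_le y 1
  calc ‖y 0 • pder f 0 x + y 1 • pder f 1 x‖ ≤ ‖y 0‖ * ‖pder f 0 x‖ + ‖y 1‖ * ‖pder f 1 x‖ := by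
        refine (norm_add_le _ _).trans ?_
        rw [norm_smul, norm_smul]
    _ ≤ ‖y‖ * ‖pder f 0 x‖ + ‖y‖ * ‖pder f 1 x‖ := by gcongr
    _ = _ := by ring

theorem norm_pder_le (f : E2 → F) (i : Fin 2) (x : E2) : ‖pder f i x‖ ≤ ‖fderiv ℝ f x‖ := by
  have := (fderiv ℝ f x).le_opNorm (EuclideanSpace.single i 1)
  simpa [pder] using this

variable {Ω : Set E2} {k : ℕ} {f g : E2 → F}

theorem IsReg.bdd (h : IsReg Ω k f) : ∃ K, ∀ x ∈ Ω, ‖f x‖ ≤ K := by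
  cases k with
  | zero => exact h.1
  | succ k => exact h.1

theorem IsReg.partialDeriv (h : IsReg Ω (k + 1) f) (i : Fin 2) : IsReg Ω k (pder f i) := h.2.2 i

theorem IsReg.differentiableOn (h : IsReg Ω (k + 1) f) : DifferentiableOn ℝ f Ω := h.2.1

theorem IsReg.differentiableAt (hΩ : IsOpen Ω) (h : IsReg Ω (k + 1) f) {x : E2} (hx : x ∈ Ω) :
    DifferentiableAt ℝ f x :=
  (h.2.1 x hx).differentiableAt (hΩ.mem_nhds hx)

theorem IsReg.fderiv_bdd (h : IsReg Ω (k + 1) f) : ∃ K, ∀ x ∈ Ω, ‖fderiv ℝ f x‖ ≤ K := by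
  obtain ⟨K0, h0⟩ := (h.partialDeriv 0).bdd
  obtain ⟨K1, h1⟩ := (h.partialDeriv 1).bdd
  exact ⟨K0 + K1, fun x hx => (norm_fderiv_le_pder f x).trans (add_le_add (h0 x hx) (h1 x hx))⟩

/-- On a quasiconvex set, a bounded gradient gives a Lipschitz bound. -/
theorem exists_lipschitz_of_fderiv_bdd (hΩ : IsOpen Ω) (hq : IsQuasiconvex Ω)
    (hf : DifferentiableOn ℝ f Ω) {K : ℝ} (hK : ∀ x ∈ Ω, ‖fderiv ℝ f x‖ ≤ K) :
    ∃ K, ∀ x ∈ Ω, ∀ y ∈ Ω, ‖f x - f y‖ ≤ K * ‖x - y‖ := by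
  obtain ⟨C, hC⟩ := hq
  refine ⟨K * C, fun x hx y hy => ?_⟩
  have hK0 : 0 ≤ K := (norm_nonneg _).trans (hK x hx)
  obtain ⟨l, hl, hp⟩ := hC x hx y hy
  rw [norm_sub_rev]
  calc ‖f y - f x‖ ≤ K * l := hp.norm_sub_le hΩ hf hK
    _ ≤ K * (C * ‖x - y‖) := by gcongr
    _ = _ := by ring

theorem IsReg.of_succ (hΩ : IsOpen Ω) (hq : IsQuasiconvex Ω) (h : IsReg Ω (k + 1) f) :
    IsReg Ω k f := by
  induction k generalizing f with
  | zero =>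
    obtain ⟨K, hK⟩ := h.fderiv_bdd
    exact ⟨h.1, exists_lipschitz_of_fderiv_bdd hΩ hq h.2.1 hK⟩
  | succ k ih => exact ⟨h.1, h.2.1, fun i => ih (h.2.2 i)⟩

theorem IsReg.mono (hΩ : IsOpen Ω) (hq : IsQuasiconvex Ω) {l : ℕ} (h : IsReg Ω k f)
    (hl : l ≤ k) : IsReg Ω l f := by
  induction k, hl using Nat.le_induction with
  | base => exact h
  | succ n _ ih => exact ih (h.of_succ hΩ hq)

theorem IsReg.continuousOn (h : IsReg Ω k f) : ContinuousOn f Ω := by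
  cases k with
  | zero =>
    obtain ⟨-, K, hK⟩ := h
    have : LipschitzOnWith (Real.toNNReal K) f Ω := by
      refine LipschitzOnWith.of_dist_le_mul fun x hx y hy => ?_
      rw [dist_eq_norm, dist_eq_norm]
      exact (hK x hx y hy).trans (by gcongr; exact Real.le_coe_toNNReal K)
    exact this.continuousOn
  | succ k => exact h.2.1.continuousOn

theorem IsReg.continuousOn_fderiv (h : IsReg Ω (k + 1) f) :
    ContinuousOn (fderiv ℝ f) Ω := by
  have h0 := (h.partialDeriv 0).continuousOn
  have h1 := (h.partialDeriv 1).continuousOn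
  have : fderiv ℝ f = fun x =>
      (EuclideanSpace.proj (0 : Fin 2) : E2 →L[ℝ] ℝ).smulRight (pder f 0 x) +
      (EuclideanSpace.proj (1 : Fin 2) : E2 →L[ℝ] ℝ).smulRight (pder f 1 x) := by
    funext x
    ext1 y
    rw [fderiv_apply_eq_pder]
    simp
  rw [this]
  have hc : ∀ i : Fin 2, Continuous fun z : F =>
      (EuclideanSpace.proj i : E2 →L[ℝ] ℝ).smulRight z := fun i =>
    ((ContinuousLinearMap.smulRightL ℝ E2 F) (EuclideanSpace.proj i)).continuous
  exact ((hc 0).comp_continuousOn h0).add ((hc 1).comp_continuousOn h1)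

theorem pder_congr (hΩ : IsOpen Ω) (h : EqOn f g Ω) (i : Fin 2) :
    EqOn (pder f i) (pder g i) Ω := by
  intro x hx
  simp only [pder]
  rw [(h.eventuallyEq_of_mem (hΩ.mem_nhds hx)).fderiv_eq]

theorem IsReg.congr (hΩ : IsOpen Ω) (hf : IsReg Ω k f) (h : EqOn g f Ω) : IsReg Ω k g := by
  induction k generalizing f g with
  | zero =>
    obtain ⟨⟨K, hK⟩, L, hL⟩ := hf
    exact ⟨⟨K, fun x hx => by rw [h hx]; exact hK x hx⟩,
      L, fun x hx y hy => by rw [h hx, h hy]; exact hL x hx y hy⟩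
  | succ k ih =>
    obtain ⟨⟨K, hK⟩, hd, hp⟩ := hf
    exact ⟨⟨K, fun x hx => by rw [h hx]; exact hK x hx⟩, hd.congr h,
      fun i => ih (hp i) (pder_congr hΩ h i)⟩

theorem isReg_const (c : F) : IsReg Ω k (fun _ => c) := by
  have : ∀ c : F, IsReg Ω k (fun _ : E2 => c) := by
    induction k with
    | zero => exact fun c => ⟨⟨‖c‖, fun _ _ => le_rfl⟩, 0, fun _ _ _ _ => by simp⟩
    | succ k ih =>
      refine fun c => ⟨⟨‖c‖, fun _ _ => le_rfl⟩, differentiableOn_const c, fun i => ?_⟩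
      have : pder (fun _ : E2 => c) i = fun _ => 0 := by
        funext x; simp [pder]
      rw [this]; exact ih 0
  exact this c

theorem IsReg.add (hΩ : IsOpen Ω) (hf : IsReg Ω k f) (hg : IsReg Ω k g) :
    IsReg Ω k (fun x => f x + g x) := by
  induction k generalizing f g with
  | zero =>
    obtain ⟨⟨K, hK⟩, L, hL⟩ := hf
    obtain ⟨⟨K', hK'⟩, L', hL'⟩ := hg
    refine ⟨⟨K + K', fun x hx => (norm_add_le _ _).trans (add_le_add (hK x hx) (hK' x hx))⟩,
      L + L', fun x hx y hy => ?_⟩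
    calc ‖f x + g x - (f y + g y)‖ = ‖(f x - f y) + (g x - g y)‖ := by congr 1; abel
      _ ≤ L * ‖x - y‖ + L' * ‖x - y‖ :=
        (norm_add_le _ _).trans (add_le_add (hL x hx y hy) (hL' x hx y hy))
      _ = _ := by ring
  | succ k ih =>
    obtain ⟨K, hK⟩ := hf.bdd
    obtain ⟨K', hK'⟩ := hg.bdd
    refine ⟨⟨K + K', fun x hx => (norm_add_le _ _).trans (add_le_add (hK x hx) (hK' x hx))⟩,
      hf.2.1.add hg.2.1, fun i => (ih (hf.2.2 i) (hg.2.2 i)).congr hΩ fun x hx => ?_⟩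
    simp only [pder]
    rw [fderiv_fun_add (hf.differentiableAt hΩ hx) (hg.differentiableAt hΩ hx)]
    rfl

theorem IsReg.clm (hΩ : IsOpen Ω) (L : F →L[ℝ] G) (hf : IsReg Ω k f) :
    IsReg Ω k (fun x => L (f x)) := by
  induction k generalizing f with
  | zero =>
    obtain ⟨⟨K, hK⟩, M, hM⟩ := hf
    refine ⟨⟨‖L‖ * K, fun x hx => (L.le_opNorm _).trans (by gcongr; exact hK x hx)⟩,
      ‖L‖ * M, fun x hx y hy => ?_⟩
    rw [← map_sub, mul_assoc]
    exact (L.le_opNorm _).trans (by gcongr; exact hM x hx y hy)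
  | succ k ih =>
    obtain ⟨K, hK⟩ := hf.bdd
    refine ⟨⟨‖L‖ * K, fun x hx => (L.le_opNorm _).trans (by gcongr; exact hK x hx)⟩,
      fun x hx => (L.differentiableAt.comp x (hf.differentiableAt hΩ hx)).differentiableWithinAt,
      fun i => (ih (hf.2.2 i)).congr hΩ fun x hx => ?_⟩
    simp only [pder]
    have := (L.hasFDerivAt.comp x (hf.differentiableAt hΩ hx).hasFDerivAt).fderiv
    rw [show (fun x => L (f x)) = L ∘ f from rfl, this]
    rfl

theorem IsReg.neg (hΩ : IsOpen Ω) (hf : IsReg Ω k f) : IsReg Ω k (fun x => -f x) :=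
  hf.clm hΩ (-ContinuousLinearMap.id ℝ F)

theorem IsReg.sub (hΩ : IsOpen Ω) (hf : IsReg Ω k f) (hg : IsReg Ω k g) :
    IsReg Ω k (fun x => f x - g x) := by
  simpa only [sub_eq_add_neg] using hf.add hΩ (hg.neg hΩ)

theorem IsReg.const_smul (hΩ : IsOpen Ω) (c : ℝ) (hf : IsReg Ω k f) :
    IsReg Ω k (fun x => c • f x) :=
  hf.clm hΩ (c • ContinuousLinearMap.id ℝ F)

theorem IsReg.sum (hΩ : IsOpen Ω) {ι : Type} (S : Finset ι) {φ : ι → E2 → F}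
    (h : ∀ i ∈ S, IsReg Ω k (φ i)) : IsReg Ω k (fun x => ∑ i ∈ S, φ i x) := by
  classical
  induction S using Finset.induction_on with
  | empty => simpa using isReg_const (Ω := Ω) (k := k) (0 : F)
  | insert a S ha ih =>
    simp only [Finset.sum_insert ha]
    exact (h a (by simp)).add hΩ (ih fun i hi => h i (by simp [hi]))

theorem IsReg.bilin (hΩ : IsOpen Ω) (hq : IsQuasiconvex Ω) (B : F →L[ℝ] G →L[ℝ] H)
    {f : E2 → F} {g : E2 → G} (hf : IsReg Ω k f) (hg : IsReg Ω k g) :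
    IsReg Ω k (fun x => B (f x) (g x)) := by
  have hbd : ∀ {a : E2 → F} {b : E2 → G}, (∃ K, ∀ x ∈ Ω, ‖a x‖ ≤ K) → (∃ K, ∀ x ∈ Ω, ‖b x‖ ≤ K) →
      ∃ K, ∀ x ∈ Ω, ‖B (a x) (b x)‖ ≤ K := by
    rintro a b ⟨K, hK⟩ ⟨K', hK'⟩
    refine ⟨‖B‖ * K * K', fun x hx => (B.le_opNorm₂ _ _).trans ?_⟩
    have := (norm_nonneg _).trans (hK x hx)
    gcongr
    exacts [hK x hx, hK' x hx]
  induction k generalizing f g with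
  | zero =>
    refine ⟨hbd hf.1 hg.1, ?_⟩
    obtain ⟨⟨K, hK⟩, L, hL⟩ := hf
    obtain ⟨⟨K', hK'⟩, L', hL'⟩ := hg
    refine ⟨‖B‖ * L * K' + ‖B‖ * K * L', fun x hx y hy => ?_⟩
    have e : B (f x) (g x) - B (f y) (g y) = B (f x - f y) (g x) + B (f y) (g x - g y) := by
      simp
    have hL0 : 0 ≤ L * ‖x - y‖ := (norm_nonneg _).trans (hL x hx y hy)
    have hK0 : 0 ≤ K := (norm_nonneg _).trans (hK x hx)
    rw [e]
    calc ‖B (f x - f y) (g x) + B (f y) (g x - g y)‖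
        ≤ ‖B‖ * ‖f x - f y‖ * ‖g x‖ + ‖B‖ * ‖f y‖ * ‖g x - g y‖ :=
          (norm_add_le _ _).trans (add_le_add (B.le_opNorm₂ _ _) (B.le_opNorm₂ _ _))
      _ ≤ ‖B‖ * (L * ‖x - y‖) * K' + ‖B‖ * K * (L' * ‖x - y‖) := by
          gcongr
          exacts [hL x hx y hy, hK' x hx, hK y hy, hL' x hx y hy]
      _ = _ := by ring
  | succ k ih =>
    refine ⟨hbd hf.1 hg.1, fun x hx => ?_, fun i => ?_⟩
    · exact (B.hasFDerivAt_of_bilinear (hf.differentiableAt hΩ hx).hasFDerivAt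
        (hg.differentiableAt hΩ hx).hasFDerivAt).differentiableAt.differentiableWithinAt
    · refine ((ih (hf.of_succ hΩ hq) (hg.partialDeriv i)).add hΩ
        (ih (hf.partialDeriv i) (hg.of_succ hΩ hq))).congr hΩ fun x hx => ?_
      have := (B.hasFDerivAt_of_bilinear (hf.differentiableAt hΩ hx).hasFDerivAt
        (hg.differentiableAt hΩ hx).hasFDerivAt).fderiv
      simp only [pder]
      rw [this]
      simp

theorem IsReg.smul (hΩ : IsOpen Ω) (hq : IsQuasiconvex Ω) {φ : E2 → ℝ} (hφ : IsReg Ω k φ)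
    (hf : IsReg Ω k f) : IsReg Ω k (fun x => φ x • f x) :=
  hφ.bilin hΩ hq (ContinuousLinearMap.lsmul ℝ ℝ) hf

theorem IsReg.mul (hΩ : IsOpen Ω) (hq : IsQuasiconvex Ω) {φ ψ : E2 → ℝ} (hφ : IsReg Ω k φ)
    (hψ : IsReg Ω k ψ) : IsReg Ω k (fun x => φ x * ψ x) :=
  hφ.bilin hΩ hq (ContinuousLinearMap.mul ℝ ℝ) hψ

theorem IsReg.innerProd (hΩ : IsOpen Ω) (hq : IsQuasiconvex Ω) {n : ℕ}
    {a b : E2 → EuclideanSpace ℝ (Fin n)} (ha : IsReg Ω k a) (hb : IsReg Ω k b) :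
    IsReg Ω k (fun x => inner ℝ (a x) (b x)) :=
  ha.bilin hΩ hq (innerSL ℝ) hb

theorem IsReg.coord (hΩ : IsOpen Ω) {n : ℕ}
    {a : E2 → EuclideanSpace ℝ (Fin n)} (ha : IsReg Ω k a) (i : Fin n) :
    IsReg Ω k (fun x => a x i) :=
  ha.clm hΩ (EuclideanSpace.proj i : EuclideanSpace ℝ (Fin n) →L[ℝ] ℝ)

theorem IsReg.of_coord (hΩ : IsOpen Ω) {n : ℕ}
    {a : E2 → EuclideanSpace ℝ (Fin n)} (ha : ∀ i, IsReg Ω k (fun x => a x i)) : IsReg Ω k a := by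
  have h : IsReg Ω k (fun x => ∑ i, (ContinuousLinearMap.toSpanSingleton ℝ
      (EuclideanSpace.single i (1 : ℝ))) (a x i)) :=
    IsReg.sum hΩ _ fun i _ => (ha i).clm hΩ _
  refine h.congr hΩ fun x _ => ?_
  ext i
  simp [Finset.sum_apply, Pi.single_apply]

theorem IsReg.inv (hΩ : IsOpen Ω) (hq : IsQuasiconvex Ω) {φ : E2 → ℝ} {c : ℝ} (hc : 0 < c)
    (hφ : IsReg Ω k φ) (hb : ∀ x ∈ Ω, c ≤ |φ x|) : IsReg Ω k (fun x => (φ x)⁻¹) := by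
  have hne : ∀ x ∈ Ω, φ x ≠ 0 := fun x hx h => by
    have := hb x hx; rw [h, abs_zero] at this; linarith
  have hbd : ∀ x ∈ Ω, ‖(φ x)⁻¹‖ ≤ c⁻¹ := fun x hx => by
    rw [norm_inv, Real.norm_eq_abs]; exact inv_anti₀ hc (hb x hx)
  induction k with
  | zero =>
    obtain ⟨-, L, hL⟩ := hφ
    refine ⟨⟨c⁻¹, hbd⟩, c⁻¹ * L * c⁻¹, fun x hx y hy => ?_⟩
    have e : (φ x)⁻¹ - (φ y)⁻¹ = -((φ x)⁻¹ * (φ x - φ y) * (φ y)⁻¹) := by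
      have := hne x hx; have := hne y hy; field_simp; ring
    rw [e, norm_neg, norm_mul, norm_mul]
    have hL0 : 0 ≤ L * ‖x - y‖ := (norm_nonneg _).trans (hL x hx y hy)
    calc ‖(φ x)⁻¹‖ * ‖φ x - φ y‖ * ‖(φ y)⁻¹‖ ≤ c⁻¹ * (L * ‖x - y‖) * c⁻¹ := by
          gcongr
          exacts [hbd x hx, hL x hx y hy, hbd y hy]
      _ = _ := by ring
  | succ k ih =>
    have hi := ih (hφ.of_succ hΩ hq)
    refine ⟨⟨c⁻¹, hbd⟩, fun x hx =>
      ((hφ.differentiableAt hΩ hx).inv (hne x hx)).differentiableWithinAt, fun i => ?_⟩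
    refine (((hi.mul hΩ hq hi).mul hΩ hq (hφ.partialDeriv i)).neg hΩ).congr hΩ fun x hx => ?_
    simp only [pder]
    have := ((hasDerivAt_inv (hne x hx)).comp_hasFDerivAt x
      (hφ.differentiableAt hΩ hx).hasFDerivAt).fderiv
    rw [show (fun x => (φ x)⁻¹) = Inv.inv ∘ φ from rfl, this]
    have := hne x hx
    simp only [neg_smul, neg_apply, smul_apply, smul_eq_mul]
    field_simp

/-- The derivative of `f` along the vector field `X`. -/
def dd (X : E2 → E2) (f : E2 → F) (x : E2) : F := fderiv ℝ f x (X x)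

theorem dd_eq (X : E2 → E2) (f : E2 → F) (x : E2) :
    dd X f x = X x 0 • pder f 0 x + X x 1 • pder f 1 x := fderiv_apply_eq_pder f x (X x)

theorem IsReg.dirDeriv (hΩ : IsOpen Ω) (hq : IsQuasiconvex Ω) {X : E2 → E2} (hX : IsReg Ω k X)
    (hf : IsReg Ω (k + 1) f) : IsReg Ω k (dd X f) :=
  (((hX.coord hΩ 0).smul hΩ hq (hf.partialDeriv 0)).add hΩ
    ((hX.coord hΩ 1).smul hΩ hq (hf.partialDeriv 1))).congr hΩ fun x _ => dd_eq X f x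

theorem dd_congr (hΩ : IsOpen Ω) (X : E2 → E2) (h : EqOn f g Ω) : EqOn (dd X f) (dd X g) Ω := by
  intro x hx
  simp only [dd]
  rw [(h.eventuallyEq_of_mem (hΩ.mem_nhds hx)).fderiv_eq]

theorem dd_bilin (B : F →L[ℝ] G →L[ℝ] H) (X : E2 → E2) {f : E2 → F} {g : E2 → G} {x : E2}
    (hf : DifferentiableAt ℝ f x) (hg : DifferentiableAt ℝ g x) :
    dd X (fun x => B (f x) (g x)) x = B (dd X f x) (g x) + B (f x) (dd X g x) := by
  simp only [dd]
  rw [(B.hasFDerivAt_of_bilinear hf.hasFDerivAt hg.hasFDerivAt).fderiv]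
  simp [add_comm]

theorem dd_smul (X : E2 → E2) {φ : E2 → ℝ} {f : E2 → F} {x : E2}
    (hφ : DifferentiableAt ℝ φ x) (hf : DifferentiableAt ℝ f x) :
    dd X (fun x => φ x • f x) x = dd X φ x • f x + φ x • dd X f x :=
  dd_bilin (ContinuousLinearMap.lsmul ℝ ℝ) X hφ hf

theorem dd_mul (X : E2 → E2) {φ ψ : E2 → ℝ} {x : E2}
    (hφ : DifferentiableAt ℝ φ x) (hψ : DifferentiableAt ℝ ψ x) :
    dd X (fun x => φ x * ψ x) x = dd X φ x * ψ x + φ x * dd X ψ x :=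
  dd_bilin (ContinuousLinearMap.mul ℝ ℝ) X hφ hψ

theorem dd_inner (X : E2 → E2) {n : ℕ} {a b : E2 → EuclideanSpace ℝ (Fin n)} {x : E2}
    (ha : DifferentiableAt ℝ a x) (hb : DifferentiableAt ℝ b x) :
    dd X (fun x => inner ℝ (a x) (b x)) x = inner ℝ (dd X a x) (b x) + inner ℝ (a x) (dd X b x) :=
  dd_bilin (innerSL ℝ) X ha hb

theorem dd_add (X : E2 → E2) {x : E2}
    (hf : DifferentiableAt ℝ f x) (hg : DifferentiableAt ℝ g x) :
    dd X (fun x => f x + g x) x = dd X f x + dd X g x := by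
  simp only [dd]; rw [fderiv_fun_add hf hg]; rfl

theorem dd_sub (X : E2 → E2) {x : E2}
    (hf : DifferentiableAt ℝ f x) (hg : DifferentiableAt ℝ g x) :
    dd X (fun x => f x - g x) x = dd X f x - dd X g x := by
  simp only [dd]; rw [fderiv_fun_sub hf hg]; rfl

end Reg

/-! ### Bounded Lipschitz domains are quasiconvex -/

theorem convexComb_mem_Ioo {a b r u v : ℝ} (ha : 0 ≤ a) (hb : 0 ≤ b) (hab : a + b = 1)
    (hu : -r < u ∧ u < r) (hv : -r < v ∧ v < r) :
    -r < a * u + b * v ∧ a * u + b * v < r :=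
  convex_Ioo (-r) r hu hv ha hb hab

/-- Above the graph of a Lipschitz function `g`, a convex combination of two points that is shifted
upwards by a suitable multiple of the Lipschitz constant is again above the graph. -/
theorem epigraph_convexComb {g : ℝ → ℝ} {L X Y x₁ y₁ a b τ : ℝ}
    (lip : ∀ u v : ℝ, g u - g v ≤ L * |u - v|) (ha : 0 ≤ a) (hb : 0 ≤ b) (hab : a + b = 1)
    (gx : g X < x₁) (gy : g Y < y₁) (hτ : 2 * (a * b) * (L * |X - Y|) ≤ τ) :
    g (a * X + b * Y) < a * x₁ + b * y₁ + τ := by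
  have e1 : g (a * X + b * Y) - g X ≤ L * (b * |X - Y|) := by
    refine (lip _ _).trans_eq ?_
    rw [show a * X + b * Y - X = -(b * (X - Y)) by rw [← eq_sub_iff_add_eq] at hab; rw [hab]; ring,
      abs_neg, abs_mul, abs_of_nonneg hb]
  have e2 : g (a * X + b * Y) - g Y ≤ L * (a * |X - Y|) := by
    refine (lip _ _).trans_eq ?_
    rw [show a * X + b * Y - Y = a * (X - Y) by
      rw [← eq_sub_iff_add_eq'] at hab; rw [hab]; ring, abs_mul, abs_of_nonneg ha]
  have e3 : a * g X + b * g Y < a * x₁ + b * y₁ := by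
    rcases ha.eq_or_lt with h0 | h0
    · have : b = 1 := by linarith
      rw [← h0, this]; linarith
    · have := mul_lt_mul_of_pos_left gx h0
      have := mul_le_mul_of_nonneg_left gy.le hb
      linarith
  have e4 := mul_le_mul_of_nonneg_left e1 ha
  have e5 := mul_le_mul_of_nonneg_left e2 hb
  have e6 : g (a * X + b * Y) = a * g (a * X + b * Y) + b * g (a * X + b * Y) := by
    rw [← add_mul, hab, one_mul]
  linarith

/-- Near each point of its closure, a Lipschitz domain is quasiconvex. -/
theorem IsLipschitzDomain.locally_quasiconvex {Ω : Set E2} (hΩ : IsLipschitzDomain Ω) {p : E2}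
    (hp : p ∈ closure Ω) :
    ∃ r > 0, ∃ C ≥ 0, ∀ x ∈ Metric.ball p r ∩ Ω, ∀ y ∈ Metric.ball p r ∩ Ω,
      ∃ l ≤ C * ‖x - y‖, PolyPath Ω x y l := by
  by_cases hpΩ : p ∈ Ω
  · obtain ⟨r, hr, hball⟩ := Metric.isOpen_iff.1 hΩ.isOpen p hpΩ
    refine ⟨r, hr, 1, zero_le_one, fun x hx y hy => ⟨‖y - x‖, ?_, PolyPath.of_segment ?_⟩⟩
    · rw [norm_sub_rev, one_mul]
    · exact ((convex_ball p r).segment_subset hx.1 hy.1).trans hball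
  · have hfr : p ∈ frontier Ω := by
      rw [hΩ.isOpen.frontier_eq]; exact ⟨hp, hpΩ⟩
    obtain ⟨R, ρ, h, g, L, hρ, hh, hg, hiff⟩ := hΩ.boundary p hfr
    have hL : (0 : ℝ) ≤ L := L.2
    set r := min ρ (h / (1 + 2 * L)) with hr
    have hrpos : 0 < r := lt_min hρ (by positivity)
    have hrh : r * (1 + 2 * L) ≤ h := by
      rw [← le_div_iff₀ (by positivity)]; exact min_le_right _ _
    have hco : ∀ q ∈ Metric.ball p r, ∀ i, |R (q - p) i| < r := fun q hq i => by
      have h1 : ‖R (q - p) i‖ ≤ ‖R (q - p)‖ := PiLp.norm_apply_le _ i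
      rw [R.norm_map] at h1
      exact h1.trans_lt (by simpa [dist_eq_norm] using hq)
    refine ⟨r, hrpos, 1 + 2 * L, by positivity, ?_⟩
    rintro x ⟨hxb, hx⟩ y ⟨hyb, hy⟩
    set e : E2 := R.symm (EuclideanSpace.single 1 1) with he
    have hnorm_e : ‖e‖ = 1 := by simp [he]
    set δ : ℝ := |R (x - p) 0 - R (y - p) 0| with hδ
    have hδ0 : 0 ≤ δ := abs_nonneg _
    have hδxy : δ ≤ ‖x - y‖ := by
      have h1 : ‖R (x - y) 0‖ ≤ ‖R (x - y)‖ := PiLp.norm_apply_le _ 0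
      rw [R.norm_map] at h1
      have h2 : R (x - y) 0 = R (x - p) 0 - R (y - p) 0 := by
        rw [show x - y = (x - p) - (y - p) by abel, map_sub]; rfl
      rw [h2] at h1
      exact h1
    have hδr : δ ≤ 2 * r := by
      have h1 := hco x hxb 0
      have h2 := hco y hyb 0
      rw [abs_lt] at h1 h2
      rw [hδ, abs_le]; constructor <;> linarith [h1.1, h1.2, h2.1, h2.2]
    have gx := (hiff x ((hco x hxb 0).trans_le (min_le_left _ _))
      ((hco x hxb 1).trans_le (by nlinarith))).1 hx
    have gy := (hiff y ((hco y hyb 0).trans_le (min_le_left _ _))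
      ((hco y hyb 1).trans_le (by nlinarith))).1 hy
    -- A convex combination of `x` and `y`, shifted upwards far enough, stays in `Ω`.
    have key : ∀ a b τ : ℝ, 0 ≤ a → 0 ≤ b → a + b = 1 → 2 * (a * b) * (L * δ) ≤ τ → τ ≤ L * δ →
        a • x + b • y + τ • e ∈ Ω := by
      intro a b τ ha hb hab h1 h2
      have hR : R (a • x + b • y + τ • e - p) =
          a • R (x - p) + b • R (y - p) + τ • EuclideanSpace.single 1 1 := by
        have : a • x + b • y + τ • e - p = a • (x - p) + b • (y - p) + τ • e := by
          have : p = (a + b) • p := by rw [hab, one_smul]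
          nth_rewrite 1 [this]
          module
        rw [this]
        simp [he]
      have c0 : R (a • x + b • y + τ • e - p) 0 = a * R (x - p) 0 + b * R (y - p) 0 := by
        rw [hR]; simp
      have c1 : R (a • x + b • y + τ • e - p) 1 = a * R (x - p) 1 + b * R (y - p) 1 + τ := by
        rw [hR]; simp
      have hx0 := abs_lt.1 (hco x hxb 0)
      have hy0 := abs_lt.1 (hco y hyb 0)
      have hx1 := abs_lt.1 (hco x hxb 1)
      have hy1 := abs_lt.1 (hco y hyb 1)
      have hτ0 : 0 ≤ τ := le_trans (by positivity) h1
      have hτh : τ ≤ 2 * L * r := by nlinarith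
      have hb0 := convexComb_mem_Ioo ha hb hab hx0 hy0
      have hb1 := convexComb_mem_Ioo ha hb hab hx1 hy1
      have hρr : r ≤ ρ := min_le_left _ _
      rw [hiff _ (by rw [c0, abs_lt]; constructor <;> linarith [hb0.1, hb0.2])
        (by rw [c1, abs_lt]; constructor <;> nlinarith [hb1.1, hb1.2]), c0, c1]
      have lip : ∀ u v : ℝ, g u - g v ≤ L * |u - v| := fun u v => by
        have := hg.dist_le_mul u v
        rw [Real.dist_eq, Real.dist_eq] at this
        exact (le_abs_self _).trans this
      exact epigraph_convexComb lip ha hb hab gx gy h1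
    have hLδ : 0 ≤ L * δ := by positivity
    -- The path goes up from `x`, across, and down to `y`.
    have p1 : PolyPath Ω x (x + (L * δ) • e) ‖x + (L * δ) • e - x‖ := by
      refine PolyPath.of_segment ?_
      rintro z ⟨a, b, ha, hb, hab, rfl⟩
      have := key 1 0 (b * (L * δ)) zero_le_one le_rfl (by simp) (by simp; positivity)
        (mul_le_of_le_one_left hLδ (by linarith))
      convert this using 1
      rw [← eq_sub_iff_add_eq] at hab; rw [hab]; module
    have p2 : PolyPath Ω (x + (L * δ) • e) (y + (L * δ) • e)
        ‖y + (L * δ) • e - (x + (L * δ) • e)‖ := by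
      refine PolyPath.of_segment ?_
      rintro z ⟨a, b, ha, hb, hab, rfl⟩
      have := key a b (L * δ) ha hb hab (mul_le_of_le_one_left hLδ (by
        rw [← eq_sub_iff_add_eq] at hab; rw [hab]; nlinarith [sq_nonneg (2 * b - 1)])) le_rfl
      convert this using 1
      have : (L * δ) • e = (a + b) • (L * δ) • e := by rw [hab, one_smul]
      conv_rhs => rw [this]
      module
    have p3 : PolyPath Ω (y + (L * δ) • e) y ‖y - (y + (L * δ) • e)‖ := by
      refine PolyPath.of_segment ?_
      rintro z ⟨a, b, ha, hb, hab, rfl⟩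
      have := key 0 1 (a * (L * δ)) le_rfl zero_le_one (by simp) (by simp; positivity)
        (mul_le_of_le_one_left hLδ (by linarith))
      convert this using 1
      rw [← eq_sub_iff_add_eq'] at hab; rw [hab]; module
    refine ⟨_, ?_, (p1.trans p2).trans p3⟩
    have n1 : ‖x + (L * δ) • e - x‖ = L * δ := by
      rw [add_sub_cancel_left, norm_smul, hnorm_e, mul_one, Real.norm_of_nonneg hLδ]
    have n2 : ‖y + (L * δ) • e - (x + (L * δ) • e)‖ = ‖x - y‖ := by
      rw [add_sub_add_right_eq_sub, norm_sub_rev]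
    have n3 : ‖y - (y + (L * δ) • e)‖ = L * δ := by
      rw [sub_add_cancel_left, norm_neg, norm_smul, hnorm_e, mul_one, Real.norm_of_nonneg hLδ]
    rw [n1, n2, n3]
    nlinarith

theorem IsLipschitzDomain.exists_polyPath {Ω : Set E2} (hΩ : IsLipschitzDomain Ω) {x y : E2} (hx : x ∈ Ω)
    (hy : y ∈ Ω) : ∃ l, PolyPath Ω x y l := by
  refine hΩ.isConnected.isPreconnected.induction₂ (fun x y => ∃ l, PolyPath Ω x y l) ?_ ?_ ?_ hx hy
  · intro p hp
    obtain ⟨r, hr, C, -, h⟩ := hΩ.locally_quasiconvex (subset_closure hp)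
    filter_upwards [mem_nhdsWithin_of_mem_nhds (Metric.ball_mem_nhds p hr), self_mem_nhdsWithin]
      with y hy hyΩ
    obtain ⟨l, -, hl⟩ := h p ⟨Metric.mem_ball_self hr, hp⟩ y ⟨hy, hyΩ⟩
    exact ⟨l, hl⟩
  · rintro x y z - - - ⟨l, hl⟩ ⟨l', hl'⟩
    exact ⟨_, hl.trans hl'⟩
  · rintro x y - - ⟨l, hl⟩
    exact ⟨_, hl.symm⟩

/-- Nearby points are joined by the local estimate, points at positive distance by some polygonal
path; compactness of `closure Ω ×ˢ closure Ω` makes the constant uniform. -/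
theorem IsLipschitzDomain.isQuasiconvex {Ω : Set E2} (hΩ : IsLipschitzDomain Ω) :
    IsQuasiconvex Ω := by
  have hcomp : IsCompact (closure Ω ×ˢ closure Ω) :=
    (hΩ.isBounded.isCompact_closure).prod hΩ.isBounded.isCompact_closure
  let P : Set (E2 × E2) → Prop := fun W => ∃ C ≥ (0 : ℝ), ∀ z ∈ W, z.1 ∈ Ω → z.2 ∈ Ω →
    ∃ l ≤ C * ‖z.1 - z.2‖, PolyPath Ω z.1 z.2 l
  have hP : P (closure Ω ×ˢ closure Ω) := by
    refine hcomp.induction_on ⟨0, le_rfl, by simp⟩ ?_ ?_ ?_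
    · rintro s t hst ⟨C, hC0, hC⟩
      exact ⟨C, hC0, fun z hz => hC z (hst hz)⟩
    · rintro s t ⟨C, hC0, hC⟩ ⟨C', hC'0, hC'⟩
      refine ⟨max C C', le_max_of_le_left hC0, fun z hz h1 h2 => ?_⟩
      rcases hz with hz | hz
      · obtain ⟨l, hl, hp⟩ := hC z hz h1 h2
        exact ⟨l, hl.trans (by gcongr; exact le_max_left _ _), hp⟩
      · obtain ⟨l, hl, hp⟩ := hC' z hz h1 h2
        exact ⟨l, hl.trans (by gcongr; exact le_max_right _ _), hp⟩
    · rintro ⟨p, q⟩ ⟨hp, hq⟩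
      obtain ⟨r, hr, C, hC0, hC⟩ := hΩ.locally_quasiconvex hp
      by_cases hpq : p = q
      · subst hpq
        refine ⟨Metric.ball p r ×ˢ Metric.ball p r, mem_nhdsWithin_of_mem_nhds
          (prod_mem_nhds (Metric.ball_mem_nhds p hr) (Metric.ball_mem_nhds p hr)), C, hC0, ?_⟩
        rintro ⟨x, y⟩ ⟨hx, hy⟩ hxΩ hyΩ
        exact hC x ⟨hx, hxΩ⟩ y ⟨hy, hyΩ⟩
      · obtain ⟨r', hr', C', hC'0, hC'⟩ := hΩ.locally_quasiconvex hq
        set d := dist p q with hd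
        have hdpos : 0 < d := dist_pos.2 hpq
        set r₁ := min r (d / 4) with hr₁
        set r₂ := min r' (d / 4) with hr₂
        have hr₁pos : 0 < r₁ := lt_min hr (by positivity)
        have hr₂pos : 0 < r₂ := lt_min hr' (by positivity)
        obtain ⟨x₀, hx₀Ω, hx₀⟩ := Metric.mem_closure_iff.1 hp r₁ hr₁pos
        obtain ⟨y₀, hy₀Ω, hy₀⟩ := Metric.mem_closure_iff.1 hq r₂ hr₂pos
        obtain ⟨l₀, hl₀⟩ := hΩ.exists_polyPath hx₀Ω hy₀Ω
        set K := C * (2 * r) + |l₀| + C' * (2 * r') with hK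
        have hK0 : 0 ≤ K := by positivity
        refine ⟨Metric.ball p r₁ ×ˢ Metric.ball q r₂, mem_nhdsWithin_of_mem_nhds
          (prod_mem_nhds (Metric.ball_mem_nhds p hr₁pos) (Metric.ball_mem_nhds q hr₂pos)),
          K / (d / 2), by positivity, ?_⟩
        rintro ⟨x, y⟩ ⟨hx, hy⟩ hxΩ hyΩ
        simp only [Metric.mem_ball] at hx hy
        have hx₀' : dist x₀ p < r₁ := by rwa [dist_comm]
        have hy₀' : dist y₀ q < r₂ := by rwa [dist_comm]
        obtain ⟨l₁, hl₁, hp₁⟩ := hC x ⟨hx.trans_le (min_le_left _ _), hxΩ⟩ x₀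
          ⟨hx₀'.trans_le (min_le_left _ _), hx₀Ω⟩
        obtain ⟨l₂, hl₂, hp₂⟩ := hC' y₀ ⟨hy₀'.trans_le (min_le_left _ _), hy₀Ω⟩ y
          ⟨hy.trans_le (min_le_left _ _), hyΩ⟩
        refine ⟨_, ?_, (hp₁.trans hl₀).trans hp₂⟩
        have b1 : l₁ ≤ C * (2 * r) := hl₁.trans (by
          gcongr
          rw [← dist_eq_norm]
          have := dist_triangle_right x x₀ p
          have := min_le_left r (d / 4)
          linarith)
        have b2 : l₂ ≤ C' * (2 * r') := hl₂.trans (by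
          gcongr
          rw [← dist_eq_norm]
          have := dist_triangle_right y₀ y q
          have := min_le_left r' (d / 4)
          linarith)
        have b3 : d / 2 ≤ ‖x - y‖ := by
          rw [← dist_eq_norm]
          have t1 := dist_triangle p x q
          have t2 := dist_triangle x y q
          rw [dist_comm p x] at t1
          have := min_le_right r (d / 4)
          have := min_le_right r' (d / 4)
          linarith
        calc l₁ + l₀ + l₂ ≤ K := by have := le_abs_self l₀; linarith
          _ = K / (d / 2) * (d / 2) := by field_simp
          _ ≤ K / (d / 2) * ‖x - y‖ := by gcongr
  obtain ⟨C, -, hC⟩ := hP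
  exact ⟨C, fun x hx y hy => hC (x, y) ⟨subset_closure hx, subset_closure hy⟩ hx hy⟩

/-! ### Comparison with the classes `C^{k,1}` defined by iterated derivatives -/

theorem isReg_of_iteratedFDerivWithin {Ω : Set E2} (hΩ : IsOpen Ω) {F : Type}
    [NormedAddCommGroup F] [NormedSpace ℝ F] {k : ℕ} {K : ℝ} {f : E2 → F}
    (hc : ContDiffOn ℝ k f Ω)
    (hb : ∀ j ≤ k, ∀ x ∈ Ω, ‖iteratedFDerivWithin ℝ j f Ω x‖ ≤ K)
    (hl : ∀ x ∈ Ω, ∀ y ∈ Ω,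
      ‖iteratedFDerivWithin ℝ k f Ω x - iteratedFDerivWithin ℝ k f Ω y‖ ≤ K * ‖x - y‖) :
    IsReg Ω k f := by
  have hu : UniqueDiffOn ℝ Ω := hΩ.uniqueDiffOn
  induction k generalizing F with
  | zero =>
    refine ⟨⟨K, fun x hx => ?_⟩, K, fun x hx y hy => ?_⟩
    · have := hb 0 le_rfl x hx
      rwa [norm_iteratedFDerivWithin_zero] at this
    · have := hl x hx y hy
      rwa [← dist_eq_norm, dist_iteratedFDerivWithin_zero, dist_eq_norm] at this
  | succ k ih =>
    have h1 : IsReg Ω k (fderivWithin ℝ f Ω) := by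
      refine ih (hc.fderivWithin hu (by norm_cast)) (fun j hj x hx => ?_) fun x hx y hy => ?_
      · rw [norm_iteratedFDerivWithin_fderivWithin hu hx]
        exact hb (j + 1) (by omega) x hx
      · have := hl x hx y hy
        rw [iteratedFDerivWithin_succ_eq_comp_right hu hx,
          iteratedFDerivWithin_succ_eq_comp_right hu hy, Function.comp_apply, Function.comp_apply,
          ← dist_eq_norm, LinearIsometryEquiv.dist_map, dist_eq_norm] at this
        exact this
    refine ⟨⟨K, fun x hx => ?_⟩, hc.differentiableOn (by norm_cast), fun i => ?_⟩
    · have := hb 0 (by omega) x hx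
      rwa [norm_iteratedFDerivWithin_zero] at this
    · refine (h1.clm hΩ (ContinuousLinearMap.apply ℝ F (EuclideanSpace.single i 1))).congr hΩ
        fun x hx => ?_
      simp only [ContinuousLinearMap.apply_apply, pder]
      rw [fderivWithin_of_isOpen hΩ hx]

theorem IsCkLip.isReg {Ω : Set E2} (hΩ : IsOpen Ω) {k : ℕ} {f : E2 → E3} (h : IsCkLip k f Ω) :
    IsReg Ω k f := by
  obtain ⟨K, h1, h2, h3⟩ := h
  exact isReg_of_iteratedFDerivWithin hΩ h1 h2 h3

theorem isCkLipWith_one {Ω : Set E2} (hΩ : IsOpen Ω) {f : E2 → E3} {K : ℝ}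
    (hf : DifferentiableOn ℝ f Ω) (hc : ContinuousOn (fderiv ℝ f) Ω)
    (h0 : ∀ x ∈ Ω, ‖f x‖ ≤ K) (h1 : ∀ x ∈ Ω, ‖fderiv ℝ f x‖ ≤ K)
    (h2 : ∀ x ∈ Ω, ∀ y ∈ Ω, ‖fderiv ℝ f x - fderiv ℝ f y‖ ≤ K * ‖x - y‖) :
    IsCkLipWith 1 K f Ω := by
  have hu : UniqueDiffOn ℝ Ω := hΩ.uniqueDiffOn
  have hd : ∀ x ∈ Ω, fderivWithin ℝ f Ω x = fderiv ℝ f x := fun x hx => fderivWithin_of_isOpen hΩ hx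
  refine ⟨?_, fun j hj x hx => ?_, fun x hx y hy => ?_⟩
  · have : ContDiffOn ℝ (0 + 1) f Ω := by
      rw [contDiffOn_succ_iff_fderiv_of_isOpen hΩ]
      exact ⟨hf, by simp, contDiffOn_zero.2 hc⟩
    simpa using this
  · interval_cases j
    · rw [norm_iteratedFDerivWithin_zero]; exact h0 x hx
    · rw [← norm_iteratedFDerivWithin_fderivWithin hu hx, norm_iteratedFDerivWithin_zero, hd x hx]
      exact h1 x hx
  · rw [iteratedFDerivWithin_succ_eq_comp_right hu hx,
      iteratedFDerivWithin_succ_eq_comp_right hu hy, Function.comp_apply, Function.comp_apply,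
      ← dist_eq_norm, LinearIsometryEquiv.dist_map, dist_iteratedFDerivWithin_zero, dist_eq_norm,
      hd x hx, hd y hy]
    exact h2 x hx y hy

theorem IsReg.fderiv_lipschitz {Ω : Set E2} {f : E2 → E3} (hf : IsReg Ω 1 f) :
    ∃ K, ∀ x ∈ Ω, ∀ y ∈ Ω, ‖fderiv ℝ f x - fderiv ℝ f y‖ ≤ K * ‖x - y‖ := by
  obtain ⟨-, L, hL⟩ := hf.partialDeriv 0
  obtain ⟨-, M, hM⟩ := hf.partialDeriv 1
  refine ⟨L + M, fun x hx y hy => ?_⟩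
  refine ContinuousLinearMap.opNorm_le_bound _ ?_ fun z => ?_
  · have h1 := (norm_nonneg _).trans (hL x hx y hy)
    have h2 := (norm_nonneg _).trans (hM x hx y hy)
    linarith
  · rw [_root_.sub_apply, fderiv_apply_eq_pder, fderiv_apply_eq_pder]
    have h0 : ‖z 0‖ ≤ ‖z‖ := PiLp.norm_apply_le z 0
    have h1 : ‖z 1‖ ≤ ‖z‖ := PiLp.norm_apply_le z 1
    calc ‖z 0 • pder f 0 x + z 1 • pder f 1 x - (z 0 • pder f 0 y + z 1 • pder f 1 y)‖
        = ‖z 0 • (pder f 0 x - pder f 0 y) + z 1 • (pder f 1 x - pder f 1 y)‖ := by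
          congr 1; module
      _ ≤ ‖z 0‖ * ‖pder f 0 x - pder f 0 y‖ + ‖z 1‖ * ‖pder f 1 x - pder f 1 y‖ := by
          refine (norm_add_le _ _).trans ?_
          rw [norm_smul, norm_smul]
      _ ≤ ‖z‖ * (L * ‖x - y‖) + ‖z‖ * (M * ‖x - y‖) := by
          gcongr
          exacts [hL x hx y hy, hM x hx y hy]
      _ = _ := by ring

theorem IsReg.exists_isCkLipWith_one {Ω : Set E2} (hΩ : IsOpen Ω) {f : E2 → E3}
    (hf : IsReg Ω 1 f) : ∃ K ≥ 0, IsCkLipWith 1 K f Ω := by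
  obtain ⟨K0, h0⟩ := hf.bdd
  obtain ⟨K1, h1⟩ := hf.fderiv_bdd
  obtain ⟨K2, h2⟩ := hf.fderiv_lipschitz
  refine ⟨|K0| + |K1| + |K2|, by positivity, isCkLipWith_one hΩ hf.2.1 hf.continuousOn_fderiv
    (fun x hx => (h0 x hx).trans ?_) (fun x hx => (h1 x hx).trans ?_)
    fun x hx y hy => (h2 x hx y hy).trans ?_⟩
  · linarith [le_abs_self K0, abs_nonneg K1, abs_nonneg K2]
  · linarith [le_abs_self K1, abs_nonneg K0, abs_nonneg K2]
  · gcongr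
    linarith [le_abs_self K2, abs_nonneg K0, abs_nonneg K1]

theorem IsReg.isCkLip_zero {Ω : Set E2} {f : E2 → E3} (hf : IsReg Ω 0 f) : IsCkLip 0 f Ω := by
  obtain ⟨K0, h0⟩ := hf.bdd
  obtain ⟨-, K1, h1⟩ := id hf
  refine ⟨|K0| + |K1|, ?_, fun j hj x hx => ?_, fun x hx y hy => ?_⟩
  · simpa using hf.continuousOn
  · interval_cases j
    rw [norm_iteratedFDerivWithin_zero]
    exact (h0 x hx).trans (by linarith [le_abs_self K0, abs_nonneg K1])
  · rw [← dist_eq_norm, dist_iteratedFDerivWithin_zero, dist_eq_norm]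
    refine (h1 x hx y hy).trans ?_
    gcongr
    linarith [le_abs_self K1, abs_nonneg K0]

/-! ### Moving frames in the plane -/

/-- The rotation `perp` as a continuous linear map. -/
def perpL : E2 →L[ℝ] E2 :=
  LinearMap.toContinuousLinearMap
    { toFun := perp
      map_add' := fun x y => by ext i; fin_cases i <;> simp [perp]; ring
      map_smul' := fun c x => by ext i; fin_cases i <;> simp [perp] }

theorem perpL_apply (x : E2) : perpL x = perp x := rfl

@[simp] theorem perp_zero (x : E2) : perp x 0 = -(x 1) := rfl

@[simp] theorem perp_one (x : E2) : perp x 1 = x 0 := rfl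

theorem perp_perp (x : E2) : perp (perp x) = -x := by
  ext i; fin_cases i <;> simp

theorem inner_eq_coord (x y : E2) : inner ℝ x y = x 0 * y 0 + x 1 * y 1 := by
  rw [PiLp.inner_apply, Fin.sum_univ_two]
  simp [mul_comm]

theorem unit_sq {t : E2} (ht : ‖t‖ = 1) : t 0 * t 0 + t 1 * t 1 = 1 := by
  rw [← inner_eq_coord, real_inner_self_eq_norm_sq, ht, one_pow]

theorem frame_expand {t : E2} (ht : ‖t‖ = 1) (y : E2) :
    y = inner ℝ t y • t + inner ℝ (perp t) y • perp t := by
  have h := unit_sq ht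
  ext i
  fin_cases i
  · simp [inner_eq_coord]
    linear_combination (-y 0) * h
  · simp [inner_eq_coord]
    linear_combination (-y 1) * h

@[simp] theorem inner_perp_self (t : E2) : inner ℝ (perp t) t = 0 := by
  simp [inner_eq_coord]; ring

@[simp] theorem inner_self_perp (t : E2) : inner ℝ t (perp t) = 0 := by
  simp [inner_eq_coord]; ring

theorem norm_perp (t : E2) : ‖perp t‖ = ‖t‖ := by
  simp [EuclideanSpace.norm_eq, Fin.sum_univ_two, add_comm]

/-- The rotated vector field. -/
def rot (T : E2 → E2) (x : E2) : E2 := perp (T x)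

section Frame

variable {F : Type} [NormedAddCommGroup F] [NormedSpace ℝ F]

theorem pder_eq_frame {T : E2 → E2} {x : E2} (hT : ‖T x‖ = 1) (f : E2 → F) (i : Fin 2) :
    pder f i x = T x i • dd T f x + rot T x i • dd (rot T) f x := by
  have h := unit_sq hT
  rw [dd_eq, dd_eq]
  fin_cases i
  · simp only [rot, perp_zero, perp_one, Fin.zero_eta]
    match_scalars
    · linear_combination -h
    · ring
  · simp only [rot, perp_zero, perp_one, Fin.mk_one]
    match_scalars
    · linear_combination -h
    · ring

/-- Regularity of the derivatives along `T` and `perp T` suffices for regularity. -/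
theorem isReg_of_frame {Ω : Set E2} (hΩ : IsOpen Ω) (hq : IsQuasiconvex Ω) {T : E2 → E2} {k : ℕ}
    (hT : IsReg Ω k T) (hunit : ∀ x ∈ Ω, ‖T x‖ = 1) {f : E2 → F} (hb : ∃ K, ∀ x ∈ Ω, ‖f x‖ ≤ K)
    (hd : DifferentiableOn ℝ f Ω) (h1 : IsReg Ω k (dd T f)) (h2 : IsReg Ω k (dd (rot T) f)) :
    IsReg Ω (k + 1) f := by
  have hN : IsReg Ω k (rot T) := hT.clm hΩ perpL
  refine ⟨hb, hd, fun i => ?_⟩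
  exact (((hT.coord hΩ i).smul hΩ hq h1).add hΩ ((hN.coord hΩ i).smul hΩ hq h2)).congr hΩ
    fun x hx => pder_eq_frame (hunit x hx) f i

theorem IsReg.differentiableAt_fderiv {Ω : Set E2} (hΩ : IsOpen Ω) {k : ℕ} {f : E2 → F}
    (h : IsReg Ω (k + 2) f) {x : E2} (hx : x ∈ Ω) : DifferentiableAt ℝ (fderiv ℝ f) x := by
  have h0 := (h.partialDeriv 0).differentiableAt hΩ hx
  have h1 := (h.partialDeriv 1).differentiableAt hΩ hx
  have e : fderiv ℝ f = fun x =>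
      (ContinuousLinearMap.smulRightL ℝ E2 F) (EuclideanSpace.proj (0 : Fin 2)) (pder f 0 x) +
      (ContinuousLinearMap.smulRightL ℝ E2 F) (EuclideanSpace.proj (1 : Fin 2)) (pder f 1 x) := by
    funext x
    ext1 y
    rw [fderiv_apply_eq_pder]
    simp
  rw [e]
  have hc : ∀ (i : Fin 2) (z : F), DifferentiableAt ℝ
      ((ContinuousLinearMap.smulRightL ℝ E2 F) (EuclideanSpace.proj i)) z := fun i z =>
    ContinuousLinearMap.differentiableAt _
  exact ((hc 0 _).comp x h0).add ((hc 1 _).comp x h1)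

theorem dd_dd {Ω : Set E2} (hΩ : IsOpen Ω) {k : ℕ} {f : E2 → F}
    (h : IsReg Ω (k + 2) f) {X Y : E2 → E2} {x : E2} (hx : x ∈ Ω) (hY : DifferentiableAt ℝ Y x) :
    dd X (dd Y f) x = fderiv ℝ (fderiv ℝ f) x (X x) (Y x) + fderiv ℝ f x (dd X Y x) := by
  have := ((h.differentiableAt_fderiv hΩ hx).hasFDerivAt.clm_apply hY.hasFDerivAt).fderiv
  change fderiv ℝ (fun y => (fderiv ℝ f y) (Y y)) x (X x) = _
  rw [this]
  simp [dd, add_comm]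

theorem fderiv_fderiv_symm {Ω : Set E2} (hΩ : IsOpen Ω) {k : ℕ} {f : E2 → F}
    (h : IsReg Ω (k + 2) f) {x : E2} (hx : x ∈ Ω) (v w : E2) :
    fderiv ℝ (fderiv ℝ f) x v w = fderiv ℝ (fderiv ℝ f) x w v := by
  refine second_derivative_symmetric_of_eventually (f := f) (x := x) ?_
    (h.differentiableAt_fderiv hΩ hx).hasFDerivAt v w
  filter_upwards [hΩ.mem_nhds hx] with y hy
  exact (h.differentiableAt hΩ hy).hasFDerivAt

end Frame

/-! ### Ruled planar domains -/

/-- The point of parameter `l` on the ruling through `x`, where `l = 1` is `x` itself and `l = 0`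
is the point at which the signed distance `s` along the ruling vanishes. -/
def ray (T : E2 → E2) (s : E2 → ℝ) (l : ℝ) (x : E2) : E2 := x - ((1 - l) * s x) • rot T x

/-- A planar domain `Ω` foliated by segments (the rulings) which cross a common curve: `T` is the
unit field orthogonal to the rulings and `s` the signed distance to the curve, measured
along the rulings. -/
structure IsRuling (Ω : Set E2) (m : ℕ) (T : E2 → E2) (s : E2 → ℝ) : Prop where
  isOpen : IsOpen Ω
  quasiconvex : IsQuasiconvex Ω
  reg : IsReg Ω (m + 1) T
  unit : ∀ x ∈ Ω, ‖T x‖ = 1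
  s_bdd : ∃ K, ∀ x ∈ Ω, ‖s x‖ ≤ K
  s_deriv : ∀ x ∈ Ω, HasFDerivAt s (innerSL ℝ (rot T x)) x
  ray_mem : ∀ x ∈ Ω, ∀ l ∈ Icc (0 : ℝ) 1, ray T s l x ∈ Ω
  T_ray : ∀ x ∈ Ω, ∀ l ∈ Icc (0 : ℝ) 1, T (ray T s l x) = T x
  s_ray : ∀ x ∈ Ω, ∀ l ∈ Icc (0 : ℝ) 1, s (ray T s l x) = l * s x
  T_local : ∀ x ∈ Ω, ∀ᶠ τ in 𝓝 (0 : ℝ), T (x + τ • rot T x) = T x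

/-- The curvature of the curves orthogonal to the rulings. -/
def curv (T : E2 → E2) (x : E2) : ℝ := inner ℝ (rot T x) (dd T T x)

/-- The factor `1 + sμ`, `μ` being the curvature of the orthogonal curves. -/
def stretch (T : E2 → E2) (s : E2 → ℝ) (x : E2) : ℝ := 1 + s x * curv T x

/-- The factor `1 - sκ`, `κ` being the curvature, at the foot point of the ruling, of the curve
`s = 0`; it is the Jacobian of the coordinates given by `s` and the arclength of that curve. -/
def jac (T : E2 → E2) (s : E2 → ℝ) (x : E2) : ℝ := 1 - s x * curv T (ray T s 0 x)

/-- The weighted average `∫ λⁿ f(x_λ) dν(λ)` of `f` over the part of the ruling between `x` and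
its foot point. -/
def avg {F : Type} [NormedAddCommGroup F] [NormedSpace ℝ F] (T : E2 → E2) (s : E2 → ℝ)
    (ν : Measure ℝ) (n : ℕ) (f : E2 → F) (x : E2) : F :=
  ∫ l in Icc (0 : ℝ) 1, l ^ n • f (ray T s l x) ∂ν

/-- The primitive of `f` along the rulings which vanishes for `s = 0`. -/
def prim {F : Type} [NormedAddCommGroup F] [NormedSpace ℝ F] (T : E2 → E2) (s : E2 → ℝ)
    (f : E2 → F) (x : E2) : F := s x • avg T s volume 0 f x

namespace IsRuling

variable {Ω : Set E2} {m : ℕ} {T : E2 → E2} {s : E2 → ℝ}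

theorem differentiableAt_T (h : IsRuling Ω m T s) {x : E2} (hx : x ∈ Ω) :
    DifferentiableAt ℝ T x := h.reg.differentiableAt h.isOpen hx

theorem hasFDerivAt_rot (h : IsRuling Ω m T s) {x : E2} (hx : x ∈ Ω) :
    HasFDerivAt (rot T) (perpL.comp (fderiv ℝ T x)) x :=
  perpL.hasFDerivAt.comp x (h.differentiableAt_T hx).hasFDerivAt

theorem dd_rot (h : IsRuling Ω m T s) (X : E2 → E2) {x : E2} (hx : x ∈ Ω) :
    dd X (rot T) x = perp (dd X T x) := by
  simp only [dd]
  rw [(h.hasFDerivAt_rot hx).fderiv]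
  rfl

theorem reg_rot (h : IsRuling Ω m T s) : IsReg Ω (m + 1) (rot T) := h.reg.clm h.isOpen perpL

theorem norm_rot (h : IsRuling Ω m T s) {x : E2} (hx : x ∈ Ω) : ‖rot T x‖ = 1 := by
  rw [rot, norm_perp, h.unit x hx]

theorem reg_T (h : IsRuling Ω m T s) : IsReg Ω m T := h.reg.of_succ h.isOpen h.quasiconvex

theorem reg_rot' (h : IsRuling Ω m T s) : IsReg Ω m (rot T) :=
  h.reg_rot.of_succ h.isOpen h.quasiconvex

theorem ddN_T (h : IsRuling Ω m T s) {x : E2} (hx : x ∈ Ω) : dd (rot T) T x = 0 := by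
  have h1 : HasDerivAt (fun τ : ℝ => x + τ • rot T x) (rot T x) 0 := by
    simpa using ((hasDerivAt_id (0 : ℝ)).smul_const (rot T x)).const_add x
  have h0 : HasFDerivAt T (fderiv ℝ T x) (x + (0 : ℝ) • rot T x) := by
    simpa using (h.differentiableAt_T hx).hasFDerivAt
  have h2 : HasDerivAt (fun τ : ℝ => T (x + τ • rot T x)) (dd (rot T) T x) 0 :=
    h0.comp_hasDerivAt 0 h1
  have h3 : HasDerivAt (fun τ : ℝ => T (x + τ • rot T x)) 0 0 :=
    (hasDerivAt_const (0 : ℝ) (T x)).congr_of_eventuallyEq (h.T_local x hx)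
  exact h2.unique h3

theorem ddT_T (h : IsRuling Ω m T s) {x : E2} (hx : x ∈ Ω) :
    dd T T x = curv T x • rot T x := by
  have h1 : dd T (fun y => inner ℝ (T y) (T y)) x = 0 := by
    have : EqOn (fun y => (inner ℝ (T y) (T y) : ℝ)) (fun _ => 1) Ω := fun y hy => by
      simp only
      rw [real_inner_self_eq_norm_sq, h.unit y hy, one_pow]
    rw [dd_congr h.isOpen T this hx]
    simp [dd]
  rw [dd_inner T (h.differentiableAt_T hx) (h.differentiableAt_T hx), real_inner_comm] at h1
  have h2 := frame_expand (h.unit x hx) (dd T T x)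
  rw [show (inner ℝ (T x) (dd T T x) : ℝ) = 0 by linarith, zero_smul, zero_add] at h2
  exact h2

theorem ddT_rot (h : IsRuling Ω m T s) {x : E2} (hx : x ∈ Ω) :
    dd T (rot T) x = -(curv T x • T x) := by
  rw [h.dd_rot _ hx, h.ddT_T hx, ← perpL_apply, map_smul, perpL_apply, rot, perp_perp, smul_neg]

theorem ddN_s (h : IsRuling Ω m T s) {x : E2} (hx : x ∈ Ω) : dd (rot T) s x = 1 := by
  simp only [dd]
  rw [(h.s_deriv x hx).fderiv, innerSL_apply_apply, real_inner_self_eq_norm_sq, h.norm_rot hx,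
    one_pow]

theorem ddT_s (h : IsRuling Ω m T s) {x : E2} (hx : x ∈ Ω) : dd T s x = 0 := by
  simp only [dd]
  rw [(h.s_deriv x hx).fderiv, innerSL_apply_apply, rot, inner_perp_self]

theorem reg_curv (h : IsRuling Ω m T s) : IsReg Ω m (curv T) :=
  h.reg_rot'.innerProd h.isOpen h.quasiconvex (h.reg_T.dirDeriv h.isOpen h.quasiconvex h.reg)

theorem reg_s (h : IsRuling Ω m T s) : IsReg Ω (m + 1) s := by
  refine ⟨h.s_bdd, fun x hx => (h.s_deriv x hx).differentiableAt.differentiableWithinAt,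
    fun i => (h.reg_rot'.coord h.isOpen i).congr h.isOpen fun x hx => ?_⟩
  simp only [pder]
  rw [(h.s_deriv x hx).fderiv, innerSL_apply_apply, inner_eq_coord]
  fin_cases i <;> simp

theorem reg_s' (h : IsRuling Ω m T s) : IsReg Ω m s := h.reg_s.of_succ h.isOpen h.quasiconvex

theorem reg_stretch (h : IsRuling Ω m T s) : IsReg Ω m (stretch T s) :=
  (isReg_const 1).add h.isOpen (h.reg_s'.mul h.isOpen h.quasiconvex h.reg_curv)

/-- Differentiation across the rulings does not commute with differentiation along them. -/
theorem commutator {F : Type} [NormedAddCommGroup F] [NormedSpace ℝ F] (h : IsRuling Ω m T s)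
    {k : ℕ} {f : E2 → F} (hf : IsReg Ω (k + 2) f) {x : E2} (hx : x ∈ Ω) :
    dd (rot T) (dd T f) x = dd T (dd (rot T) f) x + curv T x • dd T f x := by
  rw [dd_dd h.isOpen hf hx (h.differentiableAt_T hx),
    dd_dd h.isOpen hf hx (h.reg_rot.differentiableAt h.isOpen hx), h.ddN_T hx, h.ddT_rot hx,
    fderiv_fderiv_symm h.isOpen hf hx]
  simp [dd]

/-! ### Averages along the rulings -/

/-- The derivative of `ray T s l` at `x`. -/
def rayDeriv (T : E2 → E2) (s : E2 → ℝ) (l : ℝ) (x : E2) : E2 →L[ℝ] E2 :=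
  ContinuousLinearMap.id ℝ E2 - (1 - l) • (s x • perpL.comp (fderiv ℝ T x) +
    (innerSL ℝ (rot T x)).smulRight (rot T x))

theorem hasFDerivAt_ray (h : IsRuling Ω m T s) (l : ℝ) {x : E2} (hx : x ∈ Ω) :
    HasFDerivAt (ray T s l) (rayDeriv T s l x) x := by
  have h1 := ((h.s_deriv x hx).smul (h.hasFDerivAt_rot hx)).const_smul (1 - l)
  have h2 := (hasFDerivAt_id x).sub h1
  refine h2.congr_of_eventuallyEq (Eventually.of_forall fun y => ?_)
  simp [ray, smul_smul]

theorem rayDeriv_rot (h : IsRuling Ω m T s) (l : ℝ) {x : E2} (hx : x ∈ Ω) :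
    rayDeriv T s l x (rot T x) = l • rot T x := by
  have h1 : perpL (fderiv ℝ T x (rot T x)) = 0 := by
    have := h.ddN_T hx
    simp only [dd] at this
    rw [this, map_zero]
  have h2 : (inner ℝ (rot T x) (rot T x) : ℝ) = 1 := by
    rw [real_inner_self_eq_norm_sq, h.norm_rot hx, one_pow]
  simp only [rayDeriv, _root_.sub_apply, _root_.smul_apply, _root_.add_apply,
    ContinuousLinearMap.comp_apply, h1, ContinuousLinearMap.smulRight_apply, innerSL_apply_apply,
    h2, ContinuousLinearMap.id_apply]
  module

theorem rayDeriv_T (h : IsRuling Ω m T s) (l : ℝ) {x : E2} (hx : x ∈ Ω) :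
    rayDeriv T s l x (T x) = (1 + (1 - l) * (s x * curv T x)) • T x := by
  have h1 : perpL (fderiv ℝ T x (T x)) = -(curv T x • T x) := by
    have h1 := h.ddT_T hx
    simp only [dd] at h1
    rw [h1, map_smul, perpL_apply, rot, perp_perp, smul_neg]
  have h2 : (inner ℝ (rot T x) (T x) : ℝ) = 0 := inner_perp_self _
  simp only [rayDeriv, _root_.sub_apply, _root_.smul_apply, _root_.add_apply,
    ContinuousLinearMap.comp_apply, h1, ContinuousLinearMap.smulRight_apply, innerSL_apply_apply,
    h2, ContinuousLinearMap.id_apply]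
  module

theorem rot_ray (h : IsRuling Ω m T s) {x : E2} (hx : x ∈ Ω) {l : ℝ} (hl : l ∈ Icc (0 : ℝ) 1) :
    rot T (ray T s l x) = rot T x := by
  rw [rot, h.T_ray x hx l hl, rot]

/-- The radii of curvature of the orthogonal curves vary linearly along a ruling. -/
theorem curv_ray (h : IsRuling Ω m T s) {x : E2} (hx : x ∈ Ω) {l : ℝ} (hl : l ∈ Icc (0 : ℝ) 1) :
    (1 + (1 - l) * (s x * curv T x)) * curv T (ray T s l x) = curv T x := by
  have hy := h.ray_mem x hx l hl
  have h1 : HasFDerivAt (fun y => T (ray T s l y))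
      ((fderiv ℝ T (ray T s l x)).comp (rayDeriv T s l x)) x :=
    (h.differentiableAt_T hy).hasFDerivAt.comp x (h.hasFDerivAt_ray l hx)
  have h2 : (fderiv ℝ T (ray T s l x)).comp (rayDeriv T s l x) = fderiv ℝ T x := by
    rw [← h1.fderiv]
    refine Filter.EventuallyEq.fderiv_eq ?_
    filter_upwards [h.isOpen.mem_nhds hx] with y hy using h.T_ray y hy l hl
  have h3 : (1 + (1 - l) * (s x * curv T x)) • dd T T (ray T s l x) = dd T T x := by
    simp only [dd]
    rw [h.T_ray x hx l hl, ← h2, ContinuousLinearMap.comp_apply, h.rayDeriv_T l hx, map_smul]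
  have h4 := congrArg (fun v => (inner ℝ (rot T x) v : ℝ)) h3
  simp only [inner_smul_right] at h4
  rw [curv, curv, h.rot_ray hx hl]
  exact h4

theorem stretch_mul_jac (h : IsRuling Ω m T s) {x : E2} (hx : x ∈ Ω) :
    stretch T s x * jac T s x = 1 := by
  have h1 := h.curv_ray hx (l := 0) ⟨le_rfl, zero_le_one⟩
  simp only [stretch, jac]
  linear_combination (-s x) * h1

/-- The factor by which `ray T s l` stretches lengths across the rulings is a product of a function
at `x` and a function at the image point. -/
theorem rayDeriv_factor (h : IsRuling Ω m T s) {x : E2} (hx : x ∈ Ω) {l : ℝ}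
    (hl : l ∈ Icc (0 : ℝ) 1) :
    1 + (1 - l) * (s x * curv T x) = stretch T s x * jac T s (ray T s l x) := by
  have h1 := h.curv_ray hx hl
  have h2 := h.stretch_mul_jac (h.ray_mem x hx l hl)
  have h3 : (1 + (1 - l) * (s x * curv T x)) * stretch T s (ray T s l x) = stretch T s x := by
    simp only [stretch]
    rw [h.s_ray x hx l hl]
    linear_combination (l * s x) * h1
  rw [← h3, mul_assoc, h2, mul_one]

variable {F : Type} [NormedAddCommGroup F] [NormedSpace ℝ F]

theorem continuous_ray (T : E2 → E2) (s : E2 → ℝ) (x : E2) :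
    Continuous fun l => ray T s l x := by
  unfold ray; fun_prop

theorem continuousOn_ray {X : Type} [TopologicalSpace X] (h : IsRuling Ω m T s) {x : E2}
    (hx : x ∈ Ω) {f : E2 → X}
    (hf : ContinuousOn f Ω) : ContinuousOn (fun l => f (ray T s l x)) (Icc 0 1) :=
  hf.comp (continuous_ray T s x).continuousOn fun l hl => h.ray_mem x hx l hl

theorem integrableOn_ray (h : IsRuling Ω m T s) (ν : Measure ℝ)
    [IsFiniteMeasureOnCompacts ν] (n : ℕ) {x : E2}
    (hx : x ∈ Ω) {f : E2 → F} (hf : ContinuousOn f Ω) :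
    IntegrableOn (fun l => l ^ n • f (ray T s l x)) (Icc 0 1) ν :=
  ContinuousOn.integrableOn_Icc
    ((continuous_pow n).continuousOn.smul (h.continuousOn_ray hx hf))

end IsRuling

namespace IsRuling

variable {Ω : Set E2} {m : ℕ} {T : E2 → E2} {s : E2 → ℝ}
variable {F : Type} [NormedAddCommGroup F] [NormedSpace ℝ F]

theorem continuous_rayDeriv (T : E2 → E2) (s : E2 → ℝ) (x : E2) :
    Continuous fun l => rayDeriv T s l x := by
  unfold rayDeriv; fun_prop

theorem rayDeriv_bdd (h : IsRuling Ω m T s) :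
    ∃ K, ∀ x ∈ Ω, ∀ l ∈ Icc (0 : ℝ) 1, ‖rayDeriv T s l x‖ ≤ K := by
  obtain ⟨S, hS⟩ := h.s_bdd
  obtain ⟨K, hK⟩ := h.reg_rot.fderiv_bdd
  refine ⟨1 + (S * K + 1), fun x hx l hl => ?_⟩
  have hS0 : 0 ≤ S := (norm_nonneg _).trans (hS x hx)
  have hK0 : 0 ≤ K := (norm_nonneg _).trans (hK x hx)
  have h1 : ‖s x • perpL.comp (fderiv ℝ T x) + (innerSL ℝ (rot T x)).smulRight (rot T x)‖
      ≤ S * K + 1 := by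
    refine (norm_add_le _ _).trans (add_le_add ?_ ?_)
    · rw [norm_smul, ← (h.hasFDerivAt_rot hx).fderiv]
      gcongr
      exacts [hS x hx, hK x hx]
    · rw [ContinuousLinearMap.norm_smulRight_apply, innerSL_apply_norm, h.norm_rot hx, mul_one]
  refine (norm_sub_le _ _).trans (add_le_add ContinuousLinearMap.norm_id_le ?_)
  rw [norm_smul]
  calc ‖1 - l‖ * _ ≤ 1 * (S * K + 1) := by
        gcongr
        rw [Real.norm_eq_abs, abs_le]; constructor <;> linarith [hl.1, hl.2]
    _ = _ := one_mul _

theorem avg_bdd (h : IsRuling Ω m T s) (ν : Measure ℝ) [IsFiniteMeasureOnCompacts ν] (n : ℕ)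
    {f : E2 → F} (hf : ∃ K, ∀ x ∈ Ω, ‖f x‖ ≤ K) : ∃ K, ∀ x ∈ Ω, ‖avg T s ν n f x‖ ≤ K := by
  obtain ⟨K, hK⟩ := hf
  refine ⟨K * ν.real (Icc 0 1), fun x hx => ?_⟩
  refine norm_setIntegral_le_of_norm_le_const isCompact_Icc.measure_lt_top fun l hl => ?_
  rw [norm_smul, norm_pow]
  have h1 : ‖l‖ ^ n ≤ 1 := pow_le_one₀ (norm_nonneg _) (by
    rw [Real.norm_eq_abs, abs_le]; constructor <;> linarith [hl.1, hl.2])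
  calc ‖l‖ ^ n * ‖f (ray T s l x)‖ ≤ 1 * ‖f (ray T s l x)‖ := by gcongr
    _ ≤ K := by rw [one_mul]; exact hK _ (h.ray_mem x hx l hl)

theorem hasFDerivAt_avg (h : IsRuling Ω m T s) (ν : Measure ℝ) [IsFiniteMeasureOnCompacts ν]
    (n : ℕ) {k : ℕ} {f : E2 → F} (hf : IsReg Ω (k + 1) f) {x : E2} (hx : x ∈ Ω) :
    HasFDerivAt (avg T s ν n f)
      (∫ l in Icc (0 : ℝ) 1, l ^ n • (fderiv ℝ f (ray T s l x)).comp (rayDeriv T s l x) ∂ν) x ∧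
    IntegrableOn (fun l => l ^ n • (fderiv ℝ f (ray T s l x)).comp (rayDeriv T s l x))
      (Icc (0 : ℝ) 1) ν := by
  obtain ⟨K, hK⟩ := hf.fderiv_bdd
  obtain ⟨R, hR⟩ := h.rayDeriv_bdd
  have hc : ContinuousOn (fun l => l ^ n • (fderiv ℝ f (ray T s l x)).comp (rayDeriv T s l x))
      (Icc (0 : ℝ) 1) :=
    (continuous_pow n).continuousOn.smul
      ((h.continuousOn_ray hx hf.continuousOn_fderiv).clm_comp
        (continuous_rayDeriv T s x).continuousOn)
  refine ⟨?_, hc.integrableOn_Icc⟩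
  refine hasFDerivAt_integral_of_dominated_of_fderiv_le (s := Ω) (bound := fun _ => K * R)
    (F := fun x l => l ^ n • f (ray T s l x))
    (F' := fun x l => l ^ n • (fderiv ℝ f (ray T s l x)).comp (rayDeriv T s l x))
    (h.isOpen.mem_nhds hx) ?_ ?_ ?_ ?_ ?_ ?_
  · filter_upwards [h.isOpen.mem_nhds hx] with y hy
    exact (h.integrableOn_ray ν n hy hf.continuousOn).aestronglyMeasurable
  · exact h.integrableOn_ray ν n hx hf.continuousOn
  · exact hc.aestronglyMeasurable measurableSet_Icc
  · refine ae_restrict_of_forall_mem measurableSet_Icc fun l hl y hy => ?_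
    have hK0 := (norm_nonneg _).trans (hK y hy)
    rw [norm_smul, norm_pow]
    have h1 : ‖l‖ ^ n ≤ 1 := pow_le_one₀ (norm_nonneg _) (by
      rw [Real.norm_eq_abs, abs_le]; constructor <;> linarith [hl.1, hl.2])
    calc _ ≤ 1 * (K * R) := by
          gcongr
          refine (ContinuousLinearMap.opNorm_comp_le _ _).trans ?_
          gcongr
          exacts [hK _ (h.ray_mem y hy l hl), hR y hy l hl]
      _ = _ := one_mul _
  · exact integrableOn_const isCompact_Icc.measure_lt_top.ne
  · refine ae_restrict_of_forall_mem measurableSet_Icc fun l hl y hy => ?_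
    exact ((hf.differentiableAt h.isOpen (h.ray_mem y hy l hl)).hasFDerivAt.comp y
      (h.hasFDerivAt_ray l hy)).const_smul (l ^ n)

theorem ddN_avg [CompleteSpace F] (h : IsRuling Ω m T s) (ν : Measure ℝ)
    [IsFiniteMeasureOnCompacts ν] (n : ℕ) {k : ℕ} {f : E2 → F} (hf : IsReg Ω (k + 1) f) {x : E2}
    (hx : x ∈ Ω) : dd (rot T) (avg T s ν n f) x = avg T s ν (n + 1) (dd (rot T) f) x := by
  obtain ⟨h1, h2⟩ := h.hasFDerivAt_avg ν n hf hx
  simp only [dd, avg]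
  rw [h1.fderiv, ContinuousLinearMap.integral_apply h2]
  refine setIntegral_congr_fun measurableSet_Icc fun l hl => ?_
  simp only [_root_.smul_apply, ContinuousLinearMap.comp_apply, h.rayDeriv_rot l hx, map_smul,
    h.rot_ray hx hl, smul_smul, pow_succ]

theorem ddT_avg [CompleteSpace F] (h : IsRuling Ω m T s) (ν : Measure ℝ)
    [IsFiniteMeasureOnCompacts ν] (n : ℕ) {k : ℕ} {f : E2 → F} (hf : IsReg Ω (k + 1) f) {x : E2}
    (hx : x ∈ Ω) : dd T (avg T s ν n f) x =
      stretch T s x • avg T s ν n (fun y => jac T s y • dd T f y) x := by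
  obtain ⟨h1, h2⟩ := h.hasFDerivAt_avg ν n hf hx
  simp only [dd, avg]
  rw [h1.fderiv, ContinuousLinearMap.integral_apply h2, ← integral_smul]
  refine setIntegral_congr_fun measurableSet_Icc fun l hl => ?_
  simp only [_root_.smul_apply, ContinuousLinearMap.comp_apply, h.rayDeriv_T l hx, map_smul,
    h.T_ray x hx l hl, h.rayDeriv_factor hx hl, smul_smul]
  congr 1
  ring

theorem avg_dirac [CompleteSpace F] (f : E2 → F) (x : E2) :
    avg T s (Measure.dirac 0) 0 f x = f (ray T s 0 x) := by
  simp only [avg, pow_zero, one_smul]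
  rw [setIntegral_dirac]
  simp

theorem isReg_avg_zero (h : IsRuling Ω m T s) (ν : Measure ℝ)
    [IsFiniteMeasureOnCompacts ν] (n : ℕ) {f : E2 → F} (hf : IsReg Ω 0 f) :
    IsReg Ω 0 (avg T s ν n f) := by
  refine ⟨h.avg_bdd ν n hf.bdd, ?_⟩
  have hr : IsReg Ω 0 fun x => s x • rot T x :=
    (h.reg_s.smul h.isOpen h.quasiconvex h.reg_rot).mono h.isOpen h.quasiconvex (Nat.zero_le _)
  obtain ⟨-, L, hL⟩ := hr
  obtain ⟨-, M, hM⟩ := id hf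
  refine ⟨|M| * (1 + L) * ν.real (Icc 0 1), fun x hx y hy => ?_⟩
  have hL0 := (norm_nonneg _).trans (hL x hx y hy)
  simp only [avg]
  rw [← integral_sub (h.integrableOn_ray ν n hx hf.continuousOn)
    (h.integrableOn_ray ν n hy hf.continuousOn)]
  have : ∀ l ∈ Icc (0 : ℝ) 1, ‖l ^ n • f (ray T s l x) - l ^ n • f (ray T s l y)‖ ≤
      |M| * (1 + L) * ‖x - y‖ := fun l hl => by
    have h1 : ‖l‖ ^ n ≤ 1 := pow_le_one₀ (norm_nonneg _) (by
      rw [Real.norm_eq_abs, abs_le]; constructor <;> linarith [hl.1, hl.2])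
    have h2 : ‖1 - l‖ ≤ 1 := by
      rw [Real.norm_eq_abs, abs_le]; constructor <;> linarith [hl.1, hl.2]
    have h3 : ‖ray T s l x - ray T s l y‖ ≤ (1 + L) * ‖x - y‖ := by
      have : ray T s l x - ray T s l y = (x - y) - (1 - l) • (s x • rot T x - s y • rot T y) := by
        simp only [ray]; module
      rw [this]
      calc _ ≤ ‖x - y‖ + 1 * (L * ‖x - y‖) := by
            refine (norm_sub_le _ _).trans ?_
            rw [norm_smul]
            gcongr
            exact hL x hx y hy
        _ = _ := by ring
    rw [← smul_sub, norm_smul, norm_pow]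
    calc _ ≤ 1 * (|M| * ((1 + L) * ‖x - y‖)) := by
          gcongr
          refine (hM _ (h.ray_mem x hx l hl) _ (h.ray_mem y hy l hl)).trans ?_
          gcongr
          exact le_abs_self M
      _ = _ := by ring
  calc _ ≤ |M| * (1 + L) * ‖x - y‖ * ν.real (Icc 0 1) :=
        norm_setIntegral_le_of_norm_le_const isCompact_Icc.measure_lt_top this
    _ = _ := by ring

/-- The Jacobian factor is as regular as the averages of functions with the regularity of the
curvature are. -/
theorem isReg_jac_of_avg (h : IsRuling Ω m T s) {k : ℕ} (hk : k ≤ m)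
    (H : ∀ f : E2 → ℝ, IsReg Ω k f → IsReg Ω k (avg T s (Measure.dirac 0) 0 f)) :
    IsReg Ω k (jac T s) := by
  have h1 := H _ (h.reg_curv.mono h.isOpen h.quasiconvex hk)
  refine ((isReg_const 1).sub h.isOpen ((h.reg_s'.mono h.isOpen h.quasiconvex hk).mul h.isOpen
    h.quasiconvex h1)).congr h.isOpen fun x _ => ?_
  rw [avg_dirac, jac]

/-- Averages preserve regularity. The derivative across the rulings brings in the Jacobian factor,
whose regularity of order `k` is part of what has been shown at the preceding step. -/
theorem isReg_avg_aux (h : IsRuling Ω m T s) (k : ℕ) : k ≤ m + 1 →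
    ∀ (F : Type) [NormedAddCommGroup F] [NormedSpace ℝ F] [CompleteSpace F] (ν : Measure ℝ)
      [IsFiniteMeasureOnCompacts ν] (n : ℕ) (f : E2 → F),
      IsReg Ω k f → IsReg Ω k (avg T s ν n f) := by
  induction k with
  | zero => exact fun _ F _ _ _ ν _ n f hf => h.isReg_avg_zero ν n hf
  | succ k ih =>
    intro hk F _ _ _ ν _ n f hf
    have hjac := h.isReg_jac_of_avg (k := k) (by omega) fun f hf => ih (by omega) ℝ _ _ f hf
    have hT : IsReg Ω k T := h.reg.mono h.isOpen h.quasiconvex (by omega)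
    have hN : IsReg Ω k (rot T) := h.reg_rot.mono h.isOpen h.quasiconvex (by omega)
    refine isReg_of_frame h.isOpen h.quasiconvex hT h.unit (h.avg_bdd ν n hf.bdd)
      (fun x hx => (h.hasFDerivAt_avg ν n hf hx).1.differentiableAt.differentiableWithinAt) ?_ ?_
    · refine IsReg.congr h.isOpen ?_ fun x hx => h.ddT_avg ν n hf hx
      exact (h.reg_stretch.mono h.isOpen h.quasiconvex (by omega)).smul h.isOpen h.quasiconvex
        (ih (by omega) F ν n _ (hjac.smul h.isOpen h.quasiconvex
          (hT.dirDeriv h.isOpen h.quasiconvex hf)))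
    · refine IsReg.congr h.isOpen ?_ fun x hx => h.ddN_avg ν n hf hx
      exact ih (by omega) F ν (n + 1) _ (hN.dirDeriv h.isOpen h.quasiconvex hf)

theorem isReg_avg [CompleteSpace F] (h : IsRuling Ω m T s) {k : ℕ} (hk : k ≤ m + 1)
    (ν : Measure ℝ) [IsFiniteMeasureOnCompacts ν] (n : ℕ) {f : E2 → F} (hf : IsReg Ω k f) :
    IsReg Ω k (avg T s ν n f) :=
  h.isReg_avg_aux k hk F ν n f hf

/-- Foot point values are averages with respect to the Dirac measure at `0`. -/
theorem isReg_foot [CompleteSpace F] (h : IsRuling Ω m T s) {k : ℕ} (hk : k ≤ m + 1)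
    {f : E2 → F} (hf : IsReg Ω k f) : IsReg Ω k (fun x => f (ray T s 0 x)) :=
  (h.isReg_avg hk (Measure.dirac 0) 0 hf).congr h.isOpen fun x _ => (avg_dirac f x).symm

theorem isReg_jac (h : IsRuling Ω m T s) : IsReg Ω m (jac T s) :=
  h.isReg_jac_of_avg le_rfl fun _ hf => h.isReg_avg (by omega) _ 0 hf

theorem isReg_prim [CompleteSpace F] (h : IsRuling Ω m T s) {k : ℕ} (hk : k ≤ m + 1)
    {f : E2 → F} (hf : IsReg Ω k f) : IsReg Ω k (prim T s f) :=
  (h.reg_s.mono h.isOpen h.quasiconvex hk).smul h.isOpen h.quasiconvex (h.isReg_avg hk _ 0 hf)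

theorem ddN_jac (h : IsRuling Ω (m + 1) T s) {x : E2} (hx : x ∈ Ω) :
    dd (rot T) (jac T s) x = -(curv T x * jac T s x) := by
  have h1 : EqOn (jac T s) (fun y => (1 : ℝ) - s y * avg T s (Measure.dirac 0) 0 (curv T) y) Ω :=
    fun y _ => by simp only [avg_dirac, jac]
  have hd := (h.hasFDerivAt_avg (Measure.dirac 0) 0 h.reg_curv hx).1.differentiableAt
  have h2 : dd (rot T) (avg T s (Measure.dirac 0) 0 (curv T)) x = 0 := by
    rw [h.ddN_avg _ 0 h.reg_curv hx]
    simp only [avg]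
    rw [setIntegral_dirac]
    simp
  rw [dd_congr h.isOpen _ h1 hx, dd_sub _ (differentiableAt_const _)
    ((h.s_deriv x hx).differentiableAt.fun_mul hd), dd_mul _ (h.s_deriv x hx).differentiableAt hd,
    h.ddN_s hx, h2, avg_dirac]
  have h3 := h.curv_ray hx (l := 0) ⟨le_rfl, zero_le_one⟩
  simp only [dd, fderiv_fun_const, Pi.zero_apply, _root_.zero_apply, jac]
  linear_combination -h3

theorem hasDerivAt_ray (T : E2 → E2) (s : E2 → ℝ) (l : ℝ) (x : E2) :
    HasDerivAt (fun l => ray T s l x) (s x • rot T x) l := by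
  have h1 := (((hasDerivAt_id l).const_sub 1).mul_const (s x)).smul_const (rot T x)
  have h2 := (h1.const_sub x)
  refine h2.congr_deriv ?_
  module

theorem hasDerivAt_comp_ray (h : IsRuling Ω m T s) {k : ℕ} {f : E2 → F} (hf : IsReg Ω (k + 1) f)
    {x : E2} (hx : x ∈ Ω) {l : ℝ} (hl : l ∈ Icc (0 : ℝ) 1) :
    HasDerivAt (fun l => f (ray T s l x)) (s x • dd (rot T) f (ray T s l x)) l := by
  have h1 := (hf.differentiableAt h.isOpen (h.ray_mem x hx l hl)).hasFDerivAt.comp_hasDerivAt l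
    (hasDerivAt_ray T s l x)
  refine h1.congr_deriv ?_
  rw [dd, h.rot_ray hx hl, map_smul]

theorem prim_eq (T : E2 → E2) (s : E2 → ℝ) (f : E2 → F) (x : E2) :
    prim T s f x = ∫ l in (0 : ℝ)..1, s x • f (ray T s l x) := by
  rw [prim, avg, intervalIntegral.integral_smul, intervalIntegral.integral_of_le zero_le_one,
    integral_Icc_eq_integral_Ioc]
  simp

theorem prim_ddN [CompleteSpace F] (h : IsRuling Ω m T s) {f : E2 → F} (hf : IsReg Ω 1 f)
    {x : E2} (hx : x ∈ Ω) : prim T s (dd (rot T) f) x = f x - f (ray T s 0 x) := by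
  have hc := (h.reg_rot.mono h.isOpen h.quasiconvex (Nat.zero_le _)).dirDeriv h.isOpen
    h.quasiconvex hf
  have h1 := intervalIntegral.integral_eq_sub_of_hasDerivAt (a := 0) (b := 1)
    (f := fun l => f (ray T s l x)) (f' := fun l => s x • dd (rot T) f (ray T s l x))
    (fun l hl => h.hasDerivAt_comp_ray hf hx (by rwa [uIcc_of_le zero_le_one] at hl))
    (ContinuousOn.intervalIntegrable (by
      rw [uIcc_of_le zero_le_one]
      exact (h.continuousOn_ray hx hc.continuousOn).const_smul (s x)))
  rw [prim_eq, h1]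
  simp [ray]

theorem ddN_prim [CompleteSpace F] (h : IsRuling Ω m T s) {f : E2 → F} (hf : IsReg Ω 1 f)
    {x : E2} (hx : x ∈ Ω) : dd (rot T) (prim T s f) x = f x := by
  have hc := (h.reg_rot.mono h.isOpen h.quasiconvex (Nat.zero_le _)).dirDeriv h.isOpen
    h.quasiconvex hf
  have hcf := h.continuousOn_ray hx hf.continuousOn
  have hcd := h.continuousOn_ray hx hc.continuousOn
  have hd := (h.hasFDerivAt_avg volume 0 hf hx).1.differentiableAt
  -- The product rule gives `∫ (f + l s ∂f) dl`, the integral of `d/dl (l f(x_l))`.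
  have h0 : dd (rot T) (prim T s f) x =
      avg T s volume 0 f x + s x • avg T s volume 1 (dd (rot T) f) x := by
    change dd (rot T) (fun y => s y • avg T s volume 0 f y) x = _
    rw [dd_smul _ (h.s_deriv x hx).differentiableAt hd, h.ddN_s hx, one_smul,
      h.ddN_avg volume 0 hf hx]
  have h1 := intervalIntegral.integral_eq_sub_of_hasDerivAt (a := 0) (b := 1)
    (f := fun l => l • f (ray T s l x))
    (f' := fun l => l • s x • dd (rot T) f (ray T s l x) + (1 : ℝ) • f (ray T s l x))
    (fun l hl => (hasDerivAt_id l).smul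
      (h.hasDerivAt_comp_ray hf hx (by rwa [uIcc_of_le zero_le_one] at hl)))
    (ContinuousOn.intervalIntegrable (by
      rw [uIcc_of_le zero_le_one]
      exact (continuousOn_id.smul (hcd.const_smul (s x))).add (hcf.const_smul (1 : ℝ))))
  rw [h0]
  simp only [avg]
  have hi : Integrable (fun l => s x • l ^ 1 • dd (rot T) f (ray T s l x))
      (volume.restrict (Icc 0 1)) :=
    (h.integrableOn_ray volume 1 hx hc.continuousOn).smul (s x)
  rw [← integral_smul, ← integral_add (h.integrableOn_ray volume 0 hx hf.continuousOn) hi,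
    integral_Icc_eq_integral_Ioc,
    ← intervalIntegral.integral_of_le zero_le_one]
  simp only [one_smul, zero_smul, sub_zero] at h1
  have h2 : f (ray T s 1 x) = f x := by simp [ray]
  rw [← h2, ← h1]
  congr 1
  funext l
  simp only [pow_zero, one_smul, pow_one]
  rw [add_comm, smul_comm]

theorem ddT_prim [CompleteSpace F] (h : IsRuling Ω m T s) {k : ℕ} {f : E2 → F}
    (hf : IsReg Ω (k + 1) f) {x : E2} (hx : x ∈ Ω) :
    dd T (prim T s f) x = stretch T s x • prim T s (fun y => jac T s y • dd T f y) x := by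
  have hd := (h.hasFDerivAt_avg volume 0 hf hx).1.differentiableAt
  change dd T (fun y => s y • avg T s volume 0 f y) x = _
  rw [dd_smul _ (h.s_deriv x hx).differentiableAt hd, h.ddT_s hx, zero_smul, zero_add,
    h.ddT_avg volume 0 hf hx, prim, smul_comm]

theorem prim_add (h : IsRuling Ω m T s) {f g : E2 → F} (hf : ContinuousOn f Ω)
    (hg : ContinuousOn g Ω) {x : E2} (hx : x ∈ Ω) :
    prim T s (fun y => f y + g y) x = prim T s f x + prim T s g x := by
  simp only [prim, avg, smul_add]
  rw [integral_add (h.integrableOn_ray volume 0 hx hf) (h.integrableOn_ray volume 0 hx hg),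
    smul_add]

theorem prim_congr (h : IsRuling Ω m T s) {f g : E2 → F} (hfg : EqOn f g Ω) {x : E2}
    (hx : x ∈ Ω) : prim T s f x = prim T s g x := by
  simp only [prim, avg]
  congr 1
  refine setIntegral_congr_fun measurableSet_Icc fun l hl => ?_
  simp only [hfg (h.ray_mem x hx l hl)]

theorem prim_foot (h : IsRuling Ω m T s) (f : E2 → F) {x : E2} (hx : x ∈ Ω) :
    prim T s f (ray T s 0 x) = 0 := by
  rw [prim, h.s_ray x hx 0 ⟨le_rfl, zero_le_one⟩, zero_mul, zero_smul]

/-- Taking primitives along the rulings commutes with taking the component along the rulings. -/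
theorem inner_prim (h : IsRuling Ω m T s) {f : E2 → E2} (hf : ContinuousOn f Ω) {x : E2}
    (hx : x ∈ Ω) :
    inner ℝ (rot T x) (prim T s f x) = prim T s (fun y => (inner ℝ (rot T y) (f y) : ℝ)) x := by
  simp only [prim, avg]
  rw [inner_smul_right, smul_eq_mul]
  congr 1
  rw [← integral_inner (h.integrableOn_ray volume 0 hx hf)]
  refine setIntegral_congr_fun measurableSet_Icc fun l hl => ?_
  simp only [pow_zero, one_smul, h.rot_ray hx hl]

end IsRuling

/-! ### The linearized isometry equation -/

namespace IsRuling

variable {Ω : Set E2} {m : ℕ} {T : E2 → E2} {s : E2 → ℝ}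

/-- The derivative across the rulings of the primitive along the rulings of
`∂_N∂_T f · ∂_N g + ∂_N f · ∂_N∂_T g`, where `N = rot T`, is as regular as the second derivatives of
`f` and `g`. A priori it
involves third derivatives; but, as in the Gauss equation, these combine to a derivative along
the rulings, which the primitive undoes. -/
theorem isReg_ddT_prim (h : IsRuling Ω (m + 1) T s) {k : ℕ} (hk : k ≤ m) {f g : E2 → E3}
    (hf : IsReg Ω (k + 3) f) (hg : IsReg Ω (k + 3) g) :
    IsReg Ω (k + 1) (dd T (prim T s fun x =>
      (inner ℝ (dd (rot T) (dd T f) x) (dd (rot T) g x) +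
        inner ℝ (dd (rot T) f x) (dd (rot T) (dd T g) x) : ℝ))) := by
  have hΩ := h.isOpen
  have hq := h.quasiconvex
  have hT2 : IsReg Ω (k + 2) T := h.reg.mono hΩ hq (by omega)
  have hN2 : IsReg Ω (k + 2) (rot T) := h.reg_rot.mono hΩ hq (by omega)
  have hT1 := hT2.of_succ hΩ hq
  have hN1 := hN2.of_succ hΩ hq
  have hJ : IsReg Ω (k + 1) (jac T s) := h.isReg_jac.mono hΩ hq (by omega)
  have hj : IsReg Ω (k + 1) (stretch T s) := h.reg_stretch.mono hΩ hq (by omega)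
  have fT := hT2.dirDeriv hΩ hq hf
  have fN := hN2.dirDeriv hΩ hq hf
  have gT := hT2.dirDeriv hΩ hq hg
  have gN := hN2.dirDeriv hΩ hq hg
  have fN' := fN.of_succ hΩ hq
  have gN' := gN.of_succ hΩ hq
  have f2 := hN1.dirDeriv hΩ hq fT
  have g2 := hN1.dirDeriv hΩ hq gT
  have fTT := hT1.dirDeriv hΩ hq fT
  have gTT := hT1.dirDeriv hΩ hq gT
  have fTN := hT1.dirDeriv hΩ hq fN
  have gTN := hT1.dirDeriv hΩ hq gN
  have fNN := hN1.dirDeriv hΩ hq fN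
  have gNN := hN1.dirDeriv hΩ hq gN
  set φ : E2 → ℝ := fun x => jac T s x * (inner ℝ (dd T (dd T f) x) (dd (rot T) g x) +
    inner ℝ (dd (rot T) f x) (dd T (dd T g) x)) with hφ_def
  set R : E2 → ℝ := fun x => jac T s x *
    ((inner ℝ (dd (rot T) (dd T f) x) (dd T (dd (rot T) g) x) +
      inner ℝ (dd T (dd (rot T) f) x) (dd (rot T) (dd T g) x)) -
      (inner ℝ (dd T (dd T f) x) (dd (rot T) (dd (rot T) g) x) +
      inner ℝ (dd (rot T) (dd (rot T) f) x) (dd T (dd T g) x))) with hR_def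
  have hφ : IsReg Ω (k + 1) φ :=
    hJ.mul hΩ hq ((fTT.innerProd hΩ hq gN').add hΩ (fN'.innerProd hΩ hq gTT))
  have hR : IsReg Ω (k + 1) R :=
    hJ.mul hΩ hq (((f2.innerProd hΩ hq gTN).add hΩ (fTN.innerProd hΩ hq g2)).sub hΩ
      ((fTT.innerProd hΩ hq gNN).add hΩ (fNN.innerProd hΩ hq gTT)))
  have hP := (f2.innerProd hΩ hq gN').add hΩ (fN'.innerProd hΩ hq g2)
  have hφ1 : IsReg Ω 1 φ := hφ.mono hΩ hq (by omega)
  have hdφ : IsReg Ω k (dd (rot T) φ) := (hN1.of_succ hΩ hq).dirDeriv hΩ hq hφ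
  -- All third derivatives are contained in the derivative of `φ` along the rulings.
  have key : EqOn (fun x => jac T s x • dd T (fun x =>
      (inner ℝ (dd (rot T) (dd T f) x) (dd (rot T) g x) +
        inner ℝ (dd (rot T) f x) (dd (rot T) (dd T g) x) : ℝ)) x)
      (fun x => dd (rot T) φ x + R x) Ω := by
    intro x hx
    have df2 := f2.differentiableAt hΩ hx
    have dg2 := g2.differentiableAt hΩ hx
    have dfN := fN.differentiableAt hΩ hx
    have dgN := gN.differentiableAt hΩ hx
    have dfTT := fTT.differentiableAt hΩ hx
    have dgTT := gTT.differentiableAt hΩ hx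
    have cf := h.commutator fT hx
    have cg := h.commutator gT hx
    simp only [hφ_def, hR_def]
    rw [dd_add _ (df2.inner ℝ dgN) (dfN.inner ℝ dg2), dd_inner _ df2 dgN, dd_inner _ dfN dg2,
      dd_mul _ (hJ.differentiableAt hΩ hx) ((dfTT.inner ℝ dgN).fun_add (dfN.inner ℝ dgTT)),
      dd_add _ (dfTT.inner ℝ dgN) (dfN.inner ℝ dgTT), dd_inner _ dfTT dgN, dd_inner _ dfN dgTT,
      h.ddN_jac hx, cf, cg]
    simp only [inner_add_left, inner_add_right, inner_smul_left, inner_smul_right, smul_eq_mul,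
      RCLike.conj_to_real]
    ring
  refine IsReg.congr hΩ (f := fun x => stretch T s x * ((φ x - φ (ray T s 0 x)) + prim T s R x))
    (hj.mul hΩ hq ((hφ.sub hΩ (h.isReg_foot (by omega) hφ)).add hΩ
      (h.isReg_prim (by omega) hR))) fun x hx => ?_
  rw [h.ddT_prim hP hx, h.prim_congr key hx, h.prim_add hdφ.continuousOn hR.continuousOn hx,
    h.prim_ddN hφ1 hx, smul_eq_mul]

/-- A planar field whose symmetrized gradient is the symmetrization of `∇f · ∇g`, up to the
`T ⊗ T` component, which is left to the normal component of the spatial field. -/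
theorem exists_planar_field (h : IsRuling Ω (m + 1) T s) {k : ℕ} (hk : k ≤ m) {f g : E2 → E3}
    (hf : IsReg Ω (k + 3) f) (hg : IsReg Ω (k + 3) g) :
    ∃ q : E2 → E2, IsReg Ω (k + 1) q ∧ IsReg Ω (k + 1) (dd T q) ∧ ∀ x ∈ Ω,
      inner ℝ (rot T x) (dd (rot T) q x) = (inner ℝ (dd (rot T) f x) (dd (rot T) g x) : ℝ) ∧
      inner ℝ (T x) (dd (rot T) q x) + inner ℝ (rot T x) (dd T q x) =
        (inner ℝ (dd T f x) (dd (rot T) g x) + inner ℝ (dd (rot T) f x) (dd T g x) : ℝ) := by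
  have hΩ := h.isOpen
  have hq := h.quasiconvex
  have hT2 : IsReg Ω (k + 2) T := h.reg.mono hΩ hq (by omega)
  have hN2 : IsReg Ω (k + 2) (rot T) := h.reg_rot.mono hΩ hq (by omega)
  have hT1 := hT2.of_succ hΩ hq
  have hN1 := hN2.of_succ hΩ hq
  have hJ : IsReg Ω (k + 1) (jac T s) := h.isReg_jac.mono hΩ hq (by omega)
  have hj : IsReg Ω (k + 1) (stretch T s) := h.reg_stretch.mono hΩ hq (by omega)
  have hμ : IsReg Ω (k + 1) (curv T) := h.reg_curv.mono hΩ hq (by omega)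
  have fT := hT2.dirDeriv hΩ hq hf
  have fN := hN2.dirDeriv hΩ hq hf
  have gT := hT2.dirDeriv hΩ hq hg
  have gN := hN2.dirDeriv hΩ hq hg
  have f2 := hN1.dirDeriv hΩ hq fT
  have g2 := hN1.dirDeriv hΩ hq gT
  have hdp := h.isReg_ddT_prim hk hf hg
  have hb := fN.innerProd hΩ hq gN
  have hβ := (fT.innerProd hΩ hq gN).add hΩ (fN.innerProd hΩ hq gT)
  have hP := (f2.innerProd hΩ hq (gN.of_succ hΩ hq)).add hΩ
    ((fN.of_succ hΩ hq).innerProd hΩ hq g2)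
  set P : E2 → ℝ := fun x => (inner ℝ (dd (rot T) (dd T f) x) (dd (rot T) g x) +
        inner ℝ (dd (rot T) f x) (dd (rot T) (dd T g) x) : ℝ) with hP_def
  set b : E2 → ℝ := fun x => inner ℝ (dd (rot T) f x) (dd (rot T) g x) with hb_def
  set β : E2 → ℝ := fun x => inner ℝ (dd T f x) (dd (rot T) g x) +
    inner ℝ (dd (rot T) f x) (dd T g x) with hβ_def
  have hp : IsReg Ω (k + 1) (prim T s P) := h.isReg_prim (by omega) hP
  set p := prim T s P with hp_def
  -- The field is the primitive of `Q`, and `p` turns out to be `rot T · ∂_T q`.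
  set Q : E2 → E2 := fun x => b x • rot T x + (β x - p x) • T x with hQ_def
  have hQ : IsReg Ω (k + 1) Q :=
    ((hb.of_succ hΩ hq).smul hΩ hq hN1).add hΩ (((hβ.of_succ hΩ hq).sub hΩ hp).smul hΩ hq hT1)
  have ddTQ : ∀ x ∈ Ω, dd T Q x = (dd T b x + (β x - p x) * curv T x) • rot T x +
      (dd T β x - dd T p x - b x * curv T x) • T x := by
    intro x hx
    have db := hb.differentiableAt hΩ hx
    have dβ := hβ.differentiableAt hΩ hx
    have dp := hp.differentiableAt hΩ hx
    have dN := hN1.differentiableAt hΩ hx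
    have dT := hT1.differentiableAt hΩ hx
    simp only [hQ_def]
    rw [dd_add _ (db.fun_smul dN) ((dβ.fun_sub dp).fun_smul dT), dd_smul _ db dN,
      dd_smul _ (dβ.fun_sub dp) dT, dd_sub _ dβ dp, h.ddT_rot hx, h.ddT_T hx]
    module
  have hdQ : IsReg Ω (k + 1) (dd T Q) := by
    refine IsReg.congr hΩ ?_ ddTQ
    exact ((((hT1.dirDeriv hΩ hq hb).add hΩ (((hβ.of_succ hΩ hq).sub hΩ hp).mul hΩ hq hμ)).smul
      hΩ hq hN1)).add hΩ ((((hT1.dirDeriv hΩ hq hβ).sub hΩ hdp).sub hΩ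
        ((hb.of_succ hΩ hq).mul hΩ hq hμ)).smul hΩ hq hT1)
  have hJdQ := hJ.smul hΩ hq hdQ
  have hddTq : ∀ x ∈ Ω, dd T (prim T s Q) x =
      stretch T s x • prim T s (fun y => jac T s y • dd T Q y) x := fun x hx => h.ddT_prim hQ hx
  have hddNq : ∀ x ∈ Ω, dd (rot T) (prim T s Q) x = Q x :=
    fun x hx => h.ddN_prim (hQ.mono hΩ hq (by omega)) hx
  have hJp : IsReg Ω 1 (fun x => jac T s x * p x) := (hJ.mul hΩ hq hp).mono hΩ hq (by omega)
  have hNJ : EqOn (fun x => (inner ℝ (rot T x) (jac T s x • dd T Q x) : ℝ))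
      (dd (rot T) fun x => jac T s x * p x) Ω := by
    intro x hx
    have dfN := fN.differentiableAt hΩ hx
    have dgN := gN.differentiableAt hΩ hx
    have cf := h.commutator hf hx
    have cg := h.commutator hg hx
    have h1 : dd T b x = P x - curv T x * β x := by
      simp only [hb_def, hP_def, hβ_def]
      rw [dd_inner _ dfN dgN, cf, cg]
      simp only [inner_add_left, inner_add_right, inner_smul_left, inner_smul_right,
        RCLike.conj_to_real]
      ring
    have h2 : (inner ℝ (rot T x) (rot T x) : ℝ) = 1 := by
      rw [real_inner_self_eq_norm_sq, h.norm_rot hx, one_pow]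
    have h3 : (inner ℝ (rot T x) (T x) : ℝ) = 0 := inner_perp_self _
    rw [dd_mul _ (hJ.differentiableAt hΩ hx) (hp.differentiableAt hΩ hx), h.ddN_jac hx,
      h.ddN_prim (hP.mono hΩ hq (by omega)) hx]
    simp only
    rw [ddTQ x hx, inner_smul_right, inner_add_right, inner_smul_right, inner_smul_right, h1, h2,
      h3]
    ring
  have hNq : ∀ x ∈ Ω, (inner ℝ (rot T x) (dd T (prim T s Q) x) : ℝ) = p x := by
    intro x hx
    rw [hddTq x hx, inner_smul_right, h.inner_prim hJdQ.continuousOn hx, h.prim_congr hNJ hx,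
      h.prim_ddN hJp hx, hp_def, h.prim_foot _ hx]
    linear_combination (prim T s P x) * h.stretch_mul_jac hx
  refine ⟨prim T s Q, h.isReg_prim (by omega) hQ, ?_, fun x hx => ?_⟩
  · exact IsReg.congr hΩ (hj.smul hΩ hq (h.isReg_prim (by omega) hJdQ)) hddTq
  · have h2 : (inner ℝ (rot T x) (rot T x) : ℝ) = 1 := by
      rw [real_inner_self_eq_norm_sq, h.norm_rot hx, one_pow]
    have h3 : (inner ℝ (rot T x) (T x) : ℝ) = 0 := inner_perp_self _
    have h4 : (inner ℝ (T x) (rot T x) : ℝ) = 0 := inner_self_perp _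
    have h5 : (inner ℝ (T x) (T x) : ℝ) = 1 := by
      rw [real_inner_self_eq_norm_sq, h.unit x hx, one_pow]
    rw [hNq x hx, hddNq x hx]
    simp only [hQ_def, inner_add_right, inner_smul_right, h2, h3, h4, h5]
    refine ⟨by ring, by ring⟩

end IsRuling

/-- A planar domain with rulings, together with an isometric immersion `u` of it into space whose
second fundamental form, with respect to the normal `n`, is `η T ⊗ T` with `η` bounded away
from zero. -/
structure IsRuledIsometry (Ω : Set E2) (m : ℕ) (T : E2 → E2) (s : E2 → ℝ) (u n : E2 → E3)
    (η : E2 → ℝ) : Prop where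
  ruling : IsRuling Ω m T s
  reg_u : IsReg Ω (m + 3) u
  reg_n : IsReg Ω (m + 1) n
  reg_η : IsReg Ω m η
  η_bound : ∃ c > 0, ∀ x ∈ Ω, c ≤ |η x|
  metric : ∀ x ∈ Ω, ∀ i j, inner ℝ (pder u i x) (pder u j x) = if i = j then (1 : ℝ) else 0
  normal : ∀ x ∈ Ω, ∀ i, inner ℝ (n x) (pder u i x) = (0 : ℝ)
  tangential : ∀ x ∈ Ω, ∀ i j l, inner ℝ (pder (pder u i) j x) (pder u l x) = (0 : ℝ)
  second : ∀ x ∈ Ω, ∀ i j, inner ℝ (n x) (pder (pder u i) j x) = η x * (T x i * T x j)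

theorem pder_eq_dd (f : E2 → E3) (i : Fin 2) :
    pder f i = dd (fun _ => EuclideanSpace.single i 1) f := rfl

/-- Solvability of the linearized isometry equation `2 sym ∇w = ∇fᵀ∇g + ∇gᵀ∇f` on the surface, with
a loss of only two derivatives. -/
theorem IsRuledIsometry.exists_solution {Ω : Set E2} {m : ℕ} {T : E2 → E2} {s : E2 → ℝ}
    {u n : E2 → E3} {η : E2 → ℝ} (h : IsRuledIsometry Ω (m + 1) T s u n η) {k : ℕ} (hk : k ≤ m)
    {f g : E2 → E3} (hf : IsReg Ω (k + 3) f) (hg : IsReg Ω (k + 3) g) :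
    ∃ w : E2 → E3, IsReg Ω (k + 1) w ∧ ∀ x ∈ Ω, ∀ i j,
      (inner ℝ (pder w i x) (pder u j x) + inner ℝ (pder w j x) (pder u i x) : ℝ) =
        inner ℝ (pder f i x) (pder g j x) + inner ℝ (pder f j x) (pder g i x) := by
  have hr := h.ruling
  have hΩ := hr.isOpen
  have hq := hr.quasiconvex
  obtain ⟨q, hqr, hdq, hqe⟩ := hr.exists_planar_field hk hf hg
  obtain ⟨c₀, hc₀, hη⟩ := h.η_bound
  have hT2 : IsReg Ω (k + 2) T := hr.reg.mono hΩ hq (by omega)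
  have hT1 := hT2.of_succ hΩ hq
  have fT := (hT2.dirDeriv hΩ hq hf).of_succ hΩ hq
  have gT := (hT2.dirDeriv hΩ hq hg).of_succ hΩ hq
  -- The normal component `c` is fixed by the `T ⊗ T` component of the equation, since the second
  -- fundamental form is `η T ⊗ T`.
  set c : E2 → ℝ := fun x =>
    (inner ℝ (T x) (dd T q x) - inner ℝ (dd T f x) (dd T g x)) * (η x)⁻¹ with hc_def
  have hηinv : IsReg Ω (k + 1) (fun x => (η x)⁻¹) :=
    (h.reg_η.mono hΩ hq (by omega)).inv hΩ hq hc₀ hη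
  have hc : IsReg Ω (k + 1) c :=
    ((hT1.innerProd hΩ hq hdq).sub hΩ (fT.innerProd hΩ hq gT)).mul hΩ hq hηinv
  have hu : ∀ l, IsReg Ω (k + 1) (pder u l) := fun l =>
    (h.reg_u.partialDeriv l).mono hΩ hq (by omega)
  have hn : IsReg Ω (k + 1) n := h.reg_n.mono hΩ hq (by omega)
  refine ⟨fun x => (q x 0 • pder u 0 x + q x 1 • pder u 1 x) + c x • n x,
    (((hqr.coord hΩ 0).smul hΩ hq (hu 0)).add hΩ ((hqr.coord hΩ 1).smul hΩ hq (hu 1))).add hΩ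
      (hc.smul hΩ hq hn), ?_⟩
  have key : ∀ x ∈ Ω, ∀ i j, (inner ℝ (pder (fun x => (q x 0 • pder u 0 x + q x 1 • pder u 1 x) +
      c x • n x) i x) (pder u j x) : ℝ) = pder q i x j - c x * (η x * (T x i * T x j)) := by
    intro x hx i j
    have d0 := (hqr.coord hΩ 0).differentiableAt hΩ hx
    have d1 := (hqr.coord hΩ 1).differentiableAt hΩ hx
    have du0 := (hu 0).differentiableAt hΩ hx
    have du1 := (hu 1).differentiableAt hΩ hx
    have duj := (hu j).differentiableAt hΩ hx
    have dc := hc.differentiableAt hΩ hx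
    have dn := hn.differentiableAt hΩ hx
    have hqc : ∀ l : Fin 2, dd (fun _ => EuclideanSpace.single i 1) (fun x => q x l) x =
        pder q i x l := fun l => by
      have := ((EuclideanSpace.proj l : E2 →L[ℝ] ℝ).hasFDerivAt.comp x
        (hqr.differentiableAt hΩ hx).hasFDerivAt).fderiv
      simp only [dd]
      change fderiv ℝ ((EuclideanSpace.proj l : E2 →L[ℝ] ℝ) ∘ q) x _ = _
      rw [this]
      rfl
    have hdn : (inner ℝ (pder n i x) (pder u j x) : ℝ) = -(η x * (T x i * T x j)) := by
      have h1 : dd (fun _ => EuclideanSpace.single i 1)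
          (fun y => (inner ℝ (n y) (pder u j y) : ℝ)) x = 0 := by
        have : EqOn (fun y => (inner ℝ (n y) (pder u j y) : ℝ)) (fun _ => 0) Ω :=
          fun y hy => h.normal y hy j
        rw [dd_congr hΩ _ this hx]
        simp [dd]
      rw [dd_inner _ dn duj, ← pder_eq_dd, ← pder_eq_dd, h.second x hx] at h1
      linear_combination h1
    rw [pder_eq_dd, dd_add _ ((d0.fun_smul du0).fun_add (d1.fun_smul du1)) (dc.fun_smul dn),
      dd_add _ (d0.fun_smul du0) (d1.fun_smul du1), dd_smul _ d0 du0, dd_smul _ d1 du1,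
      dd_smul _ dc dn, hqc, hqc, ← pder_eq_dd, ← pder_eq_dd, ← pder_eq_dd]
    simp only [inner_add_left, inner_smul_left, RCLike.conj_to_real, h.metric x hx,
      h.tangential x hx, h.normal x hx, hdn]
    fin_cases j <;> simp <;> ring
  intro x hx i j
  rw [key x hx, key x hx]
  have hηx : η x ≠ 0 := fun h0 => by
    have := hη x hx
    rw [h0, abs_zero] at this
    linarith
  have hcη : c x * η x = inner ℝ (T x) (dd T q x) - inner ℝ (dd T f x) (dd T g x) := by
    simp only [hc_def]; field_simp
  obtain ⟨e1, e2⟩ := hqe x hx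
  have hTx := hr.unit x hx
  have f1 := frame_expand hTx (dd T q x)
  have f2 := frame_expand hTx (dd (rot T) q x)
  change dd T q x = inner ℝ (T x) (dd T q x) • T x +
    inner ℝ (rot T x) (dd T q x) • rot T x at f1
  change dd (rot T) q x = inner ℝ (T x) (dd (rot T) q x) • T x +
    inner ℝ (rot T x) (dd (rot T) q x) • rot T x at f2
  have f1c : ∀ l, dd T q x l = inner ℝ (T x) (dd T q x) * T x l +
    inner ℝ (rot T x) (dd T q x) * rot T x l := fun l => by
      conv_lhs => rw [f1]
      simp
  have f2c : ∀ l, dd (rot T) q x l = inner ℝ (T x) (dd (rot T) q x) * T x l +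
    inner ℝ (rot T x) (dd (rot T) q x) * rot T x l := fun l => by
      conv_lhs => rw [f2]
      simp
  rw [pder_eq_frame hTx q, pder_eq_frame hTx q, pder_eq_frame hTx f, pder_eq_frame hTx f,
    pder_eq_frame hTx g, pder_eq_frame hTx g]
  simp only [inner_add_left, inner_add_right, inner_smul_left, inner_smul_right,
    RCLike.conj_to_real, PiLp.add_apply, PiLp.smul_apply, smul_eq_mul, f1c, f2c]
  linear_combination (-2 * (T x i * T x j)) * hcη + (T x i * rot T x j + T x j * rot T x i) * e2 +
    2 * (rot T x i * rot T x j) * e1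

/-! ### Unit fields determined by their tensor square -/

section TensorSquare

variable {Ω : Set E2} {T : E2 → E2}

theorem eq_or_eq_neg_of_tensorSquare_eq {t t' : E2} (ht : ‖t‖ = 1) (ht' : ‖t'‖ = 1)
    (h : ∀ i j, t i * t j = t' i * t' j) : t = t' ∨ t = -t' := by
  have h1 := unit_sq ht
  have h2 := unit_sq ht'
  have h3 : (inner ℝ t t' : ℝ) ^ 2 = 1 := by
    rw [inner_eq_coord]
    linear_combination (t' 0 * t' 0) * h 0 0 + 2 * (t' 0 * t' 1) * h 0 1 + (t' 1 * t' 1) * h 1 1 +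
      (t' 0 * t' 0 + t' 1 * t' 1 + 1) * h2
  have h4 : ((inner ℝ t t' : ℝ) - 1) * (inner ℝ t t' + 1) = 0 := by linear_combination h3
  rcases mul_eq_zero.1 h4 with h5 | h5
  · exact Or.inl ((inner_eq_one_iff_of_norm_eq_one (𝕜 := ℝ) ht ht').1 (sub_eq_zero.1 h5))
  · refine Or.inr ((inner_eq_one_iff_of_norm_eq_one (𝕜 := ℝ) ht (by rwa [norm_neg])).1 ?_)
    rw [inner_neg_right]; linarith

theorem differentiableAt_of_tensorSquare (hΩ : IsOpen Ω) (hc : ContinuousOn T Ω)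
    (hunit : ∀ x ∈ Ω, ‖T x‖ = 1) {x : E2} (hx : x ∈ Ω)
    (hd : ∀ i j, DifferentiableAt ℝ (fun y => T y i * T y j) x) (i : Fin 2) :
    DifferentiableAt ℝ (fun y => T y i) x := by
  -- Near `x`, the field is the normalization of `(T y ⊗ T y) (T x)`.
  set a2 : E2 → ℝ := fun y => (T y 0 * T y 0) * (T x 0 * T x 0) +
    2 * (T y 0 * T y 1) * (T x 0 * T x 1) + (T y 1 * T y 1) * (T x 1 * T x 1) with ha2
  have hd2 : DifferentiableAt ℝ a2 x := by
    have h00 := hd 0 0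
    have h01 := hd 0 1
    have h11 := hd 1 1
    exact (((h00.mul_const _).fun_add ((h01.const_mul 2).mul_const _))).fun_add (h11.mul_const _)
  have hx2 : a2 x = 1 := by
    have := unit_sq (hunit x hx)
    simp only [ha2]
    linear_combination (T x 0 * T x 0 + T x 1 * T x 1 + 1) * this
  have hinner : ContinuousAt (fun y => (inner ℝ (T y) (T x) : ℝ)) x :=
    ((hc.continuousAt (hΩ.mem_nhds hx)).inner continuousAt_const)
  have hpos : ∀ᶠ y in 𝓝 x, (0 : ℝ) < inner ℝ (T y) (T x) := by
    refine hinner.eventually (lt_mem_nhds ?_)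
    simp only
    rw [real_inner_self_eq_norm_sq, hunit x hx]; norm_num
  have heq : (fun y => T y i) =ᶠ[𝓝 x]
      fun y => ((T y i * T y 0) * T x 0 + (T y i * T y 1) * T x 1) / √(a2 y) := by
    filter_upwards [hpos] with y hy
    have h1 : a2 y = (inner ℝ (T y) (T x)) ^ 2 := by
      simp only [ha2, inner_eq_coord]; ring
    rw [h1, Real.sqrt_sq hy.le, eq_div_iff hy.ne', inner_eq_coord]
    ring
  refine DifferentiableAt.congr_of_eventuallyEq ?_ heq
  have hn : DifferentiableAt ℝ
      (fun y => (T y i * T y 0) * T x 0 + (T y i * T y 1) * T x 1) x :=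
    ((hd i 0).mul_const _).fun_add ((hd i 1).mul_const _)
  have hs : DifferentiableAt ℝ (fun y => √(a2 y)) x := hd2.sqrt (by rw [hx2]; norm_num)
  have h0 : √(a2 x) ≠ 0 := by rw [hx2]; norm_num
  simpa only [div_eq_mul_inv] using hn.fun_mul (hs.fun_inv h0)

/-- A continuous unit field is as regular as its tensor square: `∂T = (∂(T ⊗ T)) T`. -/
theorem isReg_of_tensorSquare (hΩ : IsOpen Ω) (hq : IsQuasiconvex Ω) (hc : ContinuousOn T Ω)
    (hunit : ∀ x ∈ Ω, ‖T x‖ = 1) {k : ℕ} (hr : ∀ i j, IsReg Ω (k + 1) fun y => T y i * T y j) :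
    IsReg Ω (k + 1) T := by
  have hd : ∀ i, ∀ x ∈ Ω, DifferentiableAt ℝ (fun y => T y i) x := fun i x hx =>
    differentiableAt_of_tensorSquare hΩ hc hunit hx
      (fun i j => (hr i j).differentiableAt hΩ hx) i
  have hbd : ∀ i, ∃ K, ∀ x ∈ Ω, ‖T x i‖ ≤ K := fun i =>
    ⟨1, fun x hx => (PiLp.norm_apply_le _ i).trans (hunit x hx).le⟩
  have hpd : ∀ i l, EqOn (pder (fun y => T y i) l)
      (fun x => pder (fun y => T y i * T y 0) l x * T x 0 +
        pder (fun y => T y i * T y 1) l x * T x 1) Ω := by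
    intro i l x hx
    have e : ∀ i j, pder (fun y => T y i * T y j) l x =
        pder (fun y => T y i) l x * T x j + T x i * pder (fun y => T y j) l x := fun i j =>
      dd_mul (fun _ => EuclideanSpace.single l 1) (hd i x hx) (hd j x hx)
    have e1 : pder (fun y => T y 0) l x * T x 0 + pder (fun y => T y 1) l x * T x 1 = 0 := by
      have h1 : pder (fun y => T y 0 * T y 0 + T y 1 * T y 1) l x = 0 := by
        have : EqOn (fun y => T y 0 * T y 0 + T y 1 * T y 1) (fun _ => 1) Ω := fun y hy =>
          unit_sq (hunit y hy)
        rw [pder_congr hΩ this l hx]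
        simp [pder]
      have h2 : pder (fun y => T y 0 * T y 0 + T y 1 * T y 1) l x =
          pder (fun y => T y 0 * T y 0) l x + pder (fun y => T y 1 * T y 1) l x :=
        dd_add (fun _ => EuclideanSpace.single l 1) ((hd 0 x hx).fun_mul (hd 0 x hx))
          ((hd 1 x hx).fun_mul (hd 1 x hx))
      rw [h2, e, e] at h1
      linarith
    have hu := unit_sq (hunit x hx)
    simp only
    rw [e, e]
    linear_combination (-pder (fun y => T y i) l x) * hu - (T x i) * e1
  have main : ∀ n ≤ k + 1, ∀ i, IsReg Ω n fun y => T y i := by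
    intro n
    induction n with
    | zero =>
      intro _ i
      refine ⟨hbd i, ?_⟩
      have hpb : ∀ l, ∃ K, ∀ x ∈ Ω, ‖pder (fun y => T y i) l x‖ ≤ K := fun l => by
        obtain ⟨K0, h0⟩ := ((hr i 0).partialDeriv l).bdd
        obtain ⟨K1, h1⟩ := ((hr i 1).partialDeriv l).bdd
        refine ⟨K0 * 1 + K1 * 1, fun x hx => ?_⟩
        have b : ∀ j, ‖T x j‖ ≤ 1 := fun j => (PiLp.norm_apply_le _ j).trans (hunit x hx).le
        have := (norm_nonneg _).trans (h0 x hx)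
        have := (norm_nonneg _).trans (h1 x hx)
        rw [hpd i l hx]
        refine (norm_add_le _ _).trans ?_
        rw [norm_mul, norm_mul]
        gcongr
        exacts [h0 x hx, b 0, h1 x hx, b 1]
      obtain ⟨K0, h0⟩ := hpb 0
      obtain ⟨K1, h1⟩ := hpb 1
      exact exists_lipschitz_of_fderiv_bdd hΩ hq
        (fun x hx => (hd i x hx).differentiableWithinAt)
        (fun x hx => (norm_fderiv_le_pder _ x).trans (add_le_add (h0 x hx) (h1 x hx)))
    | succ n ih =>
      intro hn i
      refine ⟨hbd i, fun x hx => (hd i x hx).differentiableWithinAt, fun l => ?_⟩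
      refine IsReg.congr hΩ ?_ (hpd i l)
      exact ((((hr i 0).partialDeriv l).mono hΩ hq (by omega)).mul hΩ hq (ih (by omega) 0)).add hΩ
        ((((hr i 1).partialDeriv l).mono hΩ hq (by omega)).mul hΩ hq (ih (by omega) 1))
  exact IsReg.of_coord hΩ (main (k + 1) le_rfl)

end TensorSquare

/-! ### The planar curve and its normal segments -/

namespace PlanarData

variable (P : PlanarData)

theorem norm_tangent {t : ℝ} (ht : t ∈ Icc 0 P.T) : ‖P.tangent t‖ = 1 := P.Γ_arclength t ht

theorem hasDerivAt_Γ {t : ℝ} (ht : t ∈ Ioo 0 P.T) : HasDerivAt P.Γ (P.tangent t) t :=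
  (P.Γ_diff t (Ioo_subset_Icc_self ht)).hasDerivWithinAt.hasDerivAt (Icc_mem_nhds ht.1 ht.2)

theorem continuousOn_tangent : ContinuousOn P.tangent (Icc 0 P.T) := by
  obtain ⟨L, hL⟩ := P.Γ_lip
  exact hL.continuousOn

theorem continuousOn_normal : ContinuousOn P.normal (Icc 0 P.T) :=
  perpL.continuous.comp_continuousOn P.continuousOn_tangent

theorem norm_normal {t : ℝ} (ht : t ∈ Icc 0 P.T) : ‖P.normal t‖ = 1 := by
  rw [normal, norm_perp, P.norm_tangent ht]

theorem continuousOn_sm : ContinuousOn P.sm (Icc 0 P.T) := by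
  obtain ⟨L, hL⟩ := P.sm_lip
  exact hL.continuousOn

theorem continuousOn_sp : ContinuousOn P.sp (Icc 0 P.T) := by
  obtain ⟨L, hL⟩ := P.sp_lip
  exact hL.continuousOn

theorem exists_bound : ∃ K, ∀ z ∈ P.M, |z.1| ≤ K := by
  obtain ⟨K, hK⟩ := isCompact_Icc.bddAbove_image P.continuousOn_sm
  obtain ⟨K', hK'⟩ := isCompact_Icc.bddAbove_image P.continuousOn_sp
  refine ⟨max K K', fun z hz => ?_⟩
  have h1 := hK (mem_image_of_mem _ (Ioo_subset_Icc_self hz.1))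
  have h2 := hK' (mem_image_of_mem _ (Ioo_subset_Icc_self hz.1))
  have h3 := hz.2
  rw [abs_le]
  constructor
  · linarith [h3.1, le_max_left K K']
  · linarith [h3.2, le_max_right K K']

theorem eventually_mem_M {s t : ℝ} (h : (s, t) ∈ P.M) : ∀ᶠ t' in 𝓝 t, (s, t') ∈ P.M := by
  obtain ⟨ht, hs⟩ := h
  have hn : Icc 0 P.T ∈ 𝓝 t := Icc_mem_nhds ht.1 ht.2
  have h1 := (P.continuousOn_sm.continuousAt hn).eventually (lt_mem_nhds (neg_lt.1 hs.1))
  have h2 := (P.continuousOn_sp.continuousAt hn).eventually (lt_mem_nhds hs.2)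
  filter_upwards [h1, h2, Ioo_mem_nhds ht.1 ht.2] with t' h1 h2 h3
  exact ⟨h3, neg_lt.1 h1, h2⟩

theorem eventually_mem_M' {s t : ℝ} (h : (s, t) ∈ P.M) : ∀ᶠ s' in 𝓝 s, (s', t) ∈ P.M := by
  obtain ⟨ht, hs⟩ := h
  filter_upwards [Ioo_mem_nhds hs.1 hs.2] with s' hs'
  exact ⟨ht, hs'⟩

theorem mem_M_mul {s t l : ℝ} (h : (s, t) ∈ P.M) (hl : l ∈ Icc (0 : ℝ) 1) : (l * s, t) ∈ P.M := by
  obtain ⟨ht, hs⟩ := h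
  have h0 : (0 : ℝ) ∈ Ioo (-P.sm t) (P.sp t) :=
    ⟨by linarith [P.sm_pos t (Ioo_subset_Icc_self ht)], P.sp_pos t (Ioo_subset_Icc_self ht)⟩
  refine ⟨ht, ?_⟩
  have := (convex_Ioo (-P.sm t) (P.sp t)) h0 hs (sub_nonneg.2 hl.2) hl.1 (by ring)
  simpa using this

theorem Φ_mem_segm {z : ℝ × ℝ} (hz : z ∈ P.M) : P.Φ z ∈ P.segm z.2 := ⟨z.1, hz.2, rfl⟩

/-- Segments with distinct parameters do not meet. -/
def Admissible : Prop :=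
  ∀ t₁ ∈ Icc 0 P.T, ∀ t₂ ∈ Icc 0 P.T, t₁ ≠ t₂ → Disjoint (P.segm t₁) (P.segm t₂)

variable {P}

theorem Admissible.injOn (h : P.Admissible) : InjOn P.Φ P.M := by
  intro z hz z' hz' he
  have ht : z.2 = z'.2 := by
    by_contra hne
    refine Set.disjoint_left.1 (h z.2 (Ioo_subset_Icc_self hz.1) z'.2 (Ioo_subset_Icc_self hz'.1)
      hne) (P.Φ_mem_segm hz) ?_
    rw [he]; exact P.Φ_mem_segm hz'
  have hs : z.1 = z'.1 := by
    simp only [Φ, ht] at he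
    have h1 := smul_left_injective ℝ (norm_ne_zero_iff.1 (by
      rw [P.norm_normal (Ioo_subset_Icc_self hz'.1)]; exact one_ne_zero) : P.normal z'.2 ≠ 0)
      (add_left_cancel he)
    exact h1
  exact Prod.ext hs ht

variable (P)

open Classical in
/-- The parameters `(s,t)` of a point of `Ω`; outside `Ω` the value is `0`. -/
def param (x : E2) : ℝ × ℝ := if h : ∃ z ∈ P.M, P.Φ z = x then h.choose else 0

/-- The unit tangent of the curve at the foot point of the segment through a given point. -/
def field (x : E2) : E2 := P.tangent (P.param x).2

theorem param_mem {x : E2} (hx : x ∈ P.Ω) : P.param x ∈ P.M ∧ P.Φ (P.param x) = x := by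
  have h : ∃ z ∈ P.M, P.Φ z = x := hx
  rw [param, dif_pos h]
  exact h.choose_spec

variable {P}

theorem Admissible.param_Φ (h : P.Admissible) {z : ℝ × ℝ} (hz : z ∈ P.M) :
    P.param (P.Φ z) = z := by
  obtain ⟨h1, h2⟩ := P.param_mem (mem_image_of_mem P.Φ hz)
  exact h.injOn h1 hz h2

theorem norm_field {x : E2} (hx : x ∈ P.Ω) : ‖P.field x‖ = 1 :=
  P.norm_tangent (Ioo_subset_Icc_self (P.param_mem hx).1.1)

theorem rot_field (x : E2) : rot P.field x = P.normal (P.param x).2 := rfl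

theorem add_smul_normal (z : ℝ × ℝ) (τ : ℝ) :
    P.Φ z + τ • P.normal z.2 = P.Φ (z.1 + τ, z.2) := by
  simp only [Φ, add_smul, add_assoc]

theorem ray_field {x : E2} (hx : x ∈ P.Ω) (l : ℝ) :
    ray P.field (fun y => (P.param y).1) l x = P.Φ (l * (P.param x).1, (P.param x).2) := by
  have h2 := (P.param_mem hx).2
  simp only [ray, rot_field]
  nth_rewrite 1 [← h2]
  simp only [Φ]
  module

/-- If the tensor square of the unit tangent field is continuous, so is the parameter `t`: any
limit segment through a point `x` is parallel to the segment of `x`, hence overlaps it. -/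
theorem Admissible.continuousAt_param (h : P.Admissible) (hΩ : IsOpen P.Ω)
    (hc : ∀ i j, ContinuousOn (fun y => P.field y i * P.field y j) P.Ω) {x : E2} (hx : x ∈ P.Ω) :
    ContinuousAt (fun y => (P.param y).2) x := by
  obtain ⟨S, hS⟩ := P.exists_bound
  rw [ContinuousAt, tendsto_iff_ultrafilter]
  -- Along an ultrafilter the parameters converge; `t` is the limit to be identified.
  intro U hU
  have hΩU : P.Ω ∈ (U : Filter E2) := hU (hΩ.mem_nhds hx)
  obtain ⟨t, htI, ht⟩ := isCompact_Icc.ultrafilter_le_nhds (U.map fun y => (P.param y).2)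
    (s := Icc 0 P.T) (by
      rw [le_principal_iff, Ultrafilter.coe_map, mem_map]
      exact mem_of_superset hΩU fun y hy => Ioo_subset_Icc_self (P.param_mem hy).1.1)
  obtain ⟨s, -, hs⟩ := isCompact_Icc.ultrafilter_le_nhds (U.map fun y => (P.param y).1)
    (s := Icc (-S) S) (by
      rw [le_principal_iff, Ultrafilter.coe_map, mem_map]
      exact mem_of_superset hΩU fun y hy => abs_le.1 (hS _ (P.param_mem hy).1))
  have hs : Tendsto (fun y => (P.param y).1) U (𝓝 s) := hs
  have ht : Tendsto (fun y => (P.param y).2) U (𝓝[Icc 0 P.T] t) :=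
    tendsto_nhdsWithin_iff.2
      ⟨ht, mem_of_superset hΩU fun y hy => Ioo_subset_Icc_self (P.param_mem hy).1.1⟩
  suffices hteq : t = (P.param x).2 by
    rw [← hteq]; exact ht.mono_right nhdsWithin_le_nhds
  have cN := (P.continuousOn_normal t htI).tendsto.comp ht
  have cT := (P.continuousOn_tangent t htI).tendsto.comp ht
  have cΓ := (P.Γ_diff.continuousOn t htI).tendsto.comp ht
  have csm := (P.continuousOn_sm t htI).tendsto.comp ht
  have csp := (P.continuousOn_sp t htI).tendsto.comp ht
  have hxe : x = P.Γ t + s • P.normal t := by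
    refine tendsto_nhds_unique (hU : Tendsto id U (𝓝 x)) ((cΓ.add (hs.smul cN)).congr' ?_)
    filter_upwards [hΩU] with y hy
    exact (P.param_mem hy).2
  have hs1 : -P.sm t ≤ s := by
    refine le_of_tendsto_of_tendsto csm.neg hs ?_
    filter_upwards [hΩU] with y hy using (P.param_mem hy).1.2.1.le
  have hs2 : s ≤ P.sp t := by
    refine le_of_tendsto_of_tendsto hs csp ?_
    filter_upwards [hΩU] with y hy using (P.param_mem hy).1.2.2.le
  have hpar : P.tangent t = P.field x ∨ P.tangent t = -P.field x := by
    refine eq_or_eq_neg_of_tensorSquare_eq (P.norm_tangent htI) (norm_field hx) fun i j => ?_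
    have c : ∀ l : Fin 2, Tendsto (fun y => P.field y l) U (𝓝 (P.tangent t l)) := fun l =>
      ((EuclideanSpace.proj l : E2 →L[ℝ] ℝ).continuous.tendsto _).comp cT
    refine tendsto_nhds_unique ((c i).mul (c j)) ?_
    exact ((hc i j).continuousAt (hΩ.mem_nhds hx)).tendsto.mono_left hU
  obtain ⟨hzM, hzx⟩ := P.param_mem hx
  set z := P.param x with hz
  obtain ⟨σ, hσ⟩ : ∃ σ : ℝ, P.normal t = σ • P.normal z.2 := by
    rcases hpar with hp | hp
    · exact ⟨1, by rw [one_smul, normal, hp]; rfl⟩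
    · refine ⟨-1, ?_⟩
      rw [normal, hp, ← perpL_apply, map_neg, neg_one_smul]; rfl
  -- The point `x`, possibly an end point of the segment of `t`, is moved into both open segments.
  by_contra hne
  have hcont : ContinuousAt (fun e : ℝ => z.1 - e * s * σ) 0 := by fun_prop
  have hnear : ∀ᶠ e in 𝓝[>] (0 : ℝ), z.1 - e * s * σ ∈ Ioo (-P.sm z.2) (P.sp z.2) := by
    refine (hcont.eventually (Ioo_mem_nhds ?_ ?_)).filter_mono nhdsWithin_le_nhds
    · simpa using hzM.2.1
    · simpa using hzM.2.2
  obtain ⟨e, he, he1⟩ := (hnear.and (Ioo_mem_nhdsGT (zero_lt_one' ℝ))).exists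
  have hsmp := P.sm_pos t htI
  have hspp := P.sp_pos t htI
  have hmem₁ : x - (e * s) • P.normal t ∈ P.segm t := by
    refine ⟨(1 - e) * s, ⟨?_, ?_⟩, ?_⟩
    · nlinarith [mul_le_mul_of_nonneg_left hs1 (sub_nonneg.2 he1.2.le), mul_pos he1.1 hsmp]
    · nlinarith [mul_le_mul_of_nonneg_left hs2 (sub_nonneg.2 he1.2.le), mul_pos he1.1 hspp]
    · simp only
      rw [hxe]; module
  have hmem₂ : x - (e * s) • P.normal t ∈ P.segm z.2 := by
    refine ⟨z.1 - e * s * σ, he, ?_⟩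
    simp only
    rw [hσ, ← hzx]
    simp only [Φ]; module
  exact Set.disjoint_left.1 (h t htI z.2 (Ioo_subset_Icc_self hzM.1) hne) hmem₁ hmem₂

/-- The signed distance along the segments has the unit normal as its gradient: variations of
the parameter `t` displace a point in the direction of the ruling only to higher order. -/
theorem Admissible.hasFDerivAt_param (hΩ : IsOpen P.Ω)
    (hct : ∀ x ∈ P.Ω, ContinuousAt (fun y => (P.param y).2) x)
    {L : ℝ} (hlip : ∀ x ∈ P.Ω, ∀ y ∈ P.Ω, ‖rot P.field x - rot P.field y‖ ≤ L * ‖x - y‖)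
    {x : E2} (hx : x ∈ P.Ω) :
    HasFDerivAt (fun y => (P.param y).1) (innerSL ℝ (rot P.field x)) x := by
  obtain ⟨S, hS⟩ := P.exists_bound
  obtain ⟨hzM, hzx⟩ := P.param_mem hx
  set t₀ := (P.param x).2 with ht₀
  set s₀ := (P.param x).1 with hs₀
  have htI := Ioo_subset_Icc_self hzM.1
  set N₀ := P.normal t₀ with hN₀
  set T₀ := P.tangent t₀ with hT₀
  have hN0 : (inner ℝ N₀ N₀ : ℝ) = 1 := by
    rw [real_inner_self_eq_norm_sq, P.norm_normal htI, one_pow]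
  have hT0 : (inner ℝ T₀ T₀ : ℝ) = 1 := by
    rw [real_inner_self_eq_norm_sq, P.norm_tangent htI, one_pow]
  have hTN : (inner ℝ T₀ N₀ : ℝ) = 0 := inner_self_perp _
  have hNT : (inner ℝ N₀ T₀ : ℝ) = 0 := inner_perp_self _
  have hmem := hΩ.mem_nhds hx
  set R : E2 → E2 := fun y => P.Γ (P.param y).2 - P.Γ t₀ - ((P.param y).2 - t₀) • T₀ with hR
  have hRo : R =o[𝓝 x] fun y => (P.param y).2 - t₀ :=
    (hasDerivAt_iff_isLittleO.1 (P.hasDerivAt_Γ hzM.1)).comp_tendsto (hct x hx)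
  have hinner : ∀ v : E2, (fun y => (inner ℝ v (R y) : ℝ)) =o[𝓝 x] fun y => (P.param y).2 - t₀ :=
    fun v => ((innerSL ℝ v).isBigO_comp R (𝓝 x)).trans_isLittleO hRo
  have hyx : ∀ y ∈ P.Ω, y - x = R y + ((P.param y).2 - t₀) • T₀ +
      (P.param y).1 • P.normal (P.param y).2 - s₀ • N₀ := fun y hy => by
    have h1 := (P.param_mem hy).2
    conv_lhs => rw [← h1, ← hzx]
    simp only [Φ, hR]
    rw [← hs₀, ← ht₀, ← hN₀]
    module
  -- The parameter `t` is Lipschitz at `x`.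
  have hbig : (fun y => (P.param y).2 - t₀) =O[𝓝 x] fun y => y - x := by
    have h1 : (fun y => (inner ℝ T₀ (R y) : ℝ) + ((P.param y).2 - t₀)) =O[𝓝 x]
        fun y => y - x := by
      refine Asymptotics.IsBigO.of_bound (1 + S * L) ?_
      filter_upwards [hmem] with y hy
      have e1 := congrArg (fun v => (inner ℝ T₀ v : ℝ)) (hyx y hy)
      simp only [inner_sub_right, inner_add_right, inner_smul_right, hT0, hTN] at e1
      rw [← inner_sub_right] at e1
      have e2 : (inner ℝ T₀ (P.normal (P.param y).2) : ℝ) =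
          inner ℝ T₀ (P.normal (P.param y).2 - N₀) := by
        rw [inner_sub_right, hTN, sub_zero]
      have e3 : (inner ℝ T₀ (R y) : ℝ) + ((P.param y).2 - t₀) =
          inner ℝ T₀ (y - x) - (P.param y).1 * inner ℝ T₀ (P.normal (P.param y).2 - N₀) := by
        rw [← e2]; linarith
      have b1 : |(inner ℝ T₀ (y - x) : ℝ)| ≤ ‖y - x‖ := by
        have := abs_real_inner_le_norm T₀ (y - x)
        rwa [P.norm_tangent htI, one_mul] at this
      have b2 : |(inner ℝ T₀ (P.normal (P.param y).2 - N₀) : ℝ)| ≤ L * ‖y - x‖ := by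
        have := abs_real_inner_le_norm T₀ (P.normal (P.param y).2 - N₀)
        rw [P.norm_tangent htI, one_mul] at this
        exact this.trans (hlip y hy x hx)
      have b3 := hS _ (P.param_mem hy).1
      rw [Real.norm_eq_abs, e3]
      calc _ ≤ |(inner ℝ T₀ (y - x) : ℝ)| +
            |(P.param y).1| * |(inner ℝ T₀ (P.normal (P.param y).2 - N₀) : ℝ)| := by
            rw [← abs_mul]; exact abs_sub _ _
        _ ≤ ‖y - x‖ + S * (L * ‖y - x‖) := by
            have := (abs_nonneg _).trans b3
            gcongr
        _ = _ := by ring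
    exact (hinner T₀).right_isBigO_add.trans h1
  rw [hasFDerivAt_iff_isLittleO]
  have hsq : (fun y => (P.param y).1 * (1 - (inner ℝ N₀ (P.normal (P.param y).2) : ℝ))) =o[𝓝 x]
      fun y => y - x := by
    have h1 : (fun y => (P.param y).1 * (1 - (inner ℝ N₀ (P.normal (P.param y).2) : ℝ))) =O[𝓝 x]
        fun y => ‖y - x‖ ^ 2 := by
      refine Asymptotics.IsBigO.of_bound (S * (L ^ 2 / 2)) ?_
      filter_upwards [hmem] with y hy
      have b3 := hS _ (P.param_mem hy).1
      have e1 : 1 - (inner ℝ N₀ (P.normal (P.param y).2) : ℝ) =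
          ‖P.normal (P.param y).2 - N₀‖ ^ 2 / 2 := by
        rw [norm_sub_sq_real, P.norm_normal (Ioo_subset_Icc_self (P.param_mem hy).1.1),
          P.norm_normal htI, real_inner_comm]
        ring
      have e2 : ‖P.normal (P.param y).2 - N₀‖ ≤ L * ‖y - x‖ := hlip y hy x hx
      have e3 : ‖P.normal (P.param y).2 - N₀‖ ^ 2 ≤ (L * ‖y - x‖) ^ 2 := by gcongr
      rw [e1, norm_mul, Real.norm_eq_abs, Real.norm_of_nonneg (by positivity),
        Real.norm_of_nonneg (by positivity)]
      calc _ ≤ S * ((L * ‖y - x‖) ^ 2 / 2) := by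
            have := (abs_nonneg _).trans b3
            gcongr
        _ = _ := by ring
    refine h1.trans_isLittleO ?_
    have h2 := Asymptotics.isLittleO_norm_pow_id (E' := E2) one_lt_two
    have h3 : Tendsto (fun y => y - x) (𝓝 x) (𝓝 0) := by
      have : ContinuousAt (fun y => y - x) x := by fun_prop
      simpa [ContinuousAt] using this
    exact h2.comp_tendsto h3
  refine (hsq.sub ((hinner N₀).trans_isBigO hbig)).congr' ?_ (Eventually.of_forall fun _ => rfl)
  filter_upwards [hmem] with y hy
  have e1 := congrArg (fun v => (inner ℝ N₀ v : ℝ)) (hyx y hy)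
  simp only [inner_sub_right, inner_add_right, inner_smul_right, hN0, hNT] at e1
  rw [← inner_sub_right] at e1
  rw [innerSL_apply_apply, rot_field, ← ht₀, ← hN₀, e1]
  ring

/-- The rulings of an admissible planar domain whose tangent field has a regular tensor square. -/
theorem Admissible.isRuling (h : P.Admissible) (hΩ : IsOpen P.Ω) (hq : IsQuasiconvex P.Ω) {k : ℕ}
    (hr : ∀ i j, IsReg P.Ω (k + 1) fun y => P.field y i * P.field y j) :
    IsRuling P.Ω k P.field (fun y => (P.param y).1) := by
  have hct : ∀ x ∈ P.Ω, ContinuousAt (fun y => (P.param y).2) x := fun x hx =>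
    h.continuousAt_param hΩ (fun i j => (hr i j).continuousOn) hx
  have hcT : ContinuousOn P.field P.Ω := fun x hx =>
    ContinuousAt.continuousWithinAt
      (ContinuousAt.comp (P.continuousOn_tangent.continuousAt
        (Icc_mem_nhds (P.param_mem hx).1.1.1 (P.param_mem hx).1.1.2)) (hct x hx))
  have hT := isReg_of_tensorSquare hΩ hq hcT (fun x hx => norm_field hx) hr
  have hN : IsReg P.Ω 0 (rot P.field) :=
    ((hT.clm hΩ perpL : IsReg P.Ω (k + 1) (rot P.field))).mono hΩ hq (Nat.zero_le _)
  obtain ⟨-, L, hL⟩ := hN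
  have hpr : ∀ x ∈ P.Ω, ∀ l ∈ Icc (0 : ℝ) 1,
      P.param (ray P.field (fun y => (P.param y).1) l x) =
        (l * (P.param x).1, (P.param x).2) := fun x hx l hl => by
    have hm : (l * (P.param x).1, (P.param x).2) ∈ P.M := P.mem_M_mul (P.param_mem hx).1 hl
    rw [ray_field hx, h.param_Φ hm]
  refine ⟨hΩ, hq, hT, fun x hx => norm_field hx, ?_, fun x hx =>
    Admissible.hasFDerivAt_param hΩ hct hL hx, fun x hx l hl => ?_, fun x hx l hl => ?_,
    fun x hx l hl => ?_, fun x hx => ?_⟩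
  · obtain ⟨S, hS⟩ := P.exists_bound
    exact ⟨S, fun x hx => hS _ (P.param_mem hx).1⟩
  · rw [ray_field hx]
    exact mem_image_of_mem _ (P.mem_M_mul (P.param_mem hx).1 hl)
  · rw [field, hpr x hx l hl, field]
  · simp only [hpr x hx l hl]
  · obtain ⟨hzM, hzx⟩ := P.param_mem hx
    have hc : Tendsto (fun τ : ℝ => (P.param x).1 + τ) (𝓝 0) (𝓝 (P.param x).1) := by
      have : ContinuousAt (fun τ : ℝ => (P.param x).1 + τ) 0 := by fun_prop
      simpa [ContinuousAt] using this
    filter_upwards [hc.eventually (P.eventually_mem_M' hzM)] with τ hτ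
    have e : x + τ • rot P.field x = P.Φ ((P.param x).1 + τ, (P.param x).2) := by
      rw [← add_smul_normal, hzx, rot_field]
    have hm : ((P.param x).1 + τ, (P.param x).2) ∈ P.M := hτ
    rw [e, field, h.param_Φ hm, field]

end PlanarData

/-! ### The geometry of the chart -/

theorem inner_eq_coord₃ (x y : E3) : inner ℝ x y = x 0 * y 0 + x 1 * y 1 + x 2 * y 2 := by
  rw [PiLp.inner_apply, Fin.sum_univ_three]
  simp [mul_comm]

theorem cross_apply_zero (a b : E3) : cross a b 0 = a 1 * b 2 - a 2 * b 1 := by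
  simp [cross, cross_apply]

theorem cross_apply_one (a b : E3) : cross a b 1 = a 2 * b 0 - a 0 * b 2 := by
  simp [cross, cross_apply]

theorem cross_apply_two (a b : E3) : cross a b 2 = a 0 * b 1 - a 1 * b 0 := by
  simp [cross, cross_apply]

theorem inner_cross_left (a b : E3) : inner ℝ (cross a b) a = (0 : ℝ) := by
  rw [inner_eq_coord₃, cross_apply_zero, cross_apply_one, cross_apply_two]; ring

theorem inner_cross_right (a b : E3) : inner ℝ (cross a b) b = (0 : ℝ) := by
  rw [inner_eq_coord₃, cross_apply_zero, cross_apply_one, cross_apply_two]; ring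

theorem IsReg.cross {Ω : Set E2} (hΩ : IsOpen Ω) (hq : IsQuasiconvex Ω) {k : ℕ} {a b : E2 → E3}
    (ha : IsReg Ω k a) (hb : IsReg Ω k b) : IsReg Ω k (fun x => cross (a x) (b x)) := by
  have h : ∀ i j i' j', IsReg Ω k fun x => a x i * b x j - a x i' * b x j' := fun i j i' j' =>
    ((ha.coord hΩ i).mul hΩ hq (hb.coord hΩ j)).sub hΩ
      ((ha.coord hΩ i').mul hΩ hq (hb.coord hΩ j'))
  refine IsReg.of_coord hΩ fun i => ?_
  fin_cases i
  · exact (h 1 2 2 1).congr hΩ fun x _ => cross_apply_zero _ _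
  · exact (h 2 0 0 2).congr hΩ fun x _ => cross_apply_one _ _
  · exact (h 0 1 1 0).congr hΩ fun x _ => cross_apply_two _ _

theorem pder_comm {Ω : Set E2} (hΩ : IsOpen Ω) {k : ℕ} {f : E2 → E3} (h : IsReg Ω (k + 2) f)
    {x : E2} (hx : x ∈ Ω) (i j : Fin 2) : pder (pder f i) j x = pder (pder f j) i x := by
  have e : ∀ i j, pder (pder f i) j x =
      fderiv ℝ (fderiv ℝ f) x (EuclideanSpace.single j 1) (EuclideanSpace.single i 1) := by
    intro i j
    have := dd_dd hΩ h (X := fun _ => EuclideanSpace.single j 1)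
      (Y := fun _ => EuclideanSpace.single i 1) hx (differentiableAt_const _)
    rw [pder_eq_dd, pder_eq_dd, this]
    simp [dd]
  rw [e, e, fderiv_fderiv_symm hΩ h hx]

/-- The second derivatives of an isometric immersion are normal to the surface. -/
theorem inner_pder_pder_eq_zero {Ω : Set E2} (hΩ : IsOpen Ω) {k : ℕ} {u : E2 → E3}
    (hu : IsReg Ω (k + 2) u)
    (hm : ∀ x ∈ Ω, ∀ i j, inner ℝ (pder u i x) (pder u j x) = if i = j then (1 : ℝ) else 0)
    {x : E2} (hx : x ∈ Ω) (i j l : Fin 2) :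
    inner ℝ (pder (pder u i) j x) (pder u l x) = (0 : ℝ) := by
  have hd : ∀ i, DifferentiableAt ℝ (pder u i) x := fun i =>
    (hu.partialDeriv i).differentiableAt hΩ hx
  have e : ∀ i j l, (inner ℝ (pder (pder u i) l x) (pder u j x) : ℝ) +
      inner ℝ (pder (pder u j) l x) (pder u i x) = 0 := by
    intro i j l
    have h1 : pder (fun y => (inner ℝ (pder u i y) (pder u j y) : ℝ)) l x = 0 := by
      have : EqOn (fun y => (inner ℝ (pder u i y) (pder u j y) : ℝ))
          (fun _ => if i = j then (1 : ℝ) else 0) Ω := fun y hy => hm y hy i j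
      rw [pder_congr hΩ this l hx]
      simp [pder]
    have h2 := dd_inner (fun _ => EuclideanSpace.single l 1) (hd i) (hd j)
    have h3 : (inner ℝ (pder (pder u i) l x) (pder u j x) : ℝ) +
        inner ℝ (pder u i x) (pder (pder u j) l x) = 0 := h2.symm.trans h1
    rw [real_inner_comm (pder u i x)]
    exact h3
  have c := fun i j => pder_comm hΩ hu hx i j
  have e1 := e i l j
  have e2 := e l j i
  have e3 := e j i l
  rw [c j i] at e2
  rw [c j l, c i l] at e3
  linarith

/-- A symmetric matrix whose kernel contains `perp t` is a multiple of `t ⊗ t`. -/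
theorem eq_trace_mul_of_kernel {t : E2} (ht : ‖t‖ = 1) {A : Fin 2 → Fin 2 → ℝ}
    (hs : A 0 1 = A 1 0) (hk : ∀ i, perp t 0 * A 0 i + perp t 1 * A 1 i = 0) (i j : Fin 2) :
    A i j = (A 0 0 + A 1 1) * (t i * t j) := by
  have hu := unit_sq ht
  have h0 := hk 0
  have h1 := hk 1
  rw [perp_zero, perp_one] at h0 h1
  rw [hs] at h1
  fin_cases i <;> fin_cases j <;> simp only [Fin.zero_eta, Fin.mk_one, hs]
  · linear_combination (-A 0 0) * hu - (t 1) * h0 - (t 0) * h1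
  · linear_combination (-A 1 0) * hu + (t 0) * h0 - (t 1) * h1
  · linear_combination (-A 1 0) * hu + (t 0) * h0 - (t 1) * h1
  · linear_combination (-A 1 1) * hu + (t 1) * h0 + (t 0) * h1

namespace DevelopableChart

variable {S : Set E3} (D : DevelopableChart S)

/-- The rows of the moving frame. -/
def row (i : Fin 3) (t : ℝ) : E3 := WithLp.toLp 2 (D.r t i)

theorem inner_row {t : ℝ} (ht : t ∈ Icc 0 D.T) (i j : Fin 3) :
    inner ℝ (D.row i t) (D.row j t) = if i = j then (1 : ℝ) else 0 := by
  have h := (Matrix.mem_orthogonalGroup_iff (Fin 3) ℝ).1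
    (Matrix.mem_specialOrthogonalGroup_iff.1 (D.r_mem t ht)).1
  have h1 := congrFun (congrFun h i) j
  rw [Matrix.mul_apply, Fin.sum_univ_three, Matrix.one_apply] at h1
  rw [inner_eq_coord₃, ← h1]
  simp [row]

theorem continuousOn_row (i : Fin 3) : ContinuousOn (D.row i) (Icc 0 D.T) := by
  have h : ContinuousOn (fun t => D.r t i) (Icc 0 D.T) := by
    refine continuousOn_pi.2 fun j => ?_
    have := (D.r_ac i j).continuousOn
    rwa [uIcc_of_le D.T_pos.le] at this
  exact (PiLp.continuous_toLp 2 (fun _ : Fin 3 => ℝ)).comp_continuousOn h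

theorem isAdmissible : D.toPlanarData.Admissible := D.admissible

theorem u_Φ {s t : ℝ} (h : (s, t) ∈ D.M) :
    D.u (D.Φ (s, t)) = (∫ τ in (0 : ℝ)..t, D.row 0 τ) + s • D.row 1 t := D.u_eq (s, t) h

theorem fderiv_normal (hd : DifferentiableOn ℝ D.u D.Ω) (hΩ : IsOpen D.Ω) {s t : ℝ}
    (h : (s, t) ∈ D.M) :
    fderiv ℝ D.u (D.Φ (s, t)) (D.normal t) = D.row 1 t := by
  have hx : D.Φ (s, t) ∈ D.Ω := mem_image_of_mem _ h
  have hdx := ((hd _ hx).differentiableAt (hΩ.mem_nhds hx)).hasFDerivAt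
  have h1 : HasDerivAt (fun σ : ℝ => D.Φ (σ, t)) (D.normal t) s := by
    have : HasDerivAt (fun σ : ℝ => D.Γ t + σ • D.normal t) ((1 : ℝ) • D.normal t) s :=
      ((hasDerivAt_id s).smul_const (D.normal t)).const_add (D.Γ t)
    rwa [one_smul] at this
  have h2 : HasDerivAt (fun σ : ℝ => D.u (D.Φ (σ, t))) _ s := hdx.comp_hasDerivAt s h1
  have h3 : HasDerivAt (fun σ : ℝ => (∫ τ in (0 : ℝ)..t, D.row 0 τ) + σ • D.row 1 t)
      (D.row 1 t) s := by
    have := ((hasDerivAt_id s).smul_const (D.row 1 t)).const_add (∫ τ in (0 : ℝ)..t, D.row 0 τ)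
    simpa using this
  refine h2.unique (h3.congr_of_eventuallyEq ?_)
  filter_upwards [D.eventually_mem_M' h] with σ hσ using D.u_Φ hσ

theorem hasDerivAt_curve {t : ℝ} (ht : t ∈ Ioo 0 D.T) :
    HasDerivAt (fun t => ∫ τ in (0 : ℝ)..t, D.row 0 τ) (D.row 0 t) t := by
  have hc := D.continuousOn_row 0
  refine intervalIntegral.integral_hasDerivAt_right ?_ ?_ ?_
  · refine ContinuousOn.intervalIntegrable (hc.mono ?_)
    rw [uIcc_of_le ht.1.le]
    exact Icc_subset_Icc_right ht.2.le
  · exact (hc.mono Ioo_subset_Icc_self).stronglyMeasurableAtFilter isOpen_Ioo t ht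
  · exact hc.continuousAt (Icc_mem_nhds ht.1 ht.2)

/-- The parameters at which the tangent and the moving frame are differentiable, with the
derivatives given by the Frenet equations. -/
def IsGoodParam (t : ℝ) : Prop :=
  HasDerivAt D.normal (-(D.curvature t • D.tangent t)) t ∧
    HasDerivAt (D.row 1) (-(D.curvature t • D.row 0 t)) t

theorem ae_isGoodParam : ∀ᵐ t : ℝ, t ∈ Ioo 0 D.T → D.IsGoodParam t := by
  obtain ⟨L, hL⟩ := D.Γ_lip
  have h1 := hL.ae_differentiableWithinAt_of_mem (μ := volume)
  have h2 := (ae_restrict_iff' measurableSet_Ioo).1 D.r_ode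
  filter_upwards [h1, h2] with t ht1 ht2 ht
  have hnh : Icc 0 D.T ∈ 𝓝 t := Icc_mem_nhds ht.1 ht.2
  have hT : HasDerivAt D.tangent (deriv D.tangent t) t :=
    ((ht1 (Ioo_subset_Icc_self ht)).differentiableAt hnh).hasDerivAt
  refine ⟨?_, ?_⟩
  · have hT1 := D.norm_tangent (Ioo_subset_Icc_self ht)
    have h0 : (inner ℝ (D.tangent t) (deriv D.tangent t) : ℝ) = 0 := by
      have e1 := hT.inner ℝ hT
      have e2 : HasDerivAt (fun t => (inner ℝ (D.tangent t) (D.tangent t) : ℝ)) 0 t := by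
        refine (hasDerivAt_const t (1 : ℝ)).congr_of_eventuallyEq ?_
        filter_upwards [hnh] with t' ht'
        rw [real_inner_self_eq_norm_sq, D.norm_tangent ht', one_pow]
      have e3 := e1.unique e2
      rw [real_inner_comm (D.tangent t) (deriv D.tangent t)] at e3
      linarith
    have e : deriv D.tangent t = D.curvature t • D.normal t := by
      have := frame_expand hT1 (deriv D.tangent t)
      rw [h0, zero_smul, zero_add, real_inner_comm] at this
      exact this
    have h3 : HasDerivAt D.normal (perpL (deriv D.tangent t)) t :=
      perpL.hasFDerivAt.comp_hasDerivAt t hT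
    rw [e, map_smul, perpL_apply, PlanarData.normal, perp_perp, smul_neg] at h3
    exact h3
  · have h3 : HasDerivAt (fun τ => D.r τ 1) (-(D.curvature t • D.r t 0)) t := by
      refine hasDerivAt_pi.2 fun j => ?_
      have := ht2 ht 1 j
      rw [Matrix.mul_apply, Fin.sum_univ_three] at this
      simpa using this
    have h4 := (PiLp.continuousLinearEquiv 2 ℝ (fun _ : Fin 3 => ℝ)).symm.hasFDerivAt.comp_hasDerivAt
      t h3
    exact h4

/-- At almost all parameters the derivative across the rulings follows from the Frenet
equations; those points at which `1 - sκ = 0` are reached by continuity along the ruling. -/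
theorem fderiv_tangent_of_isGoodParam (hd : DifferentiableOn ℝ D.u D.Ω) (hΩ : IsOpen D.Ω)
    (hc : ContinuousOn (fderiv ℝ D.u) D.Ω) {s t : ℝ} (h : (s, t) ∈ D.M) (hg : D.IsGoodParam t) :
    fderiv ℝ D.u (D.Φ (s, t)) (D.tangent t) = D.row 0 t := by
  have key : ∀ σ, (σ, t) ∈ D.M → (1 - σ * D.curvature t) •
      (fderiv ℝ D.u (D.Φ (σ, t)) (D.tangent t) - D.row 0 t) = 0 := by
    intro σ hσ
    have hx : D.Φ (σ, t) ∈ D.Ω := mem_image_of_mem _ hσ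
    have hdx := ((hd _ hx).differentiableAt (hΩ.mem_nhds hx)).hasFDerivAt
    have h1 : HasDerivAt (fun τ : ℝ => D.Φ (σ, τ))
        (D.tangent t + σ • -(D.curvature t • D.tangent t)) t :=
      (D.hasDerivAt_Γ h.1).add (hg.1.const_smul σ)
    have h2 : HasDerivAt (fun τ : ℝ => D.u (D.Φ (σ, τ))) _ t := hdx.comp_hasDerivAt t h1
    have h3 : HasDerivAt (fun τ : ℝ => (∫ τ' in (0 : ℝ)..τ, D.row 0 τ') + σ • D.row 1 τ)
        (D.row 0 t + σ • -(D.curvature t • D.row 0 t)) t :=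
      (D.hasDerivAt_curve h.1).add (hg.2.const_smul σ)
    have h4 := h2.unique (h3.congr_of_eventuallyEq (by
      filter_upwards [D.eventually_mem_M hσ] with τ hτ using D.u_Φ hτ))
    have e1 : D.tangent t + σ • -(D.curvature t • D.tangent t) =
        (1 - σ * D.curvature t) • D.tangent t := by module
    have e2 : D.row 0 t + σ • -(D.curvature t • D.row 0 t) =
        (1 - σ * D.curvature t) • D.row 0 t := by module
    rw [e1, e2, map_smul] at h4
    rw [smul_sub, h4, sub_self]
  have hx : D.Φ (s, t) ∈ D.Ω := mem_image_of_mem _ h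
  have hcont : ContinuousAt
      (fun σ : ℝ => fderiv ℝ D.u (D.Φ (σ, t)) (D.tangent t) - D.row 0 t) s := by
    have h1 : ContinuousAt (fun σ : ℝ => D.Φ (σ, t)) s := by
      have : Continuous fun σ : ℝ => D.Γ t + σ • D.normal t := by fun_prop
      exact this.continuousAt
    have h2 : ContinuousAt (fun σ : ℝ => fderiv ℝ D.u (D.Φ (σ, t))) s :=
      ContinuousAt.comp (f := fun σ : ℝ => D.Φ (σ, t)) (hc.continuousAt (hΩ.mem_nhds hx)) h1
    exact (h2.clm_apply continuousAt_const).sub continuousAt_const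
  have hne : ∀ᶠ σ in 𝓝[≠] s, 1 - σ * D.curvature t ≠ 0 := by
    by_cases h0 : 1 - s * D.curvature t = 0
    · filter_upwards [self_mem_nhdsWithin] with σ hσ h1
      have h2 : (σ - s) * D.curvature t = 0 := by linear_combination h0 - h1
      rcases mul_eq_zero.1 h2 with h3 | h3
      · exact hσ (sub_eq_zero.1 h3)
      · rw [h3] at h0; norm_num at h0
    · have : ContinuousAt (fun σ : ℝ => 1 - σ * D.curvature t) s := by fun_prop
      exact (this.eventually_ne h0).filter_mono nhdsWithin_le_nhds
  refine sub_eq_zero.1 (tendsto_nhds_unique (hcont.tendsto.mono_left nhdsWithin_le_nhds)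
    (tendsto_const_nhds.congr' ?_) (l := 𝓝[≠] s))
  filter_upwards [hne, (D.eventually_mem_M' h).filter_mono nhdsWithin_le_nhds] with σ h1 h2
  exact ((smul_eq_zero.1 (key σ h2)).resolve_left h1).symm

theorem fderiv_tangent (hd : DifferentiableOn ℝ D.u D.Ω) (hΩ : IsOpen D.Ω)
    (hc : ContinuousOn (fderiv ℝ D.u) D.Ω) {s t : ℝ} (h : (s, t) ∈ D.M) :
    fderiv ℝ D.u (D.Φ (s, t)) (D.tangent t) = D.row 0 t := by
  have hx : D.Φ (s, t) ∈ D.Ω := mem_image_of_mem _ h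
  have hnh : Icc 0 D.T ∈ 𝓝 t := Icc_mem_nhds h.1.1 h.1.2
  have cN := D.continuousOn_normal.continuousAt hnh
  have cT := D.continuousOn_tangent.continuousAt hnh
  have cr := (D.continuousOn_row 0).continuousAt hnh
  have cΦ : ContinuousAt (fun τ : ℝ => D.Φ (s, τ)) t :=
    (D.hasDerivAt_Γ h.1).continuousAt.add (cN.const_smul s)
  have hcont : ContinuousAt
      (fun τ : ℝ => fderiv ℝ D.u (D.Φ (s, τ)) (D.tangent τ) - D.row 0 τ) t := by
    have h2 : ContinuousAt (fun τ : ℝ => fderiv ℝ D.u (D.Φ (s, τ))) t :=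
      ContinuousAt.comp (f := fun τ : ℝ => D.Φ (s, τ)) (hc.continuousAt (hΩ.mem_nhds hx)) cΦ
    exact (h2.clm_apply cT).sub cr
  have hfr : ∃ᶠ τ in 𝓝 t, τ ∈ Ioo 0 D.T → D.IsGoodParam τ :=
    mem_closure_iff_frequently.1 (Measure.dense_of_ae D.ae_isGoodParam t)
  have hfr2 := (hfr.and_eventually (D.eventually_mem_M h)).mono (fun τ hτ =>
    show fderiv ℝ D.u (D.Φ (s, τ)) (D.tangent τ) - D.row 0 τ ∈ ({0} : Set E3) from
      sub_eq_zero.2 (D.fderiv_tangent_of_isGoodParam hd hΩ hc hτ.2 (hτ.1 hτ.2.1)))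
  exact sub_eq_zero.1 (isClosed_singleton.mem_of_frequently_of_tendsto hfr2 hcont.tendsto)

/-- The differential of the chart in the frame of the rulings. -/
theorem pder_u (hd : DifferentiableOn ℝ D.u D.Ω) (hΩ : IsOpen D.Ω)
    (hc : ContinuousOn (fderiv ℝ D.u) D.Ω) {x : E2} (hx : x ∈ D.Ω) (i : Fin 2) :
    pder D.u i x = D.field x i • D.row 0 (D.param x).2 +
      rot D.field x i • D.row 1 (D.param x).2 := by
  obtain ⟨h1, h2⟩ := D.param_mem hx
  rw [pder_eq_frame (PlanarData.norm_field hx) D.u i]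
  have e1 : dd D.field D.u x = D.row 0 (D.param x).2 := by
    have := D.fderiv_tangent hd hΩ hc (s := (D.param x).1) (t := (D.param x).2) h1
    rw [Prod.mk.eta, h2] at this
    exact this
  have e2 : dd (rot D.field) D.u x = D.row 1 (D.param x).2 := by
    have := D.fderiv_normal hd hΩ (s := (D.param x).1) (t := (D.param x).2) h1
    rw [Prod.mk.eta, h2] at this
    exact this
  rw [e1, e2]

/-- A developable chart of class `C^{k+4,1}` with mean curvature bounded away from zero is a ruled
isometry, the unit tangent field being of class `C^{k+2,1}`. -/
theorem exists_isRuledIsometry {k : ℕ} (hS : IsReg D.Ω (k + 4) D.u)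
    (hH : D.MeanCurvatureBoundedBelow) :
    ∃ T s n η, IsRuledIsometry D.Ω (k + 1) T s D.u n η := by
  have hΩ : IsOpen D.Ω := D.lipschitzDomain.isOpen
  have hq : IsQuasiconvex D.Ω := D.lipschitzDomain.isQuasiconvex
  have hpu := fun {x : E2} (hx : x ∈ D.Ω) (i : Fin 2) =>
    D.pder_u hS.differentiableOn hΩ hS.continuousOn_fderiv hx i
  have hmetric : ∀ x ∈ D.Ω, ∀ i j,
      inner ℝ (pder D.u i x) (pder D.u j x) = if i = j then (1 : ℝ) else 0 := by
    intro x hx i j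
    have hI := Ioo_subset_Icc_self (D.param_mem hx).1.1
    have hu := unit_sq (PlanarData.norm_field hx)
    rw [hpu hx, hpu hx]
    simp only [inner_add_left, inner_add_right, inner_smul_left, inner_smul_right,
      D.inner_row hI, RCLike.conj_to_real]
    fin_cases i <;> fin_cases j <;> simp [rot] <;> linarith
  set n : E2 → E3 := fun x => cross (pder D.u 0 x) (pder D.u 1 x) with hn_def
  have hn : IsReg D.Ω (k + 3) n := (hS.partialDeriv 0).cross hΩ hq (hS.partialDeriv 1)
  -- The gradient of `u` is constant along the rulings.
  have hkernel : ∀ x ∈ D.Ω, ∀ i, rot D.field x 0 • pder (pder D.u i) 0 x +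
      rot D.field x 1 • pder (pder D.u i) 1 x = 0 := by
    intro x hx i
    rw [← dd_eq]
    obtain ⟨hzM, hzx⟩ := D.param_mem hx
    have hdi := ((hS.partialDeriv i).differentiableAt hΩ hx).hasFDerivAt
    have h1 : HasDerivAt (fun τ : ℝ => x + τ • rot D.field x) (rot D.field x) 0 := by
      simpa using ((hasDerivAt_id (0 : ℝ)).smul_const (rot D.field x)).const_add x
    have h2 : HasDerivAt (fun τ : ℝ => pder D.u i (x + τ • rot D.field x))
        (dd (rot D.field) (pder D.u i) x) 0 :=
      hdi.comp_hasDerivAt_of_eq 0 h1 (by simp)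
    refine h2.unique ((hasDerivAt_const (0 : ℝ) (pder D.u i x)).congr_of_eventuallyEq ?_)
    have hc : Tendsto (fun τ : ℝ => (D.param x).1 + τ) (𝓝 0) (𝓝 (D.param x).1) := by
      have : ContinuousAt (fun τ : ℝ => (D.param x).1 + τ) 0 := by fun_prop
      simpa [ContinuousAt] using this
    filter_upwards [hc.eventually (D.eventually_mem_M' hzM)] with τ hτ
    have hm : ((D.param x).1 + τ, (D.param x).2) ∈ D.M := hτ
    have e : x + τ • rot D.field x = D.Φ ((D.param x).1 + τ, (D.param x).2) := by
      rw [← PlanarData.add_smul_normal, hzx, PlanarData.rot_field]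
    have e2 : D.param (x + τ • rot D.field x) = ((D.param x).1 + τ, (D.param x).2) := by
      rw [e, D.isAdmissible.param_Φ hm]
    have e3 : x + τ • rot D.field x ∈ D.Ω := by rw [e]; exact mem_image_of_mem _ hm
    have e4 : D.field (x + τ • rot D.field x) = D.field x := by
      rw [PlanarData.field, e2, PlanarData.field]
    have e5 : rot D.field (x + τ • rot D.field x) = rot D.field x := congrArg perp e4
    rw [hpu e3, hpu hx, e4, e5, e2]
  -- The second fundamental form is `A = η T ⊗ T`, so that `T ⊗ T = A / η` is regular.
  set A : E2 → Fin 2 → Fin 2 → ℝ := fun x i j => inner ℝ (n x) (pder (pder D.u j) i x) with hA_def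
  have hA : ∀ i j, IsReg D.Ω (k + 2) fun x => A x i j := fun i j =>
    (hn.of_succ hΩ hq).innerProd hΩ hq ((hS.partialDeriv j).partialDeriv i)
  set η : E2 → ℝ := fun x => A x 0 0 + A x 1 1 with hη_def
  have hη : IsReg D.Ω (k + 2) η := (hA 0 0).add hΩ (hA 1 1)
  have hAη : ∀ x ∈ D.Ω, ∀ i j, A x i j = η x * (D.field x i * D.field x j) := by
    intro x hx i j
    refine eq_trace_mul_of_kernel (PlanarData.norm_field hx) ?_ (fun i => ?_) i j
    · simp only [hA_def]
      rw [pder_comm hΩ (k := k + 2) hS hx]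
    · have := congrArg (fun v => (inner ℝ (n x) v : ℝ)) (hkernel x hx i)
      simp only [inner_add_right, inner_smul_right, inner_zero_right] at this
      exact this
  obtain ⟨c, hc0, hc⟩ := hH
  have hcη : ∀ x ∈ D.Ω, c ≤ |η x| := fun x hx => hc x hx
  have htensor : ∀ i j, IsReg D.Ω (k + 2) fun y => D.field y i * D.field y j := fun i j => by
    refine ((hA i j).mul hΩ hq (hη.inv hΩ hq hc0 hcη)).congr hΩ fun x hx => ?_
    have hne : η x ≠ 0 := fun h0 => by
      have := hcη x hx
      rw [h0, abs_zero] at this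
      linarith
    simp only
    rw [hAη x hx]
    field_simp
  refine ⟨D.field, fun y => (D.param y).1, n, η, D.isAdmissible.isRuling hΩ hq htensor, hS,
    hn.of_succ hΩ hq, hη.of_succ hΩ hq, ⟨c, hc0, hcη⟩, hmetric, fun x hx i => ?_,
    fun x hx i j l => inner_pder_pder_eq_zero hΩ (k := k + 2) hS hmetric hx i j l,
    fun x hx i j => ?_⟩
  · fin_cases i
    · exact inner_cross_left _ _
    · exact inner_cross_right _ _
  · have := hAη x hx j i
    rw [mul_comm (D.field x i)]
    exact this

end DevelopableChart

/-! ### The recursive construction -/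

theorem pder_sum {Ω : Set E2} (hΩ : IsOpen Ω) {k : ℕ} {ι : Type} (S : Finset ι) (c : ι → ℝ)
    {W : ι → E2 → E3} (hW : ∀ a ∈ S, IsReg Ω (k + 1) (W a)) {x : E2} (hx : x ∈ Ω) (i : Fin 2) :
    pder (fun x => ∑ a ∈ S, c a • W a x) i x = ∑ a ∈ S, c a • pder (W a) i x := by
  simp only [pder]
  rw [fderiv_fun_sum fun a ha => ((hW a ha).differentiableAt hΩ hx).fun_const_smul (c a)]
  rw [_root_.sum_apply]
  refine Finset.sum_congr rfl fun a ha => ?_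
  rw [fderiv_fun_const_smul ((hW a ha).differentiableAt hΩ hx)]
  rfl

/-- Linear combinations of finitely many `C^{1,1}` maps with bounded coefficients are
equibounded in `C^{1,1}`. -/
theorem exists_uniform_isCkLipWith {Ω : Set E2} (hΩ : IsOpen Ω) (S : Finset ℕ) {W : ℕ → E2 → E3}
    (hW : ∀ a ∈ S, IsReg Ω 1 (W a)) :
    ∃ K, ∀ c : ℕ → ℝ, (∀ a, |c a| ≤ 1) → IsCkLipWith 1 K (fun x => ∑ a ∈ S, c a • W a x) Ω := by
  have h : ∀ a ∈ S, ∃ K ≥ 0, (∀ x ∈ Ω, ‖W a x‖ ≤ K) ∧ (∀ x ∈ Ω, ‖fderiv ℝ (W a) x‖ ≤ K) ∧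
      ∀ x ∈ Ω, ∀ y ∈ Ω, ‖fderiv ℝ (W a) x - fderiv ℝ (W a) y‖ ≤ K * ‖x - y‖ := by
    intro a ha
    obtain ⟨K0, h0⟩ := (hW a ha).bdd
    obtain ⟨K1, h1⟩ := (hW a ha).fderiv_bdd
    obtain ⟨K2, h2⟩ := (hW a ha).fderiv_lipschitz
    refine ⟨|K0| + |K1| + |K2|, by positivity, fun x hx => (h0 x hx).trans ?_,
      fun x hx => (h1 x hx).trans ?_, fun x hx y hy => (h2 x hx y hy).trans ?_⟩
    · linarith [le_abs_self K0, abs_nonneg K1, abs_nonneg K2]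
    · linarith [le_abs_self K1, abs_nonneg K0, abs_nonneg K2]
    · gcongr
      linarith [le_abs_self K2, abs_nonneg K0, abs_nonneg K1]
  choose! K hK0 h0 h1 h2 using h
  refine ⟨∑ a ∈ S, K a, fun c hc => ?_⟩
  have hreg : IsReg Ω 1 (fun x => ∑ a ∈ S, c a • W a x) :=
    IsReg.sum hΩ S fun a ha => (hW a ha).const_smul hΩ (c a)
  have hfd : ∀ x ∈ Ω, fderiv ℝ (fun x => ∑ a ∈ S, c a • W a x) x =
      ∑ a ∈ S, c a • fderiv ℝ (W a) x := by
    intro x hx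
    rw [fderiv_fun_sum fun a ha => ((hW a ha).differentiableAt hΩ hx).fun_const_smul (c a)]
    exact Finset.sum_congr rfl fun a ha =>
      fderiv_fun_const_smul ((hW a ha).differentiableAt hΩ hx) (c a)
  have hle : ∀ {G : Type} [NormedAddCommGroup G] [NormedSpace ℝ G] (v : G) (a : ℕ),
      ‖c a • v‖ ≤ ‖v‖ := by
    intro G _ _ v a
    rw [norm_smul]
    exact mul_le_of_le_one_left (norm_nonneg _) (hc a)
  refine isCkLipWith_one hΩ hreg.2.1 hreg.continuousOn_fderiv (fun x hx => ?_) (fun x hx => ?_)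
    fun x hx y hy => ?_
  · exact norm_sum_le_of_le _ fun a ha => (hle _ a).trans (h0 a ha x hx)
  · rw [hfd x hx]
    exact norm_sum_le_of_le _ fun a ha => (hle _ a).trans (h1 a ha x hx)
  · rw [hfd x hx, hfd y hy, ← Finset.sum_sub_distrib, Finset.sum_mul]
    refine norm_sum_le_of_le _ fun a ha => ?_
    have e : c a • fderiv ℝ (W a) x - c a • fderiv ℝ (W a) y =
        c a • (fderiv ℝ (W a) x - fderiv ℝ (W a) y) := (smul_sub _ _ _).symm
    rw [e]
    exact (hle _ a).trans (h2 a ha x hx y hy)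

/-- The coefficient of `ε^j` in the metric induced by `∑ εᵃ W a`. -/
def metricCoeff (W : ℕ → E2 → E3) (i l : Fin 2) (j : ℕ) (x : E2) : ℝ :=
  ∑ p ∈ Finset.HasAntidiagonal.antidiagonal j, inner ℝ (pder (W p.1) i x) (pder (W p.2) l x)

theorem metricCoeff_succ (W : ℕ → E2 → E3) (i l : Fin 2) (n : ℕ) (x : E2) :
    metricCoeff W i l (n + 1) x = inner ℝ (pder (W 0) i x) (pder (W (n + 1)) l x) +
      inner ℝ (pder (W (n + 1)) i x) (pder (W 0) l x) +
      ∑ b ∈ Finset.range n, inner ℝ (pder (W (b + 1)) i x) (pder (W (n - b)) l x) := by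
  rw [metricCoeff, Finset.Nat.sum_antidiagonal_eq_sum_range_succ
    (fun a b => (inner ℝ (pder (W a) i x) (pder (W b) l x) : ℝ)), Finset.sum_range_succ,
    Finset.sum_range_succ']
  simp only [Nat.sub_zero, Nat.sub_self, Nat.add_sub_add_right]
  ring

/-- The recursive construction of the expansion: each term solves a linearized isometry
equation with right hand side given by the preceding ones, at the cost of two derivatives. -/
theorem IsRuledIsometry.exists_expansion {Ω : Set E2} {M : ℕ} {T : E2 → E2} {s : E2 → ℝ}
    {u nrm : E2 → E3} {η : E2 → ℝ} (h : IsRuledIsometry Ω (2 * M + 1) T s u nrm η) {V : E2 → E3}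
    (hV : IsReg Ω (2 * M + 3) V)
    (hVs : ∀ x ∈ Ω, ∀ i j, (inner ℝ (pder V i x) (pder u j x) +
      inner ℝ (pder V j x) (pder u i x) : ℝ) = 0) (n : ℕ) (hn : n ≤ M + 1) :
    ∃ W : ℕ → E2 → E3, W 0 = u ∧ W 1 = V ∧
      (∀ a, 1 ≤ a → a ≤ n + 1 → IsReg Ω (2 * M + 5 - 2 * a) (W a)) ∧
      ∀ j ≤ n, ∀ x ∈ Ω, ∀ i l, metricCoeff W i l (j + 1) x = 0 := by
  have hΩ := h.ruling.isOpen
  have hq := h.ruling.quasiconvex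
  induction n with
  | zero =>
    refine ⟨fun a => if a = 0 then u else V, by simp, by simp, fun a h1 h2 => ?_,
      fun j hj x hx i l => ?_⟩
    · obtain rfl : a = 1 := by omega
      simpa using hV
    · obtain rfl : j = 0 := by omega
      rw [metricCoeff_succ]
      have := hVs x hx l i
      rw [real_inner_comm (pder u i x)] at this
      simpa using this
  | succ n ih =>
    obtain ⟨W, hW0, hW1, hWr, hWm⟩ := ih (by omega)
    have hreg : ∀ a, 1 ≤ a → a ≤ n + 1 → IsReg Ω (2 * M - 2 * n + 3) (W a) := fun a h1 h2 =>
      (hWr a h1 h2).mono hΩ hq (by omega)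
    have hsol : ∀ b ∈ Finset.range (n + 1), ∃ w : E2 → E3, IsReg Ω (2 * M - 2 * n + 1) w ∧
        ∀ x ∈ Ω, ∀ i j, (inner ℝ (pder w i x) (pder u j x) +
          inner ℝ (pder w j x) (pder u i x) : ℝ) =
          inner ℝ (pder (W (b + 1)) i x) (pder (W (n + 1 - b)) j x) +
          inner ℝ (pder (W (b + 1)) j x) (pder (W (n + 1 - b)) i x) := by
      intro b hb
      rw [Finset.mem_range] at hb
      exact h.exists_solution (k := 2 * M - 2 * n) (by omega) (hreg _ (by omega) (by omega))
        (hreg _ (by omega) (by omega))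
    choose! w hwr hwe using hsol
    -- The factor `1/2` accounts for the two orders in which each product occurs.
    set w' : E2 → E3 := fun x => ∑ b ∈ Finset.range (n + 1), (-(1 / 2) : ℝ) • w b x with hw'
    have hw'r : IsReg Ω (2 * M - 2 * n + 1) w' :=
      IsReg.sum hΩ _ fun b hb => (hwr b hb).const_smul hΩ _
    refine ⟨Function.update W (n + 2) w', by simp [hW0], ?_, fun a h1 h2 => ?_,
      fun j hj x hx i l => ?_⟩
    · rw [Function.update_of_ne (by omega), hW1]
    · by_cases ha : a = n + 2
      · subst ha
        rw [Function.update_self]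
        exact hw'r.mono hΩ hq (by omega)
      · rw [Function.update_of_ne ha]
        exact hWr a h1 (by omega)
    · by_cases hjn : j = n + 1
      · subst hjn
        have e : ∀ a, a ≠ n + 2 → Function.update W (n + 2) w' a = W a := fun a ha =>
          Function.update_of_ne ha _ _
        have hsum : ∑ b ∈ Finset.range (n + 1),
            (inner ℝ (pder (Function.update W (n + 1 + 1) w' (b + 1)) i x)
              (pder (Function.update W (n + 1 + 1) w' (n + 1 - b)) l x) : ℝ) =
            ∑ b ∈ Finset.range (n + 1),
              inner ℝ (pder (W (b + 1)) i x) (pder (W (n + 1 - b)) l x) := by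
          refine Finset.sum_congr rfl fun b hb => ?_
          rw [Finset.mem_range] at hb
          rw [e _ (by omega), e _ (by omega)]
        rw [metricCoeff_succ, hsum, Function.update_self, e 0 (by omega), hW0,
          real_inner_comm _ (pder u i x)]
        have hflip : ∑ b ∈ Finset.range (n + 1),
            (inner ℝ (pder (W (b + 1)) l x) (pder (W (n + 1 - b)) i x) : ℝ) =
            ∑ b ∈ Finset.range (n + 1),
              inner ℝ (pder (W (b + 1)) i x) (pder (W (n + 1 - b)) l x) := by
          rw [← Finset.sum_range_reflect]
          refine Finset.sum_congr rfl fun b hb => ?_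
          rw [Finset.mem_range] at hb
          rw [show n + 1 - 1 - b + 1 = n + 1 - b by omega,
            show n + 1 - (n + 1 - 1 - b) = b + 1 by omega, real_inner_comm]
        have hp : ∀ i, pder w' i x =
            ∑ b ∈ Finset.range (n + 1), (-(1 / 2) : ℝ) • pder (w b) i x := fun i =>
          pder_sum hΩ _ _ hwr hx i
        have hlin : (inner ℝ (pder w' l x) (pder u i x) + inner ℝ (pder w' i x) (pder u l x) : ℝ) =
            -(1 / 2) * ∑ b ∈ Finset.range (n + 1),
              (inner ℝ (pder (w b) l x) (pder u i x) + inner ℝ (pder (w b) i x) (pder u l x)) := by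
          rw [hp, hp, sum_inner, sum_inner, ← Finset.sum_add_distrib, Finset.mul_sum]
          refine Finset.sum_congr rfl fun b _ => ?_
          rw [inner_smul_left, inner_smul_left, RCLike.conj_to_real]
          ring
        rw [hlin, Finset.sum_congr rfl fun b hb => hwe b hb x hx l i, Finset.sum_add_distrib, hflip]
        ring
      · rw [← hWm j (by omega) x hx i l]
        refine Finset.sum_congr rfl fun p hp => ?_
        rw [Finset.HasAntidiagonal.mem_antidiagonal] at hp
        rw [Function.update_of_ne (by omega), Function.update_of_ne (by omega)]

/-- If all coefficients of order `1, …, N` of the induced metric vanish, the metric of the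
truncated expansion differs from the original one by `O(ε^{N+1})`. -/
theorem exists_metric_bound {Ω : Set E2} (hΩ : IsOpen Ω) {N : ℕ} {W : ℕ → E2 → E3}
    (hW : ∀ a ≤ N, IsReg Ω 1 (W a))
    (hm : ∀ j, 1 ≤ j → j ≤ N → ∀ x ∈ Ω, ∀ i l, metricCoeff W i l j x = 0) :
    ∃ C, ∀ ε, 0 < ε → ε ≤ 1 → ∀ x ∈ Ω, ∀ i l,
      |inner ℝ (pder (fun x => ∑ a ∈ Finset.range (N + 1), ε ^ a • W a x) i x)
          (pder (fun x => ∑ a ∈ Finset.range (N + 1), ε ^ a • W a x) l x) -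
        inner ℝ (pder (W 0) i x) (pder (W 0) l x)| ≤ C * ε ^ (N + 1) := by
  have hb : ∀ a ≤ N, ∃ K, ∀ x ∈ Ω, ‖fderiv ℝ (W a) x‖ ≤ K := fun a ha => (hW a ha).fderiv_bdd
  choose! K hK using hb
  set R := Finset.range (N + 1) ×ˢ Finset.range (N + 1) with hR
  refine ⟨∑ p ∈ R with ¬ p.1 + p.2 ≤ N, |K p.1| * |K p.2|, fun ε hε hε1 x hx i l => ?_⟩
  have hW' : ∀ a ∈ Finset.range (N + 1), IsReg Ω 1 (W a) := fun a ha =>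
    hW a (by rw [Finset.mem_range] at ha; omega)
  set G : ℕ × ℕ → ℝ := fun p => inner ℝ (pder (W p.1) i x) (pder (W p.2) l x) with hG
  have hexp : (inner ℝ (pder (fun x => ∑ a ∈ Finset.range (N + 1), ε ^ a • W a x) i x)
      (pder (fun x => ∑ a ∈ Finset.range (N + 1), ε ^ a • W a x) l x) : ℝ) =
      ∑ p ∈ R, ε ^ (p.1 + p.2) * G p := by
    rw [pder_sum hΩ _ (fun a => ε ^ a) hW' hx, pder_sum hΩ _ (fun a => ε ^ a) hW' hx, sum_inner,
      hR, Finset.sum_product]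
    refine Finset.sum_congr rfl fun a _ => ?_
    rw [inner_sum]
    refine Finset.sum_congr rfl fun b _ => ?_
    rw [inner_smul_left, inner_smul_right, RCLike.conj_to_real, pow_add]
    ring
  have hlow : ∑ p ∈ R with p.1 + p.2 ≤ N, ε ^ (p.1 + p.2) * G p =
      inner ℝ (pder (W 0) i x) (pder (W 0) l x) := by
    rw [← Finset.sum_fiberwise_of_maps_to (s := {p ∈ R | p.1 + p.2 ≤ N})
      (t := Finset.range (N + 1)) (g := fun p : ℕ × ℕ => p.1 + p.2)
      (fun p hp => by rw [Finset.mem_filter] at hp; rw [Finset.mem_range]; omega)]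
    have hfib : ∀ j ∈ Finset.range (N + 1),
        ∑ p ∈ {p ∈ R | p.1 + p.2 ≤ N} with p.1 + p.2 = j, ε ^ (p.1 + p.2) * G p =
          ε ^ j * metricCoeff W i l j x := by
      intro j hj
      rw [Finset.mem_range] at hj
      have hset : {p ∈ {p ∈ R | p.1 + p.2 ≤ N} | p.1 + p.2 = j} =
          Finset.HasAntidiagonal.antidiagonal j := by
        ext p
        simp only [hR, Finset.mem_filter, Finset.mem_product, Finset.mem_range,
          Finset.HasAntidiagonal.mem_antidiagonal]
        omega
      rw [hset, metricCoeff, Finset.mul_sum]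
      refine Finset.sum_congr rfl fun p hp => ?_
      rw [Finset.HasAntidiagonal.mem_antidiagonal] at hp
      rw [hp]
    rw [Finset.sum_congr rfl hfib, Finset.sum_range_succ', Finset.sum_eq_zero, zero_add]
    · simp [metricCoeff]
    · intro j hj
      rw [Finset.mem_range] at hj
      rw [hm (j + 1) (by omega) (by omega) x hx, mul_zero]
  rw [hexp, ← Finset.sum_filter_add_sum_filter_not R (fun p : ℕ × ℕ => p.1 + p.2 ≤ N), hlow,
    add_sub_cancel_left, Finset.sum_mul]
  refine (Finset.abs_sum_le_sum_abs _ _).trans (Finset.sum_le_sum fun p hp => ?_)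
  simp only [hR, Finset.mem_filter, Finset.mem_product, Finset.mem_range] at hp
  have hG1 : |G p| ≤ |K p.1| * |K p.2| := by
    refine (abs_real_inner_le_norm _ _).trans ?_
    gcongr
    · exact ((norm_pder_le _ _ _).trans (hK p.1 (by omega) x hx)).trans (le_abs_self _)
    · exact ((norm_pder_le _ _ _).trans (hK p.2 (by omega) x hx)).trans (le_abs_self _)
  rw [abs_mul, abs_of_pos (pow_pos hε _), mul_comm]
  have : ε ^ (p.1 + p.2) ≤ ε ^ (N + 1) := pow_le_pow_of_le_one hε.le hε1 (by omega)
  gcongr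

/-- A truncated expansion with vanishing metric coefficients is a family of infinitesimal
isometries of the form required. -/
theorem exists_family_of_expansion {S : Set E3} (D : DevelopableChart S) {N : ℕ} (hN : 1 ≤ N)
    {V : E2 → E3} {W : ℕ → E2 → E3} (hW0 : W 0 = D.u) (hW1 : W 1 = V)
    (hW : ∀ a ≤ N, IsReg D.Ω 1 (W a))
    (hm : ∀ j, 1 ≤ j → j ≤ N → ∀ x ∈ D.Ω, ∀ i l, metricCoeff W i l j x = 0) :
    ∃ w : ℝ → E2 → E3,
      (∃ K : ℝ, ∀ ε > 0, IsCkLipWith 1 K (w ε) D.Ω) ∧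
      (∀ ε > 0, IsCkLip 1 (fun x => D.u x + ε • V x + ε ^ 2 • w ε x) D.Ω) ∧
      D.IsInfinitesimalIsometry N (fun ε x => D.u x + ε • V x + ε ^ 2 • w ε x) := by
  have hΩ : IsOpen D.Ω := D.lipschitzDomain.isOpen
  have hq : IsQuasiconvex D.Ω := D.lipschitzDomain.isQuasiconvex
  have hWs : ∀ a ∈ Finset.range (N - 1), IsReg D.Ω 1 (W (a + 2)) := fun a ha =>
    hW _ (by rw [Finset.mem_range] at ha; omega)
  -- Capping `ε` at `1` in the coefficients keeps the family bounded for large `ε`.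
  set w : ℝ → E2 → E3 := fun ε x => ∑ a ∈ Finset.range (N - 1), (min ε 1) ^ a • W (a + 2) x with hw
  have hu1 : IsReg D.Ω 1 D.u := hW0 ▸ hW 0 (by omega)
  have hV1 : IsReg D.Ω 1 V := hW1 ▸ hW 1 hN
  have hwr : ∀ ε, IsReg D.Ω 1 (w ε) := fun ε =>
    IsReg.sum hΩ _ fun a ha => (hWs a ha).const_smul hΩ _
  have hφ : ∀ ε, IsReg D.Ω 1 (fun x => D.u x + ε • V x + ε ^ 2 • w ε x) := fun ε =>
    (hu1.add hΩ (hV1.const_smul hΩ ε)).add hΩ ((hwr ε).const_smul hΩ _)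
  obtain ⟨C, hC⟩ := exists_metric_bound hΩ hW hm
  refine ⟨w, ?_, fun ε _ => ?_, fun ε _ => ((hφ ε).mono hΩ hq (Nat.zero_le _)).isCkLip_zero, C, ?_⟩
  · obtain ⟨K, hK⟩ := exists_uniform_isCkLipWith hΩ _ hWs
    refine ⟨K, fun ε hε => hK (fun a => (min ε 1) ^ a) fun a => ?_⟩
    have h0 : 0 ≤ min ε 1 := le_min hε.le zero_le_one
    rw [abs_of_nonneg (pow_nonneg h0 a)]
    exact pow_le_one₀ h0 (min_le_right _ _)
  · obtain ⟨K, -, hK⟩ := (hφ ε).exists_isCkLipWith_one hΩ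
    exact ⟨K, hK⟩
  · filter_upwards [Ioo_mem_nhdsGT (zero_lt_one' ℝ)] with ε hε
    refine ae_restrict_of_forall_mem hΩ.measurableSet fun x hx i l => ?_
    have e : (fun x => D.u x + ε • V x + ε ^ 2 • w ε x) =
        fun x => ∑ a ∈ Finset.range (N + 1), ε ^ a • W a x := by
      funext x
      obtain ⟨N, rfl⟩ : ∃ N', N = N' + 1 := ⟨N - 1, by omega⟩
      rw [Finset.sum_range_succ', Finset.sum_range_succ', hW0]
      simp only [hw, min_eq_left hε.2.le, Nat.add_sub_cancel, Finset.smul_sum, smul_smul, hW1,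
        zero_add, pow_one, pow_zero, one_smul, add_assoc, one_add_one_eq_two, ← pow_add]
      rw [add_comm (∑ a ∈ Finset.range N, _)]
      simp only [add_comm 2, ← add_assoc]
      abel
    have h1 := hC ε hε.1 hε.2.le x hx i l
    rw [← e, hW0] at h1
    exact h1

end DevSurf

end

theorem theorem4p3 {S : Set DevSurf.E3} (D : DevSurf.DevelopableChart S) (N : ℕ) (hN : 1 ≤ N)
    (hS : D.IsOfClass (2 * N)) (hH : D.MeanCurvatureBoundedBelow)
    (V : DevSurf.E2 → DevSurf.E3) (hV : DevSurf.IsCkLip (2 * N - 1) V D.Ω)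
    (hVsym : D.IsFirstOrderIsometry V) :
    ∃ w : ℝ → DevSurf.E2 → DevSurf.E3,
      (∃ K : ℝ, ∀ ε > 0, DevSurf.IsCkLipWith 1 K (w ε) D.Ω) ∧
      (∀ ε > 0, DevSurf.IsCkLip 1 (fun x => D.u x + ε • V x + ε ^ 2 • w ε x) D.Ω) ∧
      D.IsInfinitesimalIsometry N (fun ε x => D.u x + ε • V x + ε ^ 2 • w ε x) := by
  have hΩ : IsOpen D.Ω := D.lipschitzDomain.isOpen
  have hq : DevSurf.IsQuasiconvex D.Ω := D.lipschitzDomain.isQuasiconvex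
  have hu := DevSurf.IsCkLip.isReg hΩ hS
  have hVr := DevSurf.IsCkLip.isReg hΩ hV
  have hVs : ∀ x ∈ D.Ω, ∀ i j, (inner ℝ (DevSurf.pder V i x) (DevSurf.pder D.u j x) +
      inner ℝ (DevSurf.pder V j x) (DevSurf.pder D.u i x) : ℝ) = 0 := fun x hx i j => by
    have h1 := hVsym x hx i j
    have h2 : (inner ℝ (DevSurf.pder V i x) (DevSurf.pder D.u j x) +
      inner ℝ (DevSurf.pder V j x) (DevSurf.pder D.u i x) : ℝ) / 2 = 0 := h1
    linarith
  -- For `N = 1` no correction is needed, and the chart is not regular enough for the construction.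
  by_cases hN1 : N = 1
  · subst hN1
    refine DevSurf.exists_family_of_expansion D le_rfl (W := fun a => if a = 0 then D.u else V)
      (by simp) (by simp) (fun a ha => ?_) fun j h1 h2 x hx i l => ?_
    · interval_cases a
      · simpa using hu.mono hΩ hq (l := 1) (by omega)
      · simpa using hVr
    · obtain rfl : j = 0 + 1 := by omega
      rw [DevSurf.metricCoeff_succ]
      have := hVs x hx l i
      rw [real_inner_comm (DevSurf.pder D.u i x)] at this
      simpa using this
  · obtain ⟨M, rfl⟩ : ∃ M, N = M + 2 := ⟨N - 2, by omega⟩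
    obtain ⟨T, s, n, η, h⟩ := D.exists_isRuledIsometry (k := 2 * M) (hu.mono hΩ hq (by omega)) hH
    obtain ⟨W, hW0, hW1, hWr, hWm⟩ :=
      h.exists_expansion (M := M) (hVr.mono hΩ hq (by omega)) hVs (M + 1) le_rfl
    refine DevSurf.exists_family_of_expansion D hN hW0 hW1 (fun a ha => ?_)
      fun j h1 h2 x hx i l => ?_
    · rcases Nat.eq_zero_or_pos a with rfl | ha0
      · rw [hW0]; exact hu.mono hΩ hq (by omega)
      · exact (hWr a ha0 (by omega)).mono hΩ hq (by omega)
    · obtain ⟨j, rfl⟩ : ∃ j', j = j' + 1 := ⟨j - 1, by omega⟩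
      exact hWm j (by omega) x hx i l
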